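/- **Setting.** Let $K\ge 1$, $s\ge 1$, $n_T\le n_S$, $N=Kn_S+n_T$. For tasks $k=0$ (target, sample size $n_0=n_T$) and $k=1,\dots,K$ (sources, sample size $n_k=n_S$) we observe $y^{(k)}_i=\langle X^{(k)}_i,\beta^{(k)}\rangle+\epsilon^{(k)}_i$, $1\le i\le n_k$, with $\beta^{(k)}\in\mathbb R^p$, $\|\beta^{(0)}\|_0\le s$ and $\|\beta^{(k)}-\beta^{(0)}\|_1\le h_k$ for $1\le k\le K$. Put $\bar h=\frac{n_S}{N}\sum_{k=1}^K h_k$. Assume: (i) for each $k$ the rows $X^{(k)}_i$ are independent, sub-Gaussian with a common constant $\kappa$ (that is, $\mathbb E\,e^{t\langle u,X^{(k)}_i\rangle}\le e^{\kappa\|u\|_2^2t^2/2}$ for all $u\in\mathbb R^p$, $t\in\mathbb R$), centred, with covariance matrix $\Sigma^{(k)}$ whose eigenvalues lie in $[1/c,c]$; (ii) the errors $\epsilon^{(k)}_i$ are independent centred Gaussian variables with variances at most $\sigma^2$, independent of the designs. For tuning parameters $\lambda_0,a_k,\tilde\lambda$ let $$\hat\beta\in\arg\min_{(b^{(0)},\dots,b^{(K)})}\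 \frac1{2N}\sum_{k=0}^K\sum_{i=1}^{n_k}\big(y^{(k)}_i-\langle X^{(k)}_i,b^{(k)}\rangle\big)^2+\lambda_0\Big(\|b^{(0)}\|_1+\sum_{k=1}^K a_k\|b^{(k)}-b^{(0)}\|_1\Big),$$ $$\hat w=\frac{n_S}{N}\sum_{k=1}^K\hat\beta^{(k)}+\frac{n_T}{N}\hat\beta^{(0)},\qquad \hat\delta\in\arg\min_{\delta\in\mathbb R^p}\ \frac1{2n_T}\sum_{i=1}^{n_T}\big(y^{(0)}_i-\langle X^{(0)}_i,\hat w\rangle-\langle X^{(0)}_i,\delta\rangle\big)^2+\tilde\lambda\|\delta\|_1,$$ and let $\hat\beta_{\mathrm{TF}}=\hat w+\hat\delta$ be the two-step TransFusion estimator. **Theorem.** For all constants $c,C_T,C_S>0$ and $\sigma,\kappa\ge 0$ there are constants $c_0,c_1,c_2,c_3,C,\eta>0$, depending only on $c,\sigma,\kappa,C_T,C_S$, such that the following holds for every instance of the above setting with $$ s\log p\le C_T\,n_T,\qquad K^2s\log p\le C_S\,n_S,\qquad \bar h\sqrt{\frac{\log p}{n_T}}+\frac{Ks\log p}{n_S}\le\eta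 .$$ Let $A$ be the (deterministic) event $\{s\log p/n_S\ge\bar h\sqrt{\log p/n_T}\}$, and choose $$\lambda_0=c_0\Big(\sqrt{\tfrac{\log p}{N}}\,\mathbb 1_A+\sqrt{\tfrac{\log p}{n_S}}\,\mathbb 1_{A^c}\Big),\quad a_k=8\Big(\sqrt{\tfrac{n_S}{N}}\,\mathbb 1_A+\tfrac{n_S}{N}\,\mathbb 1_{A^c}\Big),\quad \tilde\lambda=c_1\sqrt{\tfrac{\log p}{n_T}} .$$ Then, with probability at least $1-c_2\exp(-c_3\log p)$, every choice of the minimizers satisfies $$\|\hat\beta_{\mathrm{TF}}-\beta^{(0)}\|_2^2\le C\Big(\frac{s\log p}{N}+\bar h\sqrt{\frac{\log p}{n_T}}\Big).$$ -/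

import Mathlib

open MeasureTheory ProbabilityTheory
open scoped NNReal

noncomputable section

namespace TransFusion

/-- Sample sizes of the `K + 1` tasks: task `0` is the target, tasks `1, …, K` are the sources. -/
def sampleSize (nT nS : ℕ) {K : ℕ} : Fin (K + 1) → ℕ :=
  Fin.cons nT (fun _ => nS)

/-- The total sample size `N = K n_S + n_T`. -/
def totalSize (K nT nS : ℕ) : ℝ := (K : ℝ) * nS + nT

/-- The `ℓ₁` norm of a vector. -/
def l1norm {p : ℕ} (x : EuclideanSpace ℝ (Fin p)) : ℝ := ∑ j, |x j|

/-- The number of nonzero entries of a vector. -/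
def l0norm {p : ℕ} (x : EuclideanSpace ℝ (Fin p)) : ℕ := Set.ncard {j | x j ≠ 0}

/-- The parameter space: the target parameter is `s`-sparse, and the `k`-th contrast
has `ℓ₁` norm at most `h k`. -/
def parameterSpace {p K : ℕ} (s : ℕ) (h : Fin K → ℝ) :
    Set (Fin (K + 1) → EuclideanSpace ℝ (Fin p)) :=
  {β | l0norm (β 0) ≤ s ∧ ∀ k : Fin K, l1norm (β k.succ - β 0) ≤ h k}

/-- The average magnitude of the model shifts, `h̄ = (n_S / N) ∑ₖ hₖ`. -/
def hbar {K : ℕ} (nT nS : ℕ) (h : Fin K → ℝ) : ℝ :=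
  (nS : ℝ) / totalSize K nT nS * ∑ k, h k

/-- Sub-Gaussian designs. Within each task the rows are independent, centred, with covariance
matrix `Cov k`, all of whose eigenvalues lie in `[1 / c, c]`, and every one-dimensional marginal
`⟪u, X k i⟫` is sub-Gaussian with variance proxy `κ ‖u‖²`. The rows of a task need not be
identically distributed, and nothing is assumed on the dependence between designs of different
tasks. -/
structure SubGaussianDesign {Ω : Type*} [MeasurableSpace Ω] (μ : Measure Ω) {p K nT nS : ℕ}
    (c : ℝ) (κ : ℝ≥0)
    (X : (k : Fin (K + 1)) → Fin (sampleSize nT nS k) → Ω → EuclideanSpace ℝ (Fin p))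
    (Cov : Fin (K + 1) → Matrix (Fin p) (Fin p) ℝ) : Prop where
  measurable : ∀ k i, Measurable (X k i)
  indep : ∀ k, iIndepFun (X k) μ
  mean_zero : ∀ k i j, ∫ ω, X k i ω j ∂μ = 0
  covariance_eq : ∀ k i j l, cov[fun ω => X k i ω j, fun ω => X k i ω l; μ] = Cov k j l
  spectrum_subset : ∀ k, spectrum ℝ (Cov k) ⊆ Set.Icc (1 / c) c
  subGaussian : ∀ k i (u : EuclideanSpace ℝ (Fin p)),
    HasSubgaussianMGF (fun ω => inner ℝ u (X k i ω)) (κ * ‖u‖₊ ^ 2) μ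

/-- Gaussian errors: all errors are independent (over samples and tasks), centred Gaussian with
variances at most `σ²`, and they are independent of the designs. -/
structure GaussianErrors {Ω : Type*} [MeasurableSpace Ω] (μ : Measure Ω) {p K nT nS : ℕ}
    (σ : ℝ)
    (X : (k : Fin (K + 1)) → Fin (sampleSize nT nS k) → Ω → EuclideanSpace ℝ (Fin p))
    (ε : (k : Fin (K + 1)) → Fin (sampleSize nT nS k) → Ω → ℝ) : Prop where
  measurable : ∀ k i, Measurable (ε k i)
  gaussian : ∀ k i, ∃ v : ℝ≥0, (v : ℝ) ≤ σ ^ 2 ∧ μ.map (ε k i) = gaussianReal 0 v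
  indep : iIndepFun
    (fun (ki : (k : Fin (K + 1)) × Fin (sampleSize nT nS k)) => ε ki.1 ki.2) μ
  indep_design : IndepFun (fun ω k i => ε k i ω) (fun ω k i => X k i ω) μ

/-- The responses of the linear models, `y k i = ⟪X k i, β k⟫ + ε k i`. -/
def response {p K nT nS : ℕ} (β : Fin (K + 1) → EuclideanSpace ℝ (Fin p))
    (x : (k : Fin (K + 1)) → Fin (sampleSize nT nS k) → EuclideanSpace ℝ (Fin p))
    (e : (k : Fin (K + 1)) → Fin (sampleSize nT nS k) → ℝ) :
    (k : Fin (K + 1)) → Fin (sampleSize nT nS k) → ℝ :=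
  fun k i => inner ℝ (x k i) (β k) + e k i

/-- The objective function of the co-training step. -/
def coTrainingObjective {p K nT nS : ℕ}
    (x : (k : Fin (K + 1)) → Fin (sampleSize nT nS k) → EuclideanSpace ℝ (Fin p))
    (y : (k : Fin (K + 1)) → Fin (sampleSize nT nS k) → ℝ)
    (lam0 : ℝ) (a : Fin K → ℝ) (b : Fin (K + 1) → EuclideanSpace ℝ (Fin p)) : ℝ :=
  1 / (2 * totalSize K nT nS) * ∑ k, ∑ i, (y k i - inner ℝ (x k i) (b k)) ^ 2
    + lam0 * (l1norm (b 0) + ∑ k : Fin K, a k * l1norm (b k.succ - b 0))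

/-- The sample-size weighted average `(n_S / N) ∑ₖ b k + (n_T / N) b 0`. -/
def weightedAverage {p K : ℕ} (nT nS : ℕ) (b : Fin (K + 1) → EuclideanSpace ℝ (Fin p)) :
    EuclideanSpace ℝ (Fin p) :=
  ((nS : ℝ) / totalSize K nT nS) • ∑ k : Fin K, b k.succ
    + ((nT : ℝ) / totalSize K nT nS) • b 0

/-- The objective function of the local debias step on the target sample, started at `w`. -/
def debiasObjective {p K nT nS : ℕ}
    (x : (k : Fin (K + 1)) → Fin (sampleSize nT nS k) → EuclideanSpace ℝ (Fin p))
    (y : (k : Fin (K + 1)) → Fin (sampleSize nT nS k) → ℝ)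
    (lamT : ℝ) (w δ : EuclideanSpace ℝ (Fin p)) : ℝ :=
  1 / (2 * (nT : ℝ)) * ∑ i, (y 0 i - inner ℝ (x 0 i) w - inner ℝ (x 0 i) δ) ^ 2
    + lamT * l1norm δ

/-- `βhat` is an output of the two-step method: `βhat = ŵ + δ̂`, where `ŵ` is the weighted
average of a minimizer of the co-training objective, and `δ̂` is a minimizer of the debias
objective started at `ŵ`. -/
def IsTwoStepEstimate {p K nT nS : ℕ}
    (x : (k : Fin (K + 1)) → Fin (sampleSize nT nS k) → EuclideanSpace ℝ (Fin p))
    (y : (k : Fin (K + 1)) → Fin (sampleSize nT nS k) → ℝ)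
    (lam0 : ℝ) (a : Fin K → ℝ) (lamT : ℝ) (βhat : EuclideanSpace ℝ (Fin p)) : Prop :=
  ∃ (b : Fin (K + 1) → EuclideanSpace ℝ (Fin p)) (δ : EuclideanSpace ℝ (Fin p)),
    IsMinOn (coTrainingObjective x y lam0 a) Set.univ b ∧
    IsMinOn (debiasObjective x y lamT (weightedAverage nT nS b)) Set.univ δ ∧
    βhat = weightedAverage nT nS b + δ

/-- The event `A = {s log p / n_S ≥ h̄ √(log p / n_T)}` (it involves no randomness). -/
def EventA {K : ℕ} (p s nT nS : ℕ) (h : Fin K → ℝ) : Prop :=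
  (s : ℝ) * Real.log p / nS ≥ hbar nT nS h * √(Real.log p / nT)

open Classical in
/-- The tuning parameter `λ₀ = c₀ (√(log p / N) 1_A + √(log p / n_S) 1_{Aᶜ})`. -/
def lambdaZero {K : ℕ} (c₀ : ℝ) (p s nT nS : ℕ) (h : Fin K → ℝ) : ℝ :=
  c₀ * (if EventA p s nT nS h then √(Real.log p / totalSize K nT nS)
    else √(Real.log p / nS))

open Classical in
/-- The weights `aₖ = 8 (√(n_S / N) 1_A + (n_S / N) 1_{Aᶜ})`, the same for all `k`. -/
def weight {K : ℕ} (p s nT nS : ℕ) (h : Fin K → ℝ) : Fin K → ℝ :=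
  fun _ => 8 * (if EventA p s nT nS h then √((nS : ℝ) / totalSize K nT nS)
    else (nS : ℝ) / totalSize K nT nS)

/-- The tuning parameter `λ̃ = c₁ √(log p / n_T)` of the debias step. -/
def lambdaTilde (c₁ : ℝ) (p nT : ℕ) : ℝ := c₁ * √(Real.log p / nT)

end TransFusion

end

/-!
The errors enter only through the scores `Xᵀε`. Comparing a minimizer with the true parameters
requires the score of every source to be at most of order `√(n_S log p)`, and a union bound over
coordinates and sources gives this when `K ≤ p`. For `K > p` a few sources may violate it. Each of
these is then compared not with `β^{(k)}` but with `β^{(k)} + d_k`, where `d_k` is a lasso fit of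
its errors, so that what is left of the score is small again. The price is the average of the `d_k`,
and here it matters that `d_k` is an odd function of the errors: it has mean zero, so Chebyshev's
inequality makes the average negligible.

With the scores under control, the basic inequality of the co-training step bounds the prediction
error, and hence the error of the weighted average in the source directions, by the rate. The debias
step is a lasso on the target sample whose unknown is the error of the weighted average. Both steps
use the lower bound `‖Xv‖² ≳ n‖v‖² - log p ‖v‖₁²`, valid for all `v` with high probability. It holds
at the points of a finite net of sparse averages by concentration, and Maurey's empirical method
transfers it to every `v`, a convex combination of multiples of the coordinate vectors.
-/

namespace TransFusion

section Norms

variable {p : ℕ}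

theorem l1norm_nonneg (v : EuclideanSpace ℝ (Fin p)) : 0 ≤ l1norm v :=
  Finset.sum_nonneg fun _ _ => abs_nonneg _

@[simp] theorem l1norm_zero : l1norm (0 : EuclideanSpace ℝ (Fin p)) = 0 := by simp [l1norm]

theorem l1norm_add_le (v w : EuclideanSpace ℝ (Fin p)) :
    l1norm (v + w) ≤ l1norm v + l1norm w := by
  unfold l1norm
  rw [← Finset.sum_add_distrib]
  exact Finset.sum_le_sum fun j _ => by simpa using abs_add_le (v j) (w j)

@[simp] theorem l1norm_neg (v : EuclideanSpace ℝ (Fin p)) : l1norm (-v) = l1norm v := by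
  simp [l1norm]

theorem l1norm_sub_le (v w : EuclideanSpace ℝ (Fin p)) :
    l1norm (v - w) ≤ l1norm v + l1norm w := by
  simpa [sub_eq_add_neg] using l1norm_add_le v (-w)

theorem l1norm_le_l1norm_add_add (v w : EuclideanSpace ℝ (Fin p)) :
    l1norm w ≤ l1norm (v + w) + l1norm v := by
  simpa using l1norm_sub_le (v + w) v

theorem l1norm_smul (t : ℝ) (v : EuclideanSpace ℝ (Fin p)) :
    l1norm (t • v) = |t| * l1norm v := by
  simp [l1norm, abs_mul, Finset.mul_sum]

theorem l1norm_sum_le {ι : Type*} (s : Finset ι) (f : ι → EuclideanSpace ℝ (Fin p)) :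
    l1norm (∑ i ∈ s, f i) ≤ ∑ i ∈ s, l1norm (f i) :=
  Finset.le_sum_of_subadditive l1norm l1norm_zero.le l1norm_add_le s f

theorem continuous_l1norm : Continuous (l1norm : EuclideanSpace ℝ (Fin p) → ℝ) := by
  unfold l1norm; fun_prop

theorem norm_le_l1norm (v : EuclideanSpace ℝ (Fin p)) : ‖v‖ ≤ l1norm v := by
  rw [EuclideanSpace.norm_eq]
  refine Real.sqrt_le_iff.2 ⟨l1norm_nonneg v, ?_⟩
  simpa [l1norm] using Finset.sum_sq_le_sq_sum_of_nonneg (s := Finset.univ)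
    (f := fun j => |v j|) (fun j _ => abs_nonneg _)

theorem sum_abs_le_l1norm (S : Finset (Fin p)) (v : EuclideanSpace ℝ (Fin p)) :
    ∑ j ∈ S, |v j| ≤ l1norm v :=
  Finset.sum_le_sum_of_subset_of_nonneg (Finset.subset_univ S) fun _ _ _ => abs_nonneg _

theorem sum_abs_add_sum_abs_compl (S : Finset (Fin p)) (v : EuclideanSpace ℝ (Fin p)) :
    ∑ j ∈ S, |v j| + ∑ j ∈ Sᶜ, |v j| = l1norm v :=
  Finset.sum_add_sum_compl S _

theorem sum_abs_le_sqrt_mul_norm (S : Finset (Fin p)) {s : ℕ} (hS : S.card ≤ s)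
    (v : EuclideanSpace ℝ (Fin p)) : ∑ j ∈ S, |v j| ≤ √s * ‖v‖ := by
  rw [EuclideanSpace.norm_eq, ← Real.sqrt_mul (by positivity)]
  refine Real.le_sqrt_of_sq_le ?_
  calc (∑ j ∈ S, |v j|) ^ 2 ≤ S.card * ∑ j ∈ S, |v j| ^ 2 := sq_sum_le_card_mul_sum_sq
    _ ≤ s * ∑ j, ‖v j‖ ^ 2 := by
      gcongr
      exact Finset.sum_le_sum_of_subset_of_nonneg (Finset.subset_univ S)
        fun _ _ _ => by positivity

theorem l1norm_le_sqrt_mul_norm (v : EuclideanSpace ℝ (Fin p)) : l1norm v ≤ √p * ‖v‖ :=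
  sum_abs_le_sqrt_mul_norm Finset.univ (by simp) v

theorem abs_inner_le_mul_l1norm {t : ℝ} {w : EuclideanSpace ℝ (Fin p)} (hw : ∀ j, |w j| ≤ t)
    (v : EuclideanSpace ℝ (Fin p)) : |inner ℝ w v| ≤ t * l1norm v := by
  rw [PiLp.inner_apply, l1norm, Finset.mul_sum]
  refine (Finset.abs_sum_le_sum_abs _ _).trans (Finset.sum_le_sum fun j _ => ?_)
  rw [RCLike.inner_apply, conj_trivial, abs_mul, mul_comm]
  exact mul_le_mul_of_nonneg_right (hw j) (abs_nonneg _)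

theorem l1norm_sub_l1norm_add_le (S : Finset (Fin p)) {b : EuclideanSpace ℝ (Fin p)}
    (hb : ∀ j ∉ S, b j = 0) (v : EuclideanSpace ℝ (Fin p)) :
    l1norm b - l1norm (b + v) ≤ ∑ j ∈ S, |v j| - ∑ j ∈ Sᶜ, |v j| := by
  rw [← sum_abs_add_sum_abs_compl S, ← sum_abs_add_sum_abs_compl S (b + v)]
  have h_on : ∑ j ∈ S, |b j| ≤ ∑ j ∈ S, |(b + v) j| + ∑ j ∈ S, |v j| := by
    rw [← Finset.sum_add_distrib]
    exact Finset.sum_le_sum fun j _ => by simpa using abs_sub (b j + v j) (v j)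
  have h_off : ∑ j ∈ Sᶜ, |b j| = 0 := Finset.sum_eq_zero fun j hj => by
    rw [hb j (Finset.mem_compl.1 hj), abs_zero]
  have h_off_add : ∑ j ∈ Sᶜ, |(b + v) j| = ∑ j ∈ Sᶜ, |v j| := Finset.sum_congr rfl fun j hj => by
    simp [hb j (Finset.mem_compl.1 hj)]
  linarith

end Norms

section LinearModel

variable {ι E : Type*} [Fintype ι] [NormedAddCommGroup E] [InnerProductSpace ℝ E]

/-- The squared prediction norm `‖x v‖²` of a vector `v` under the design with rows `x i`. -/
noncomputable def predSq (x : ι → E) (v : E) : ℝ := ∑ i, inner ℝ (x i) v ^ 2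

/-- The score `xᵀ e`: the correlation of the design with rows `x i` with the vector `e`. -/
noncomputable def score (x : ι → E) (e : ι → ℝ) : E := ∑ i, e i • x i

/-- The product `xᵀ x d` of the Gram matrix of the design with rows `x i` with the vector `d`. -/
noncomputable def gramMul (x : ι → E) (d : E) : E := score x fun i => inner ℝ (x i) d

theorem predSq_nonneg (x : ι → E) (v : E) : 0 ≤ predSq x v :=
  Finset.sum_nonneg fun _ _ => sq_nonneg _

theorem predSq_smul (x : ι → E) (t : ℝ) (v : E) : predSq x (t • v) = t ^ 2 * predSq x v := by
  simp [predSq, inner_smul_right, mul_pow, Finset.mul_sum]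

theorem inner_score (x : ι → E) (e : ι → ℝ) (v : E) :
    inner ℝ (score x e) v = ∑ i, e i * inner ℝ (x i) v := by
  simp [score, sum_inner, inner_smul_left]

theorem score_add (x : ι → E) (e f : ι → ℝ) : score x (e + f) = score x e + score x f := by
  simp [score, add_smul, Finset.sum_add_distrib]

theorem score_neg (x : ι → E) (e : ι → ℝ) : score x (-e) = -score x e := by simp [score]

theorem gramMul_add (x : ι → E) (d v : E) : gramMul x (d + v) = gramMul x d + gramMul x v := by
  simp only [gramMul, ← score_add, Pi.add_def, inner_add_right]

theorem inner_gramMul (x : ι → E) (d v : E) :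
    inner ℝ (gramMul x d) v = ∑ i, inner ℝ (x i) d * inner ℝ (x i) v :=
  inner_score x _ v

theorem sum_sq_sub_inner_add (x : ι → E) (y : ι → ℝ) (d v : E) :
    ∑ i, (y i - inner ℝ (x i) (d + v)) ^ 2 = ∑ i, (y i - inner ℝ (x i) d) ^ 2
      - 2 * inner ℝ (score x y - gramMul x d) v + predSq x v := by
  rw [inner_sub_left, inner_score, inner_gramMul, predSq, ← Finset.sum_sub_distrib,
    Finset.mul_sum, ← Finset.sum_sub_distrib, ← Finset.sum_add_distrib]
  exact Finset.sum_congr rfl fun i _ => by rw [inner_add_right]; ring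

end LinearModel

section CoTraining

variable {p K nT nS : ℕ}

/-- The designs of all tasks. -/
abbrev Designs (p K nT nS : ℕ) : Type :=
  (k : Fin (K + 1)) → Fin (sampleSize nT nS k) → EuclideanSpace ℝ (Fin p)

/-- One real number per observation: the responses, or the errors, of all tasks. -/
abbrev Responses (K nT nS : ℕ) : Type :=
  (k : Fin (K + 1)) → Fin (sampleSize nT nS k) → ℝ

/-- `d` satisfies the optimality conditions of the lasso `min ½‖x d‖² - ⟪z, d⟫ + L ‖d‖₁`, in their
variational form. -/
def LassoOptimal {ι : Type*} [Fintype ι] (x : ι → EuclideanSpace ℝ (Fin p)) (L : ℝ)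
    (z d : EuclideanSpace ℝ (Fin p)) : Prop :=
  ∀ v, inner ℝ (z - gramMul x d) v ≤ L * (l1norm (d + v) - l1norm d)

theorem inner_add_l1norm_sub_le_of_abs_le {L : ℝ} {ζ : EuclideanSpace ℝ (Fin p)}
    (hL : 0 ≤ L) (hζ : ∀ j, |ζ j| ≤ L / 2) (δ w : EuclideanSpace ℝ (Fin p)) :
    inner ℝ ζ w + L * (l1norm δ - l1norm (δ + w)) ≤ 2 * L * l1norm δ - L / 2 * l1norm w := by
  have h_score := (le_abs_self _).trans (abs_inner_le_mul_l1norm hζ w)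
  have h_pen := mul_le_mul_of_nonneg_left (l1norm_le_l1norm_add_add δ w) hL
  linarith

theorem LassoOptimal.inner_add_l1norm_sub_le {ι : Type*} [Fintype ι]
    {x : ι → EuclideanSpace ℝ (Fin p)} {L : ℝ} {z d : EuclideanSpace ℝ (Fin p)}
    (hd : LassoOptimal x L z d) (hL : 0 ≤ L) (δ w : EuclideanSpace ℝ (Fin p)) :
    inner ℝ (z - gramMul x d) w + L * (l1norm (δ + d) - l1norm (δ + d + w))
      ≤ 2 * L * l1norm δ := by
  have h_add := mul_le_mul_of_nonneg_left (l1norm_add_le δ d) hL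
  have h_sub : l1norm (d + w) ≤ l1norm (δ + d + w) + l1norm δ := by
    simpa [add_assoc] using l1norm_le_l1norm_add_add δ (d + w)
  have h_sub := mul_le_mul_of_nonneg_left h_sub hL
  linarith [hd w]

theorem inner_add_l1norm_sub_le_of_support {L : ℝ} {ζ b : EuclideanSpace ℝ (Fin p)}
    {S : Finset (Fin p)} (hL : 0 ≤ L) (hζ : ∀ j, |ζ j| ≤ L / 2) (hb : ∀ j ∉ S, b j = 0)
    (v : EuclideanSpace ℝ (Fin p)) :
    inner ℝ ζ v + L * (l1norm b - l1norm (b + v))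
      ≤ 3 / 2 * L * ∑ j ∈ S, |v j| - L / 2 * ∑ j ∈ Sᶜ, |v j| := by
  have h_score := (le_abs_self _).trans (abs_inner_le_mul_l1norm hζ v)
  rw [← sum_abs_add_sum_abs_compl S v] at h_score
  have h_pen := mul_le_mul_of_nonneg_left (l1norm_sub_l1norm_add_le S hb v) hL
  linarith

/-- The penalty `‖b 0‖₁ + ∑ₖ aₖ ‖b k - b 0‖₁` of the co-training step. -/
def contrastPenalty (a : Fin K → ℝ) (b : Fin (K + 1) → EuclideanSpace ℝ (Fin p)) : ℝ :=
  l1norm (b 0) + ∑ k : Fin K, a k * l1norm (b k.succ - b 0)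

/-- The in-sample prediction error of `v` per observation, over all tasks. -/
noncomputable def meanPredSq (x : Designs p K nT nS)
    (v : Fin (K + 1) → EuclideanSpace ℝ (Fin p)) : ℝ :=
  (∑ k, predSq (x k) (v k)) / totalSize K nT nS

variable {x : Designs p K nT nS} {e : Responses K nT nS}
  {lam : ℝ} {a : Fin K → ℝ} {S : Finset (Fin p)} {B : Finset (Fin K)}
  {β d v : Fin (K + 1) → EuclideanSpace ℝ (Fin p)}

theorem half_sum_predSq_le_of_coTrainingObjective_le
    {y : Responses K nT nS} {b : Fin (K + 1) → EuclideanSpace ℝ (Fin p)}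
    (hN : 0 < totalSize K nT nS)
    (h : coTrainingObjective x y lam a (b + v) ≤ coTrainingObjective x y lam a b) :
    1 / 2 * ∑ k, predSq (x k) (v k)
      ≤ ∑ k, inner ℝ (score (x k) (y k) - gramMul (x k) (b k)) (v k)
        + totalSize K nT nS * lam * (contrastPenalty a b - contrastPenalty a (b + v)) := by
  simp only [coTrainingObjective, Pi.add_apply, sum_sq_sub_inner_add, Finset.sum_add_distrib,
    Finset.sum_sub_distrib, ← Finset.mul_sum] at h
  simp only [contrastPenalty, Pi.add_apply]
  rw [← mul_le_mul_iff_right₀ hN] at h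
  field_simp at h
  linarith

theorem score_response_sub_gramMul (k : Fin (K + 1)) :
    score (x k) (response β x e k) - gramMul (x k) ((β + d) k)
      = score (x k) (e k) - gramMul (x k) (d k) := by
  have h : response β x e k = (fun i => inner ℝ (x k i) (β k)) + e k := rfl
  rw [h, score_add, Pi.add_apply, gramMul_add, gramMul]
  abel

theorem sum_inner_eq_inner_sum_add_sum_inner_sub (ζ v : Fin (K + 1) → EuclideanSpace ℝ (Fin p)) :
    ∑ k, inner ℝ (ζ k) (v k)
      = inner ℝ (∑ k, ζ k) (v 0) + ∑ k : Fin K, inner ℝ (ζ k.succ) (v k.succ - v 0) := by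
  simp only [Fin.sum_univ_succ, inner_add_left, sum_inner, inner_sub_right,
    Finset.sum_sub_distrib]
  ring

theorem contrastPenalty_sub_contrastPenalty_add (hd : d 0 = 0) :
    contrastPenalty a (β + d) - contrastPenalty a (β + d + v)
      = l1norm (β 0) - l1norm (β 0 + v 0)
        + ∑ k, a k * (l1norm (β k.succ - β 0 + d k.succ)
          - l1norm (β k.succ - β 0 + d k.succ + (v k.succ - v 0))) := by
  have h_contrast (k : Fin K) : β k.succ + d k.succ - β 0 = β k.succ - β 0 + d k.succ := by abel
  have h_contrast_add (k : Fin K) : β k.succ + d k.succ + v k.succ - (β 0 + v 0)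
      = β k.succ - β 0 + d k.succ + (v k.succ - v 0) := by abel
  simp only [contrastPenalty, Pi.add_apply, hd, add_zero, h_contrast, h_contrast_add, mul_sub,
    Finset.sum_sub_distrib]
  ring

theorem coTraining_oracle_inequality (hN : 0 < totalSize K nT nS) (hlam : 0 ≤ lam)
    (ha : ∀ k, 0 ≤ a k) (hS : ∀ j ∉ S, β 0 j = 0) (hd_target : d 0 = 0)
    (hd_good : ∀ k ∉ B, d k.succ = 0)
    (h_good : ∀ k ∉ B, ∀ j,
      |score (x k.succ) (e k.succ) j| ≤ totalSize K nT nS * lam * a k / 2)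
    (h_bad : ∀ k ∈ B, LassoOptimal (x k.succ) (totalSize K nT nS * lam * a k)
      (score (x k.succ) (e k.succ)) (d k.succ))
    (h_total : ∀ j, |(∑ k, (score (x k) (e k) - gramMul (x k) (d k))) j|
      ≤ totalSize K nT nS * lam / 2)
    (h_min : coTrainingObjective x (response β x e) lam a (β + d + v)
      ≤ coTrainingObjective x (response β x e) lam a (β + d)) :
    meanPredSq x v
        + lam * (∑ j ∈ Sᶜ, |v 0 j| + ∑ k ∈ Bᶜ, a k * l1norm (v k.succ - v 0))
      ≤ lam * (3 * ∑ j ∈ S, |v 0 j| + 4 * ∑ k, a k * l1norm (β k.succ - β 0)) := by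
  set N := totalSize K nT nS with hN_def
  have hL : 0 ≤ N * lam := by positivity
  have h_basic := half_sum_predSq_le_of_coTrainingObjective_le hN h_min
  simp only [score_response_sub_gramMul, sum_inner_eq_inner_sum_add_sum_inner_sub,
    contrastPenalty_sub_contrastPenalty_add hd_target, ← hN_def] at h_basic
  have h_target := inner_add_l1norm_sub_le_of_support hL h_total hS (v 0)
  have h_contrast (k : Fin K) :
      inner ℝ (score (x k.succ) (e k.succ) - gramMul (x k.succ) (d k.succ)) (v k.succ - v 0)
        + N * lam * (a k * (l1norm (β k.succ - β 0 + d k.succ)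
            - l1norm (β k.succ - β 0 + d k.succ + (v k.succ - v 0))))
      ≤ N * lam * (2 * (a k * l1norm (β k.succ - β 0)))
        - N * lam / 2 * if k ∈ Bᶜ then a k * l1norm (v k.succ - v 0) else 0 := by
    have hLk := mul_nonneg hL (ha k)
    by_cases hk : k ∈ B
    · have := (h_bad k hk).inner_add_l1norm_sub_le hLk (β k.succ - β 0) (v k.succ - v 0)
      rw [if_neg (by simpa using hk)]
      linarith
    · have := inner_add_l1norm_sub_le_of_abs_le hLk (h_good k hk) (β k.succ - β 0)
        (v k.succ - v 0)
      simp only [hd_good k hk, gramMul, score, inner_zero_right, zero_smul,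
        Finset.sum_const_zero, sub_zero, add_zero, if_pos (Finset.mem_compl.2 hk)] at this ⊢
      linarith
  have h_contrasts := Finset.sum_le_sum fun k (_ : k ∈ Finset.univ) => h_contrast k
  simp only [Finset.sum_add_distrib, Finset.sum_sub_distrib, ← Finset.mul_sum,
    Finset.sum_ite_mem, Finset.univ_inter] at h_contrasts
  rw [meanPredSq, ← hN_def, ← mul_le_mul_iff_right₀ hN]
  field_simp
  linarith

theorem debiasObjective_response_eq (u δ v : EuclideanSpace ℝ (Fin p)) :
    debiasObjective x (response β x e) lam (β 0 + u - δ) (δ + v)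
      = 1 / (2 * (nT : ℝ)) * ∑ i, (e 0 i - inner ℝ (x 0 i) (u + v)) ^ 2
        + lam * l1norm (δ + v) := by
  have h_residual (i) : response β x e 0 i - inner ℝ (x 0 i) (β 0 + u - δ)
      - inner ℝ (x 0 i) (δ + v) = e 0 i - inner ℝ (x 0 i) (u + v) := by
    simp only [response, inner_add_right, inner_sub_right]
    ring
  simp only [debiasObjective, h_residual]

theorem debias_basic_inequality (hnT : 0 < nT) (hlam : 0 ≤ lam)
    {u v δ : EuclideanSpace ℝ (Fin p)} (h_score : ∀ j, |score (x 0) (e 0) j| ≤ nT * lam / 2)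
    (h_min : debiasObjective x (response β x e) lam (β 0 + u - δ) (δ + v)
      ≤ debiasObjective x (response β x e) lam (β 0 + u - δ) δ) :
    predSq (x 0) (u + v) / nT + lam * l1norm v
      ≤ predSq (x 0) u / nT + 4 * (lam * l1norm δ) := by
  have hnT' : (0 : ℝ) < nT := by exact_mod_cast hnT
  have h_residual (w : EuclideanSpace ℝ (Fin p)) : ∑ i, (e 0 i - inner ℝ (x 0 i) w) ^ 2
      = ∑ i, e 0 i ^ 2 - 2 * inner ℝ (score (x 0) (e 0)) w + predSq (x 0) w := by
    simpa [gramMul, score] using sum_sq_sub_inner_add (x 0) (e 0) 0 w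
  have h_eq := debiasObjective_response_eq (x := x) (e := e) (lam := lam) (β := β) u δ 0
  rw [add_zero, add_zero] at h_eq
  rw [debiasObjective_response_eq, h_eq, h_residual, h_residual, inner_add_right,
    ← mul_le_mul_iff_right₀ hnT'] at h_min
  have h_noise := (le_abs_self _).trans (abs_inner_le_mul_l1norm h_score v)
  have h_pen := mul_le_mul_of_nonneg_left (l1norm_le_l1norm_add_add δ v) (mul_nonneg hnT'.le hlam)
  rw [← mul_le_mul_iff_right₀ hnT']
  field_simp at h_min ⊢
  linarith

end CoTraining

section RestrictedEigenvalue

variable {p n : ℕ} {C₁ C₂ C₄ l : ℝ} {x : Fin n → EuclideanSpace ℝ (Fin p)}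

/-- Restricted eigenvalue conditions on a design: a lower and an upper bound for the prediction
norm, both up to a multiple of the `ℓ₁` norm. -/
structure DesignRegular (C₁ C₂ C₄ l : ℝ) (x : Fin n → EuclideanSpace ℝ (Fin p)) : Prop where
  lower : ∀ v, √n * ‖v‖ ≤ C₁ * √(predSq x v) + C₂ * √l * l1norm v
  upper : ∀ v, predSq x v ≤ n * (C₄ * (‖v‖ ^ 2 + l / n * l1norm v ^ 2))

theorem DesignRegular.norm_le (hx : DesignRegular C₁ C₂ C₄ l x) (hn : 0 < n)
    (v : EuclideanSpace ℝ (Fin p)) :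
    ‖v‖ ≤ C₁ * √(predSq x v / n) + C₂ * √(l / n) * l1norm v := by
  have hn' : (0 : ℝ) < n := by exact_mod_cast hn
  have h := hx.lower v
  rw [Real.sqrt_div' _ hn'.le, Real.sqrt_div' _ hn'.le]
  have hsqrt := Real.sqrt_pos.2 hn'
  field_simp
  linarith

theorem DesignRegular.sum_abs_le (hx : DesignRegular C₁ C₂ C₄ l x) (hn : 0 < n) {s : ℕ}
    {S : Finset (Fin p)} (hS : S.card ≤ s) (v : EuclideanSpace ℝ (Fin p)) :
    ∑ j ∈ S, |v j| ≤ C₁ * √(s * predSq x v / n) + C₂ * √(s * l / n) * l1norm v := by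
  refine (sum_abs_le_sqrt_mul_norm S hS v).trans ?_
  have h := mul_le_mul_of_nonneg_left (hx.norm_le hn v) (Real.sqrt_nonneg s)
  rw [mul_div_assoc, mul_div_assoc, Real.sqrt_mul (Nat.cast_nonneg s),
    Real.sqrt_mul (Nat.cast_nonneg s)]
  linarith

theorem DesignRegular.sqrt_mul_norm_le (hx : DesignRegular C₁ C₂ C₄ l x) (hl : 0 ≤ l)
    (hC₂ : 0 ≤ C₂) (hn : 4 * C₂ ^ 2 * (l * p) ≤ n) (v : EuclideanSpace ℝ (Fin p)) :
    √n * ‖v‖ ≤ 2 * C₁ * √(predSq x v) := by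
  have h_well : 2 * (C₂ * √l * √p) ≤ √n := by
    refine Real.le_sqrt_of_sq_le ?_
    rw [mul_pow, mul_pow, mul_pow, Real.sq_sqrt hl, Real.sq_sqrt (Nat.cast_nonneg p)]
    linarith
  have h_l1 : C₂ * √l * l1norm v ≤ C₂ * √l * (√p * ‖v‖) :=
    mul_le_mul_of_nonneg_left (l1norm_le_sqrt_mul_norm v) (by positivity)
  linarith [hx.lower v, mul_le_mul_of_nonneg_right h_well (norm_nonneg v)]

theorem DesignRegular.sqrt_mul_l1norm_le (hx : DesignRegular C₁ C₂ C₄ l x) (hl : 0 ≤ l)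
    (hC₂ : 0 ≤ C₂) (hn : 4 * C₂ ^ 2 * (l * p) ≤ n) (v : EuclideanSpace ℝ (Fin p)) :
    √n * l1norm v ≤ 2 * C₁ * √p * √(predSq x v) := by
  have h_l1 := mul_le_mul_of_nonneg_left (l1norm_le_sqrt_mul_norm v) (Real.sqrt_nonneg n)
  have h_norm := mul_le_mul_of_nonneg_left (hx.sqrt_mul_norm_le hl hC₂ hn v) (Real.sqrt_nonneg p)
  linarith

end RestrictedEigenvalue

section TargetError

variable {p K nT nS : ℕ} {C₁ C₂ C₄ l : ℝ}
  {x : Designs p K nT nS}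
  {v : Fin (K + 1) → EuclideanSpace ℝ (Fin p)} {S : Finset (Fin p)} {s : ℕ}
  {B : Finset (Fin K)} {a : Fin K → ℝ}

theorem cast_sampleSize_zero : ((sampleSize nT nS (0 : Fin (K + 1)) : ℕ) : ℝ) = nT := rfl

theorem cast_sampleSize_succ (k : Fin K) : ((sampleSize nT nS k.succ : ℕ) : ℝ) = nS := rfl

theorem meanPredSq_nonneg : 0 ≤ meanPredSq x v :=
  div_nonneg (Finset.sum_nonneg fun k _ => predSq_nonneg _ _)
    (add_nonneg (by positivity) (Nat.cast_nonneg _))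

theorem sum_predSq_succ_le (hN : 0 < totalSize K nT nS) (B : Finset (Fin K)) :
    ∑ k ∈ B, predSq (x k.succ) (v k.succ) ≤ meanPredSq x v * totalSize K nT nS := by
  rw [meanPredSq, div_mul_cancel₀ _ hN.ne', Fin.sum_univ_succ]
  have h_sub := Finset.sum_le_sum_of_subset_of_nonneg (Finset.subset_univ B)
    fun (k : Fin K) _ _ => predSq_nonneg (x k.succ) (v k.succ)
  linarith [predSq_nonneg (x 0) (v 0)]

theorem sum_sqrt_le {ι : Type*} (s : Finset ι) {f : ι → ℝ} (hf : ∀ i, 0 ≤ f i) :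
    ∑ i ∈ s, √(f i) ≤ √s.card * √(∑ i ∈ s, f i) := by
  simpa using Real.sum_sqrt_mul_sqrt_le s (fun _ => zero_le_one) hf

theorem sum_abs_target_le (hS : S.card ≤ s) (hnS : 0 < nS) {θ : ℝ} (hθ₀ : 0 ≤ θ)
    (hθ : C₂ * √(s * l / nS) ≤ θ) {k : Fin K} (hx : DesignRegular C₁ C₂ C₄ l (x k.succ)) :
    ∑ j ∈ S, |v 0 j| ≤ C₁ * √(s * predSq (x k.succ) (v k.succ) / nS)
      + θ * l1norm (v 0) + (1 + θ) * l1norm (v k.succ - v 0) := by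
  have h_triangle : ∑ j ∈ S, |v 0 j| ≤ ∑ j ∈ S, |v k.succ j| + l1norm (v k.succ - v 0) := by
    refine le_trans ?_ (add_le_add_right (sum_abs_le_l1norm S (v k.succ - v 0)) _)
    rw [← Finset.sum_add_distrib]
    exact Finset.sum_le_sum fun j _ => by simpa using abs_sub (v k.succ j) (v k.succ j - v 0 j)
  have h_source := hx.sum_abs_le hnS hS (v k.succ)
  rw [cast_sampleSize_succ] at h_source
  have h_l1 : l1norm (v k.succ) ≤ l1norm (v 0) + l1norm (v k.succ - v 0) := by
    simpa using l1norm_add_le (v 0) (v k.succ - v 0)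
  have h_slow := (mul_le_mul_of_nonneg_right hθ (l1norm_nonneg _)).trans
    (mul_le_mul_of_nonneg_left h_l1 hθ₀)
  linarith

theorem card_mul_sum_abs_target_le (hS : S.card ≤ s) (hnS : 0 < nS)
    (hN : 0 < totalSize K nT nS) (hC₁ : 0 ≤ C₁) {θ : ℝ} (hθ₀ : 0 ≤ θ)
    (hθ : C₂ * √(s * l / nS) ≤ θ) (G : Finset (Fin K))
    (hx : ∀ k ∈ G, DesignRegular C₁ C₂ C₄ l (x k.succ)) :
    G.card * ∑ j ∈ S, |v 0 j|
      ≤ C₁ * (√G.card * √(s * (meanPredSq x v * totalSize K nT nS) / nS))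
        + θ * (G.card * l1norm (v 0)) + (1 + θ) * ∑ k ∈ G, l1norm (v k.succ - v 0) := by
  have h_sum := Finset.sum_le_sum fun k hk =>
    sum_abs_target_le (v := v) hS hnS hθ₀ hθ (hx k hk)
  simp only [Finset.sum_add_distrib, Finset.sum_const, nsmul_eq_mul, ← Finset.mul_sum] at h_sum
  have h_sqrt : ∑ k ∈ G, √(s * predSq (x k.succ) (v k.succ) / nS)
      ≤ √G.card * √(s * (meanPredSq x v * totalSize K nT nS) / nS) := by
    refine (sum_sqrt_le G fun k => by have := predSq_nonneg (x k.succ) (v k.succ); positivity).trans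
      (mul_le_mul_of_nonneg_left (Real.sqrt_le_sqrt ?_) (Real.sqrt_nonneg _))
    rw [← Finset.sum_div, ← Finset.mul_sum]
    gcongr
    exact sum_predSq_succ_le hN G
  linarith [mul_le_mul_of_nonneg_left h_sqrt hC₁]

theorem totalSize_le (hK : 1 ≤ K) (hnTS : nT ≤ nS) : totalSize K nT nS ≤ 2 * K * nS := by
  have hK' : (1 : ℝ) ≤ K := by exact_mod_cast hK
  have hnTS' : (nT : ℝ) ≤ nS := by exact_mod_cast hnTS
  unfold totalSize
  linarith [mul_le_mul_of_nonneg_right hK' (Nat.cast_nonneg (α := ℝ) nS)]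

theorem card_mul_card_compl_ge (hp : 0 < p) (hB : 10 * (p * B.card) ≤ K) :
    (9 : ℝ) / 10 * K ≤ Bᶜ.card := by
  have h_card : B.card ≤ p * B.card := Nat.le_mul_of_pos_left _ hp
  have h_compl : B.card + Bᶜ.card = K := by simp [Finset.card_add_card_compl]
  have h_nat : 9 * K ≤ 10 * Bᶜ.card := by omega
  have h_real : (9 : ℝ) * K ≤ 10 * Bᶜ.card := by exact_mod_cast h_nat
  linarith

theorem sum_abs_target_le_average (hp : 0 < p) (hK : 1 ≤ K) (hnS : 0 < nS) (hnTS : nT ≤ nS)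
    (hS : S.card ≤ s) (hC₁ : 0 ≤ C₁) (hθ : C₂ * √(s * l / nS) ≤ 1 / 100)
    (hB : 10 * (p * B.card) ≤ K) (ha : ∀ k, 8 * (nS / totalSize K nT nS) ≤ a k)
    (hx : ∀ k, DesignRegular C₁ C₂ C₄ l (x k)) :
    ∑ j ∈ S, |v 0 j| ≤ C₁ * √(5 / 2 * (s * meanPredSq x v)) + 1 / 100 * l1norm (v 0)
      + 101 / 360 * ∑ k ∈ Bᶜ, a k * l1norm (v k.succ - v 0) := by
  have hnS' : (0 : ℝ) < nS := by exact_mod_cast hnS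
  have hK' : (0 : ℝ) < K := by exact_mod_cast hK
  have hN : 0 < totalSize K nT nS := by unfold totalSize; positivity
  have h_card := card_mul_card_compl_ge hp hB
  have h_card_pos : (0 : ℝ) < Bᶜ.card := by linarith
  have hm : 0 ≤ meanPredSq x v := meanPredSq_nonneg
  have h_good := card_mul_sum_abs_target_le (v := v) hS hnS hN hC₁ (by norm_num) hθ Bᶜ
    fun k _ => hx k.succ
  have h_pred : √Bᶜ.card * √(s * (meanPredSq x v * totalSize K nT nS) / nS)
      ≤ Bᶜ.card * √(5 / 2 * (s * meanPredSq x v)) := by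
    rw [← Real.sqrt_mul h_card_pos.le, Real.sqrt_le_left (by positivity), mul_pow,
      Real.sq_sqrt (by positivity), sq, mul_assoc]
    refine mul_le_mul_of_nonneg_left ?_ h_card_pos.le
    rw [div_le_iff₀ hnS']
    have h_ratio : totalSize K nT nS ≤ 5 / 2 * Bᶜ.card * nS :=
      (totalSize_le hK hnTS).trans (mul_le_mul_of_nonneg_right (by linarith) hnS'.le)
    calc s * (meanPredSq x v * totalSize K nT nS)
        ≤ s * (meanPredSq x v * (5 / 2 * Bᶜ.card * nS)) := by gcongr
      _ = Bᶜ.card * (5 / 2 * (s * meanPredSq x v)) * nS := by ring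
  have h_contrast : ∑ k ∈ Bᶜ, l1norm (v k.succ - v 0)
      ≤ Bᶜ.card * (10 / 36 * ∑ k ∈ Bᶜ, a k * l1norm (v k.succ - v 0)) := by
    rw [Finset.mul_sum, Finset.mul_sum]
    refine Finset.sum_le_sum fun k _ => ?_
    have h_weight : 1 ≤ Bᶜ.card * (10 / 36 * a k) := by
      have h_ratio : (4 : ℝ) / K ≤ a k := by
        refine le_trans ?_ (ha k)
        rw [mul_div_assoc', div_le_div_iff₀ hK' hN]
        linarith [totalSize_le hK hnTS]
      calc (1 : ℝ) = 9 / 10 * K * (10 / 36 * (4 / K)) := by field_simp; norm_num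
        _ ≤ Bᶜ.card * (10 / 36 * a k) := by gcongr
    linarith [mul_le_mul_of_nonneg_right h_weight (l1norm_nonneg (v k.succ - v 0))]
  rw [← mul_le_mul_iff_right₀ h_card_pos]
  linarith [mul_le_mul_of_nonneg_left h_pred hC₁]

end TargetError

section Cone

variable {m lam V W G H q b : ℝ}

theorem add_mul_le_of_cone (hlam : 0 ≤ lam) (hq : 0 ≤ q) (hW : 0 ≤ W) (hG : 0 ≤ G)
    (h_oracle : m + lam * (W + G) ≤ lam * (3 * V + 4 * H))
    (h_target : V ≤ q + 1 / 100 * (V + W) + 101 / 360 * G) :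
    m + lam / 10 * (V + W + G) ≤ 4 * lam * (q + H) := by
  have h_target' : 31 / 10 * V ≤ 31 / 10 * (100 / 99 * q + 1 / 99 * W + 2 / 7 * G) := by linarith
  linarith [mul_le_mul_of_nonneg_left h_target' hlam, mul_nonneg hlam hq, mul_nonneg hlam hW,
    mul_nonneg hlam hG]

theorem four_mul_le_half_add (hm : 0 ≤ m) (hb : 0 ≤ b) (hq : q ^ 2 ≤ b * m) :
    4 * lam * q ≤ m / 2 + 8 * lam ^ 2 * b := by
  refine abs_le_of_sq_le_sq' ?_ (by positivity) |>.2
  nlinarith [sq_nonneg (m / 2 - 8 * lam ^ 2 * b), mul_le_mul_of_nonneg_left hq (sq_nonneg lam)]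

theorem cone_bounds (hlam : 0 < lam) (hm : 0 ≤ m) (hq : 0 ≤ q) (hb : 0 ≤ b) (hV : 0 ≤ V)
    (hW : 0 ≤ W) (hG : 0 ≤ G) (hqm : q ^ 2 ≤ b * m)
    (h_oracle : m + lam * (W + G) ≤ lam * (3 * V + 4 * H))
    (h_target : V ≤ q + 1 / 100 * (V + W) + 101 / 360 * G) :
    m ≤ 16 * lam ^ 2 * b + 8 * (lam * H) ∧
      (V + W + G) ^ 2 ≤ 16000 * (4 * (lam * b) ^ 2 + H ^ 2) := by
  have h_cone := add_mul_le_of_cone hlam.le hq hW hG h_oracle h_target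
  have h_absorb := four_mul_le_half_add (lam := lam) hm hb hqm
  have h_total : 0 ≤ V + W + G := by positivity
  have h_pred : m ≤ 16 * lam ^ 2 * b + 8 * (lam * H) := by
    linarith [mul_nonneg hlam.le h_total]
  refine ⟨h_pred, ?_⟩
  have h_linear : V + W + G ≤ 40 * (q + H) :=
    le_of_mul_le_mul_left (by linarith : lam / 10 * (V + W + G) ≤ lam / 10 * (40 * (q + H)))
      (by positivity)
  have h_sq := pow_le_pow_left₀ h_total h_linear 2
  have h_q := hqm.trans (mul_le_mul_of_nonneg_left h_pred hb)
  linarith [sq_nonneg (q - H), sq_nonneg (lam * b - H)]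

end Cone

section WeightedAverage

variable {p K nT nS : ℕ} {C₁ C₂ C₃ C₄ l : ℝ}
  {x : Designs p K nT nS}
  {v : Fin (K + 1) → EuclideanSpace ℝ (Fin p)} {B : Finset (Fin K)} {a : Fin K → ℝ}

theorem sum_sampleSize : ∑ k : Fin (K + 1), (sampleSize nT nS k : ℝ) = totalSize K nT nS := by
  simp [Fin.sum_univ_succ, cast_sampleSize_zero, cast_sampleSize_succ, totalSize, add_comm]

theorem weightedAverage_eq_sum (v : Fin (K + 1) → EuclideanSpace ℝ (Fin p)) :
    weightedAverage nT nS v = ∑ k, ((sampleSize nT nS k : ℝ) / totalSize K nT nS) • v k := by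
  simp [weightedAverage, Fin.sum_univ_succ, cast_sampleSize_zero, cast_sampleSize_succ,
    Finset.smul_sum, add_comm]

theorem weightedAverage_add (v w : Fin (K + 1) → EuclideanSpace ℝ (Fin p)) :
    weightedAverage nT nS (v + w) = weightedAverage nT nS v + weightedAverage nT nS w := by
  simp [weightedAverage_eq_sum, Finset.sum_add_distrib]

/-- The sample-size weighted average `(1 / N) ∑ₖ nₖ ‖v k‖₁` of the `ℓ₁` norms of the tasks. -/
noncomputable def meanL1norm (nT nS : ℕ) (v : Fin (K + 1) → EuclideanSpace ℝ (Fin p)) : ℝ :=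
  ∑ k, (sampleSize nT nS k : ℝ) / totalSize K nT nS * l1norm (v k)

theorem l1norm_weightedAverage_le (v : Fin (K + 1) → EuclideanSpace ℝ (Fin p)) :
    l1norm (weightedAverage nT nS v) ≤ meanL1norm nT nS v := by
  rw [weightedAverage_eq_sum]
  refine (l1norm_sum_le _ _).trans_eq (Finset.sum_congr rfl fun k _ => ?_)
  rw [l1norm_smul, abs_of_nonneg (by unfold totalSize; positivity)]

theorem le_sampleSize (hnTS : nT ≤ nS) (k : Fin (K + 1)) : nT ≤ sampleSize nT nS k := by
  cases k using Fin.cases with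
  | zero => exact le_rfl
  | succ k => exact hnTS

theorem totalSize_pos (hnT : 0 < nT) : 0 < totalSize K nT nS := by
  unfold totalSize
  positivity

theorem sum_weight_mul_sqrt_le (hnT : 0 < nT) (hnTS : nT ≤ nS) :
    ∑ k, (sampleSize nT nS k : ℝ) / totalSize K nT nS
      * √(predSq (x k) (v k) / sampleSize nT nS k) ≤ √(meanPredSq x v) := by
  have hN : 0 < totalSize K nT nS := totalSize_pos hnT
  calc ∑ k, (sampleSize nT nS k : ℝ) / totalSize K nT nS
        * √(predSq (x k) (v k) / sampleSize nT nS k)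
      = ∑ k, √(sampleSize nT nS k / totalSize K nT nS)
          * √(predSq (x k) (v k) / totalSize K nT nS) := by
        refine Finset.sum_congr rfl fun k _ => ?_
        have hn : (0 : ℝ) < sampleSize nT nS k := by
          exact_mod_cast hnT.trans_le (le_sampleSize hnTS k)
        have h_weight : 0 ≤ (sampleSize nT nS k : ℝ) / totalSize K nT nS := by positivity
        rw [← Real.sqrt_mul h_weight]
        nth_rewrite 1 [← Real.sqrt_sq h_weight]
        rw [← Real.sqrt_mul (sq_nonneg _)]
        congr 1
        field_simp
    _ ≤ √(∑ k, (sampleSize nT nS k : ℝ) / totalSize K nT nS)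
          * √(∑ k, predSq (x k) (v k) / totalSize K nT nS) :=
        Real.sum_sqrt_mul_sqrt_le _ (fun k => by positivity)
          fun k => div_nonneg (predSq_nonneg _ _) hN.le
    _ = √(meanPredSq x v) := by
        rw [← Finset.sum_div, ← Finset.sum_div, sum_sampleSize, div_self hN.ne', Real.sqrt_one,
          one_mul, meanPredSq]

theorem norm_weightedAverage_le (hnT : 0 < nT) (hnTS : nT ≤ nS) (hl : 0 ≤ l) (hC₁ : 0 ≤ C₁)
    (hC₂ : 0 ≤ C₂) (hx : ∀ k, DesignRegular C₁ C₂ C₄ l (x k)) :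
    ‖weightedAverage nT nS v‖
      ≤ C₁ * √(meanPredSq x v) + C₂ * √(l / nT) * meanL1norm nT nS v := by
  have hN : 0 < totalSize K nT nS := totalSize_pos hnT
  have h_task (k : Fin (K + 1)) :
      ‖v k‖ ≤ C₁ * √(predSq (x k) (v k) / sampleSize nT nS k) + C₂ * √(l / nT) * l1norm (v k) := by
    have hn : (nT : ℝ) ≤ sampleSize nT nS k := by exact_mod_cast le_sampleSize hnTS k
    refine ((hx k).norm_le (hnT.trans_le (le_sampleSize hnTS k)) (v k)).trans ?_
    have := l1norm_nonneg (v k)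
    have : (0 : ℝ) < nT := by exact_mod_cast hnT
    gcongr
  rw [weightedAverage_eq_sum]
  calc ‖∑ k, ((sampleSize nT nS k : ℝ) / totalSize K nT nS) • v k‖
      ≤ ∑ k, (sampleSize nT nS k : ℝ) / totalSize K nT nS * ‖v k‖ := by
        refine (norm_sum_le _ _).trans_eq (Finset.sum_congr rfl fun k _ => ?_)
        rw [norm_smul, Real.norm_of_nonneg (by positivity)]
    _ ≤ ∑ k, (sampleSize nT nS k : ℝ) / totalSize K nT nS
          * (C₁ * √(predSq (x k) (v k) / sampleSize nT nS k)
            + C₂ * √(l / nT) * l1norm (v k)) := by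
        gcongr with k
        exact h_task k
    _ = C₁ * ∑ k, (sampleSize nT nS k : ℝ) / totalSize K nT nS
            * √(predSq (x k) (v k) / sampleSize nT nS k)
          + C₂ * √(l / nT) * meanL1norm nT nS v := by
        rw [meanL1norm, Finset.mul_sum, Finset.mul_sum, ← Finset.sum_add_distrib]
        exact Finset.sum_congr rfl fun k _ => by ring
    _ ≤ C₁ * √(meanPredSq x v) + C₂ * √(l / nT) * meanL1norm nT nS v := by
        gcongr
        exact sum_weight_mul_sqrt_le hnT hnTS

theorem sum_l1norm_exceptional_le (hnT : 0 < nT) (hC₃ : 0 ≤ C₃) (hB : 10 * (p * B.card) ≤ K)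
    (hxB : ∀ k ∈ B, ∀ w, √nS * l1norm w ≤ C₃ * √p * √(predSq (x k.succ) w)) :
    (nS : ℝ) / totalSize K nT nS * ∑ k ∈ B, l1norm (v k.succ) ≤ C₃ * √(meanPredSq x v) := by
  have hN : 0 < totalSize K nT nS := totalSize_pos hnT
  have h_sum : √nS * ∑ k ∈ B, l1norm (v k.succ)
      ≤ C₃ * √p * (√B.card * √(meanPredSq x v * totalSize K nT nS)) := by
    rw [Finset.mul_sum]
    refine (Finset.sum_le_sum fun k hk => hxB k hk (v k.succ)).trans ?_
    rw [← Finset.mul_sum]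
    gcongr
    refine (sum_sqrt_le B fun k => predSq_nonneg (x k.succ) (v k.succ)).trans ?_
    gcongr
    exact sum_predSq_succ_le hN B
  have h_few : √nS * √p * √B.card ≤ √(totalSize K nT nS) := by
    rw [← Real.sqrt_mul (Nat.cast_nonneg _), ← Real.sqrt_mul (by positivity)]
    refine Real.sqrt_le_sqrt ?_
    have h_card : (p : ℝ) * B.card ≤ K := by exact_mod_cast (by omega : p * B.card ≤ K)
    unfold totalSize
    nlinarith [Nat.cast_nonneg (α := ℝ) nS, Nat.cast_nonneg (α := ℝ) nT]
  rw [div_mul_eq_mul_div, div_le_iff₀ hN]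
  calc nS * ∑ k ∈ B, l1norm (v k.succ) = √nS * (√nS * ∑ k ∈ B, l1norm (v k.succ)) := by
        rw [← mul_assoc, Real.mul_self_sqrt (Nat.cast_nonneg _)]
    _ ≤ √nS * (C₃ * √p * (√B.card * √(meanPredSq x v * totalSize K nT nS))) := by gcongr
    _ = C₃ * √(meanPredSq x v) * (√nS * √p * √B.card * √(totalSize K nT nS)) := by
        rw [Real.sqrt_mul meanPredSq_nonneg]; ring
    _ ≤ C₃ * √(meanPredSq x v) * (√(totalSize K nT nS) * √(totalSize K nT nS)) := by gcongr
    _ = C₃ * √(meanPredSq x v) * totalSize K nT nS := by rw [Real.mul_self_sqrt hN.le]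

theorem meanL1norm_le (hnT : 0 < nT) (hC₃ : 0 ≤ C₃)
    (ha : ∀ k, 8 * (nS / totalSize K nT nS) ≤ a k) (hB : 10 * (p * B.card) ≤ K)
    (hxB : ∀ k ∈ B, ∀ w, √nS * l1norm w ≤ C₃ * √p * √(predSq (x k.succ) w)) :
    meanL1norm nT nS v ≤ l1norm (v 0) + ∑ k ∈ Bᶜ, a k * l1norm (v k.succ - v 0)
      + C₃ * √(meanPredSq x v) := by
  have hN : 0 < totalSize K nT nS := totalSize_pos hnT
  have h_regular : (nS : ℝ) / totalSize K nT nS * ∑ k ∈ Bᶜ, l1norm (v k.succ)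
      ≤ K * nS / totalSize K nT nS * l1norm (v 0) + ∑ k ∈ Bᶜ, a k * l1norm (v k.succ - v 0) := by
    have h_card : (Bᶜ.card : ℝ) ≤ K := by exact_mod_cast (Finset.card_le_univ Bᶜ).trans_eq (by simp)
    have h_task (k : Fin K) : (nS : ℝ) / totalSize K nT nS * l1norm (v k.succ)
        ≤ nS / totalSize K nT nS * l1norm (v 0) + a k * l1norm (v k.succ - v 0) := by
      have h_triangle : l1norm (v k.succ) ≤ l1norm (v 0) + l1norm (v k.succ - v 0) := by
        simpa using l1norm_add_le (v 0) (v k.succ - v 0)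
      have h_ratio : 0 ≤ (nS : ℝ) / totalSize K nT nS := by positivity
      have h_weight : nS / totalSize K nT nS ≤ a k := by linarith [ha k]
      linarith [mul_le_mul_of_nonneg_left h_triangle h_ratio,
        mul_le_mul_of_nonneg_right h_weight (l1norm_nonneg (v k.succ - v 0))]
    rw [Finset.mul_sum]
    refine (Finset.sum_le_sum fun k _ => h_task k).trans ?_
    rw [Finset.sum_add_distrib, Finset.sum_const, nsmul_eq_mul, ← mul_assoc, mul_div_assoc']
    have := l1norm_nonneg (v 0)
    gcongr
  have h_total : K * nS / totalSize K nT nS * l1norm (v 0)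
      + nT / totalSize K nT nS * l1norm (v 0) = l1norm (v 0) := by
    rw [← add_mul, ← add_div, ← totalSize, div_self hN.ne', one_mul]
  rw [meanL1norm, Fin.sum_univ_succ]
  simp only [cast_sampleSize_zero, cast_sampleSize_succ, ← Finset.mul_sum]
  rw [← Finset.sum_add_sum_compl B]
  linarith [sum_l1norm_exceptional_le (v := v) hnT hC₃ hB hxB]

end WeightedAverage

section Tuning

/-- The statistical rate `s log p / N + h̄ √(log p / n_T)` of the two-step estimator. -/
noncomputable def rate {K : ℕ} (p s nT nS : ℕ) (h : Fin K → ℝ) : ℝ :=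
  s * Real.log p / totalSize K nT nS + hbar nT nS h * √(Real.log p / nT)

/-- The relations between dimension, sparsity, sample sizes and model shifts under which the
two-step estimator attains the rate. -/
structure Scaling {K : ℕ} (CT η : ℝ) (p s nT nS : ℕ) (h : Fin K → ℝ) : Prop where
  two_le_dim : 2 ≤ p
  one_le_sources : 1 ≤ K
  one_le_sparsity : 1 ≤ s
  size_le : nT ≤ nS
  sparsity_le : (s : ℝ) * Real.log p ≤ CT * nT
  drift_le : hbar nT nS h * √(Real.log p / nT) + (K : ℝ) * s * Real.log p / nS ≤ η
  shift_nonneg : ∀ k, 0 ≤ h k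

namespace Scaling

variable {K p s nT nS : ℕ} {CT η c₀ : ℝ} {h : Fin K → ℝ}

theorem log_pos (hs : Scaling CT η p s nT nS h) : 0 < Real.log p :=
  Real.log_pos (by exact_mod_cast hs.two_le_dim)

theorem size_target_pos (hs : Scaling CT η p s nT nS h) : 0 < nT := by
  have hl := hs.log_pos
  have h_one : (1 : ℝ) ≤ s := by exact_mod_cast hs.one_le_sparsity
  refine Nat.pos_of_ne_zero fun h_zero => ?_
  have h_le := hs.sparsity_le
  rw [h_zero, Nat.cast_zero, mul_zero] at h_le
  exact absurd h_le (not_le.2 (by positivity))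

theorem size_source_pos (hs : Scaling CT η p s nT nS h) : 0 < nS :=
  hs.size_target_pos.trans_le hs.size_le

theorem size_source_le_total (hs : Scaling CT η p s nT nS h) :
    (nS : ℝ) ≤ totalSize K nT nS := by
  have hK : (1 : ℝ) ≤ K := by exact_mod_cast hs.one_le_sources
  unfold totalSize
  nlinarith [Nat.cast_nonneg (α := ℝ) nT, Nat.cast_nonneg (α := ℝ) nS]

theorem total_pos (hs : Scaling CT η p s nT nS h) : 0 < totalSize K nT nS :=
  totalSize_pos hs.size_target_pos

theorem sum_shift_nonneg (hs : Scaling CT η p s nT nS h) : 0 ≤ ∑ k, h k :=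
  Finset.sum_nonneg fun k _ => hs.shift_nonneg k

theorem hbar_mul_nonneg (hs : Scaling CT η p s nT nS h) :
    0 ≤ hbar nT nS h * √(Real.log p / nT) :=
  mul_nonneg (mul_nonneg (div_nonneg (Nat.cast_nonneg _) hs.total_pos.le) hs.sum_shift_nonneg)
    (Real.sqrt_nonneg _)

theorem sparsity_div_le (hs : Scaling CT η p s nT nS h) : s * Real.log p / nS ≤ η := by
  have hl := hs.log_pos
  have hK : (1 : ℝ) ≤ K := by exact_mod_cast hs.one_le_sources
  have h_mono : s * Real.log p / nS ≤ K * s * Real.log p / nS := by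
    gcongr
    exact le_mul_of_one_le_left (Nat.cast_nonneg s) hK
  linarith [hs.drift_le, hs.hbar_mul_nonneg]

theorem hbar_mul_le_rate (hs : Scaling CT η p s nT nS h) :
    hbar nT nS h * √(Real.log p / nT) ≤ rate p s nT nS h :=
  le_add_of_nonneg_left (div_nonneg (mul_nonneg (Nat.cast_nonneg _) hs.log_pos.le) hs.total_pos.le)

theorem sparsity_div_total_le_rate (hs : Scaling CT η p s nT nS h) :
    s * Real.log p / totalSize K nT nS ≤ rate p s nT nS h :=
  le_add_of_nonneg_right hs.hbar_mul_nonneg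

theorem rate_nonneg (hs : Scaling CT η p s nT nS h) : 0 ≤ rate p s nT nS h :=
  hs.hbar_mul_nonneg.trans hs.hbar_mul_le_rate

theorem rate_le (hs : Scaling CT η p s nT nS h) : rate p s nT nS h ≤ η := by
  have hl := hs.log_pos
  have hnS : (0 : ℝ) < nS := by exact_mod_cast hs.size_source_pos
  have hK : (1 : ℝ) ≤ K := by exact_mod_cast hs.one_le_sources
  have h_sparse : s * Real.log p / totalSize K nT nS ≤ K * s * Real.log p / nS := by
    gcongr
    · exact le_mul_of_one_le_left (Nat.cast_nonneg s) hK
    · exact hs.size_source_le_total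
  unfold rate
  linarith [hs.drift_le]

theorem log_div_total_le_rate (hs : Scaling CT η p s nT nS h) :
    Real.log p / totalSize K nT nS ≤ rate p s nT nS h := by
  refine le_trans ?_ hs.sparsity_div_total_le_rate
  have hN := hs.total_pos
  gcongr
  exact le_mul_of_one_le_left hs.log_pos.le (by exact_mod_cast hs.one_le_sparsity)

theorem sparsity_mul_log_div_le (hs : Scaling CT η p s nT nS h) :
    s * (Real.log p / nT) ≤ CT := by
  rw [mul_div_assoc', div_le_iff₀ (by exact_mod_cast hs.size_target_pos)]
  exact hs.sparsity_le

theorem log_div_le (hs : Scaling CT η p s nT nS h) : Real.log p / nT ≤ CT := by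
  refine (le_mul_of_one_le_left ?_ ?_).trans hs.sparsity_mul_log_div_le
  · exact div_nonneg hs.log_pos.le (Nat.cast_nonneg _)
  · exact_mod_cast hs.one_le_sparsity

theorem sources_mul_log_le (hs : Scaling CT η p s nT nS h) : K * Real.log p ≤ η * nS := by
  have hl := hs.log_pos
  have h_le : K * s * Real.log p / nS ≤ η := by linarith [hs.drift_le, hs.hbar_mul_nonneg]
  rw [div_le_iff₀ (by exact_mod_cast hs.size_source_pos)] at h_le
  refine le_trans ?_ h_le
  gcongr
  exact le_mul_of_one_le_right (Nat.cast_nonneg K) (by exact_mod_cast hs.one_le_sparsity)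

theorem four_mul_sq_mul_le (hs : Scaling CT η p s nT nS h) {b : ℝ} (hb : (100 * b) ^ 2 * η ≤ 1)
    (hpK : p ≤ K) : 4 * b ^ 2 * (Real.log p * p) ≤ nS := by
  have hl := hs.log_pos
  calc 4 * b ^ 2 * (Real.log p * p) ≤ 4 * b ^ 2 * (Real.log p * K) := by gcongr
    _ ≤ 4 * b ^ 2 * (η * nS) := by
      rw [mul_comm (Real.log p)]
      exact mul_le_mul_of_nonneg_left hs.sources_mul_log_le (by positivity)
    _ = 1 / 2500 * ((100 * b) ^ 2 * η) * nS := by ring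
    _ ≤ nS := mul_le_of_le_one_left (Nat.cast_nonneg nS) (by linarith)

theorem log_le_mul_sampleSize (hs : Scaling CT η p s nT nS h) (k : Fin (K + 1)) :
    Real.log p ≤ CT * sampleSize nT nS k := by
  have hCT : 0 ≤ CT := (div_nonneg hs.log_pos.le (Nat.cast_nonneg nT)).trans hs.log_div_le
  calc Real.log p ≤ CT * nT := (div_le_iff₀ (by exact_mod_cast hs.size_target_pos)).1 hs.log_div_le
    _ ≤ CT * sampleSize nT nS k := by
      gcongr
      exact_mod_cast le_sampleSize hs.size_le k

theorem lambdaZero_pos (hs : Scaling CT η p s nT nS h) (hc₀ : 0 < c₀) :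
    0 < lambdaZero c₀ p s nT nS h := by
  have hl := hs.log_pos
  have hN := hs.total_pos
  have hnS : (0 : ℝ) < nS := by exact_mod_cast hs.size_source_pos
  unfold lambdaZero
  split_ifs <;> positivity

theorem le_weight (hs : Scaling CT η p s nT nS h) (k : Fin K) :
    8 * (nS / totalSize K nT nS) ≤ weight p s nT nS h k := by
  have hN := hs.total_pos
  unfold weight
  split_ifs
  · gcongr
    refine Real.le_sqrt_of_sq_le (pow_le_of_le_one (by positivity) ?_ two_ne_zero)
    exact (div_le_one hN).2 hs.size_source_le_total
  · exact le_rfl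

theorem totalSize_mul_lambdaZero_mul_weight (hs : Scaling CT η p s nT nS h) (k : Fin K) :
    totalSize K nT nS * lambdaZero c₀ p s nT nS h * weight p s nT nS h k
      = 8 * c₀ * √(nS * Real.log p) := by
  have hN := hs.total_pos
  have hnS : (0 : ℝ) < nS := by exact_mod_cast hs.size_source_pos
  rw [Real.sqrt_mul hnS.le]
  unfold lambdaZero weight
  split_ifs
  · rw [Real.sqrt_div' _ hN.le, Real.sqrt_div' _ hN.le]
    field_simp
    rw [Real.sq_sqrt hN.le]
    ring
  · rw [Real.sqrt_div' _ hnS.le]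
    field_simp
    rw [Real.sq_sqrt hnS.le]

theorem le_totalSize_mul_lambdaZero (hs : Scaling CT η p s nT nS h) (hc₀ : 0 ≤ c₀) :
    c₀ * √(totalSize K nT nS * Real.log p)
      ≤ totalSize K nT nS * lambdaZero c₀ p s nT nS h := by
  have hl := hs.log_pos
  have hN := hs.total_pos
  have hnS : (0 : ℝ) < nS := by exact_mod_cast hs.size_source_pos
  have h_slow : √(Real.log p / totalSize K nT nS) ≤ √(Real.log p / nS) := by
    gcongr
    exact hs.size_source_le_total
  have h_sqrt : √(totalSize K nT nS * Real.log p)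
      = totalSize K nT nS * √(Real.log p / totalSize K nT nS) := by
    rw [Real.sqrt_mul hN.le, Real.sqrt_div' _ hN.le]
    field_simp
    rw [Real.sq_sqrt hN.le]
  rw [h_sqrt, lambdaZero, mul_left_comm]
  split_ifs <;> gcongr

theorem lambdaZero_sq_mul_le (hs : Scaling CT η p s nT nS h) :
    lambdaZero c₀ p s nT nS h ^ 2 * s ≤ c₀ ^ 2 * rate p s nT nS h := by
  have hl := hs.log_pos
  have hN := hs.total_pos
  unfold lambdaZero
  rw [mul_pow, mul_assoc]
  gcongr
  split_ifs with hA
  · rw [Real.sq_sqrt (by positivity), div_mul_eq_mul_div, mul_comm]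
    exact hs.sparsity_div_total_le_rate
  · rw [Real.sq_sqrt (by positivity), div_mul_eq_mul_div, mul_comm]
    exact (not_le.1 hA).le.trans hs.hbar_mul_le_rate

theorem lambdaZero_mul_sum_weight_le (hs : Scaling CT η p s nT nS h) (hc₀ : 0 ≤ c₀) :
    lambdaZero c₀ p s nT nS h * ∑ k, weight p s nT nS h k * h k
      ≤ 8 * c₀ * rate p s nT nS h := by
  have hl := hs.log_pos
  have hN := hs.total_pos
  have hnT : (0 : ℝ) < nT := by exact_mod_cast hs.size_target_pos
  have hnTS : (nT : ℝ) ≤ nS := by exact_mod_cast hs.size_le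
  have h_product (k : Fin K) : lambdaZero c₀ p s nT nS h * (weight p s nT nS h k * h k)
      = 8 * c₀ * √(nS * Real.log p) / totalSize K nT nS * h k := by
    rw [← hs.totalSize_mul_lambdaZero_mul_weight k]
    field_simp
  have h_slow : √(nS * Real.log p) ≤ nS * √(Real.log p / nT) := by
    rw [Real.sqrt_le_left (by positivity), mul_pow, Real.sq_sqrt (by positivity), sq, mul_assoc]
    gcongr
    rw [mul_div_assoc', le_div_iff₀ hnT, mul_comm]
    gcongr
  have h_sum := hs.sum_shift_nonneg
  rw [Finset.mul_sum]
  calc ∑ k, lambdaZero c₀ p s nT nS h * (weight p s nT nS h k * h k)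
      = 8 * c₀ * √(nS * Real.log p) / totalSize K nT nS * ∑ k, h k := by
        rw [Finset.mul_sum]
        exact Finset.sum_congr rfl fun k _ => h_product k
    _ ≤ 8 * c₀ * (nS * √(Real.log p / nT)) / totalSize K nT nS * ∑ k, h k := by gcongr
    _ = 8 * c₀ * (hbar nT nS h * √(Real.log p / nT)) := by rw [hbar]; ring
    _ ≤ 8 * c₀ * rate p s nT nS h := by gcongr; exact hs.hbar_mul_le_rate

theorem log_div_mul_sum_weight_sq_le (hs : Scaling CT η p s nT nS h) (hη : η ≤ 1) :
    Real.log p / nT * (∑ k, weight p s nT nS h k * h k) ^ 2 ≤ 128 * rate p s nT nS h := by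
  have hl := hs.log_pos
  have hN := hs.total_pos
  have hnS : (0 : ℝ) < nS := by exact_mod_cast hs.size_source_pos
  have h_drift := hs.hbar_mul_nonneg
  have h_bound {t : ℝ} (ht : t * (hbar nT nS h * √(Real.log p / nT)) ≤ 2) :
      64 * t * (hbar nT nS h * √(Real.log p / nT)) ^ 2 ≤ 128 * rate p s nT nS h := by
    have := mul_le_mul_of_nonneg_right ht h_drift
    linarith [hs.hbar_mul_le_rate]
  simp only [weight, ← Finset.mul_sum]
  split_ifs with hA
  · convert h_bound (t := totalSize K nT nS / nS) ?_ using 1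
    · rw [mul_pow, mul_pow, mul_pow, Real.sq_sqrt (by positivity), Real.sq_sqrt (by positivity),
        hbar]
      field_simp
      ring
    · calc totalSize K nT nS / nS * (hbar nT nS h * √(Real.log p / nT))
          ≤ 2 * K * (s * Real.log p / nS) := by
            gcongr
            · rw [div_le_iff₀ hnS]
              exact totalSize_le hs.one_le_sources hs.size_le
            · exact hA
        _ = 2 * (K * s * Real.log p / nS) := by ring
        _ ≤ 2 := by linarith [hs.drift_le]
  · convert h_bound (t := 1) ?_ using 1
    · rw [mul_pow (hbar nT nS h), Real.sq_sqrt (by positivity), hbar]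
      ring
    · linarith [hs.rate_le, hs.hbar_mul_le_rate]

end Scaling

end Tuning

section ErrorBound

variable {p K nT nS s : ℕ} {C₁ C₂ C₄ CT η c₀ c₁ : ℝ} {h : Fin K → ℝ}
  {x : Designs p K nT nS} {e : Responses K nT nS} {B : Finset (Fin K)}
  {β d v : Fin (K + 1) → EuclideanSpace ℝ (Fin p)}

/-- The conditions on the errors under which the two-step estimator is accurate. The sources in the
exceptional set `B` are those with a large score, and `d` is a lasso fit of their errors; it
vanishes on all the other tasks. -/
structure IsNoiseFit (c₀ c₁ : ℝ) (x : Designs p K nT nS) (e : Responses K nT nS)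
    (B : Finset (Fin K)) (d : Fin (K + 1) → EuclideanSpace ℝ (Fin p)) : Prop where
  card_le : 10 * (p * B.card) ≤ K
  target_eq_zero : d 0 = 0
  eq_zero : ∀ k ∉ B, d k.succ = 0
  abs_score_le : ∀ k ∉ B, ∀ j,
    |score (x k.succ) (e k.succ) j| ≤ 4 * c₀ * √(nS * Real.log p)
  lassoOptimal : ∀ k ∈ B, LassoOptimal (x k.succ) (8 * c₀ * √(nS * Real.log p))
    (score (x k.succ) (e k.succ)) (d k.succ)
  abs_sum_score_le : ∀ j, |(∑ k, (score (x k) (e k) - gramMul (x k) (d k))) j|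
    ≤ c₀ * √(totalSize K nT nS * Real.log p) / 2
  sq_l1norm_average_le : l1norm (weightedAverage nT nS d) ^ 2 ≤ Real.log p / totalSize K nT nS
  abs_target_score_le : ∀ j, |score (x 0) (e 0) j| ≤ c₁ * √(nT * Real.log p) / 2

theorem exists_card_le_of_l0norm_le {b : EuclideanSpace ℝ (Fin p)} (hb : l0norm b ≤ s) :
    ∃ S : Finset (Fin p), S.card ≤ s ∧ ∀ j ∉ S, b j = 0 := by
  classical
  refine ⟨Finset.univ.filter fun j => b j ≠ 0, ?_, fun j hj => by simpa using hj⟩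
  rwa [l0norm, Set.ncard_eq_toFinset_card', Set.toFinset_ofPred] at hb

theorem IsNoiseFit.oracle_inequality (hd : IsNoiseFit c₀ c₁ x e B d)
    (hs : Scaling CT η p s nT nS h) (hc₀ : 0 < c₀) (hβ : β ∈ parameterSpace s h)
    {S : Finset (Fin p)} (hS : ∀ j ∉ S, β 0 j = 0)
    (h_min : IsMinOn (coTrainingObjective x (response β x e) (lambdaZero c₀ p s nT nS h)
      (weight p s nT nS h)) Set.univ (β + d + v)) :
    meanPredSq x v + lambdaZero c₀ p s nT nS h * (∑ j ∈ Sᶜ, |v 0 j|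
        + ∑ k ∈ Bᶜ, weight p s nT nS h k * l1norm (v k.succ - v 0))
      ≤ lambdaZero c₀ p s nT nS h * (3 * ∑ j ∈ S, |v 0 j|
        + 4 * ∑ k, weight p s nT nS h k * h k) := by
  have hN := hs.total_pos
  have h_lam := hs.lambdaZero_pos hc₀
  have h_weight (k : Fin K) : 0 ≤ weight p s nT nS h k :=
    (by positivity : (0 : ℝ) ≤ 8 * (nS / totalSize K nT nS)).trans (hs.le_weight k)
  refine (coTraining_oracle_inequality hN h_lam.le h_weight hS hd.target_eq_zero hd.eq_zero
    (fun k hk j => ?_) (fun k hk => ?_) (fun j => ?_) (h_min (Set.mem_univ _))).trans ?_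
  · rw [hs.totalSize_mul_lambdaZero_mul_weight]
    linarith [hd.abs_score_le k hk j]
  · rw [hs.totalSize_mul_lambdaZero_mul_weight]
    exact hd.lassoOptimal k hk
  · linarith [hd.abs_sum_score_le j, hs.le_totalSize_mul_lambdaZero hc₀.le]
  · gcongr with k
    · exact h_weight k
    · exact hβ.2 k

theorem Scaling.mul_sqrt_le (hs : Scaling CT η p s nT nS h) (hη : (100 * C₂) ^ 2 * η ≤ 1) :
    C₂ * √(s * Real.log p / nS) ≤ 1 / 100 := by
  refine le_of_sq_le_sq ?_ (by norm_num)
  have hl := hs.log_pos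
  have h_le := mul_le_mul_of_nonneg_left hs.sparsity_div_le (sq_nonneg (100 * C₂))
  rw [mul_pow, Real.sq_sqrt (by positivity)]
  linarith

theorem IsNoiseFit.sqrt_mul_l1norm_le (hd : IsNoiseFit c₀ c₁ x e B d)
    (hs : Scaling CT η p s nT nS h) (hC₂ : 0 ≤ C₂) (hη : (100 * C₂) ^ 2 * η ≤ 1)
    (hx : ∀ k, DesignRegular C₁ C₂ C₄ (Real.log p) (x k)) {k : Fin K} (hk : k ∈ B)
    (w : EuclideanSpace ℝ (Fin p)) :
    √nS * l1norm w ≤ 2 * C₁ * √p * √(predSq (x k.succ) w) := by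
  have h_card := Nat.mul_le_mul_left p (Finset.card_pos.2 ⟨k, hk⟩)
  have h_dim : p ≤ K := by linarith [hd.card_le]
  exact (hx k.succ).sqrt_mul_l1norm_le hs.log_pos.le hC₂ (hs.four_mul_sq_mul_le hη h_dim) w

/-- The constant in the bound on the prediction error of the co-training step. -/
noncomputable def predConst (C₁ c₀ : ℝ) : ℝ := √(40 * C₁ ^ 2 * c₀ ^ 2 + 64 * c₀)

/-- The constant in the bound on the `ℓ₁` error of the co-training step over the tasks outside the
exceptional set. -/
noncomputable def coneConst (C₁ CT c₀ : ℝ) : ℝ := √(16000 * (25 * C₁ ^ 4 * CT * c₀ ^ 2 + 128))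

theorem IsNoiseFit.cone_bounds (hd : IsNoiseFit c₀ c₁ x e B d) (hs : Scaling CT η p s nT nS h)
    (hC₁ : 0 ≤ C₁) (hc₀ : 0 < c₀) (hη : η ≤ 1) (hηC : (100 * C₂) ^ 2 * η ≤ 1)
    (hx : ∀ k, DesignRegular C₁ C₂ C₄ (Real.log p) (x k)) (hβ : β ∈ parameterSpace s h)
    (h_min : IsMinOn (coTrainingObjective x (response β x e) (lambdaZero c₀ p s nT nS h)
      (weight p s nT nS h)) Set.univ (β + d + v)) :
    √(meanPredSq x v) ≤ predConst C₁ c₀ * √(rate p s nT nS h) ∧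
      √(Real.log p / nT) * (l1norm (v 0)
        + ∑ k ∈ Bᶜ, weight p s nT nS h k * l1norm (v k.succ - v 0))
        ≤ coneConst C₁ CT c₀ * √(rate p s nT nS h) := by
  have hN := hs.total_pos
  have hl := hs.log_pos
  have hnT : (0 : ℝ) < nT := by exact_mod_cast hs.size_target_pos
  obtain ⟨S, hS_card, hS⟩ := exists_card_le_of_l0norm_le hβ.1
  have h_weight (k : Fin K) : 0 ≤ weight p s nT nS h k :=
    (by positivity : (0 : ℝ) ≤ 8 * (nS / totalSize K nT nS)).trans (hs.le_weight k)
  have h_target := sum_abs_target_le_average (v := v) (by linarith [hs.two_le_dim])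
    hs.one_le_sources hs.size_source_pos hs.size_le hS_card hC₁ (hs.mul_sqrt_le hηC) hd.card_le
    hs.le_weight hx
  rw [← sum_abs_add_sum_abs_compl S] at h_target ⊢
  obtain ⟨h_pred, h_cone⟩ := TransFusion.cone_bounds (hs.lambdaZero_pos hc₀) meanPredSq_nonneg
    (by positivity) (b := 5 / 2 * C₁ ^ 2 * s) (by positivity)
    (Finset.sum_nonneg fun _ _ => abs_nonneg _) (Finset.sum_nonneg fun _ _ => abs_nonneg _)
    (Finset.sum_nonneg fun k _ => mul_nonneg (h_weight k) (l1norm_nonneg _))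
    (by rw [mul_pow, Real.sq_sqrt (by have := meanPredSq_nonneg (x := x) (v := v); positivity)]
        exact le_of_eq (by ring))
    (hd.oracle_inequality hs hc₀ hβ hS h_min) h_target
  have h_lam := hs.lambdaZero_sq_mul_le (c₀ := c₀)
  constructor
  · rw [predConst, ← Real.sqrt_mul (by positivity)]
    refine Real.sqrt_le_sqrt (h_pred.trans ?_)
    nlinarith [hs.lambdaZero_mul_sum_weight_le hc₀.le, sq_nonneg C₁]
  · have h_CT := hs.sparsity_mul_log_div_le
    have h_CT_nonneg : 0 ≤ CT := le_trans (by positivity) h_CT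
    have h_cross := mul_le_mul h_lam h_CT (by positivity) (h_lam.trans' (by positivity))
    rw [coneConst, ← Real.sqrt_mul (by positivity)]
    refine Real.le_sqrt_of_sq_le ?_
    rw [mul_pow, Real.sq_sqrt (by positivity)]
    refine (mul_le_mul_of_nonneg_left h_cone (by positivity)).trans ?_
    linarith [hs.log_div_mul_sum_weight_sq_le hη,
      mul_le_mul_of_nonneg_left h_cross (by positivity : 0 ≤ C₁ ^ 4)]

/-- The constant in the error bounds for the weighted average of the co-training step. -/
noncomputable def averageConst (C₁ C₂ CT c₀ : ℝ) : ℝ :=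
  1 + √CT + C₁ * predConst C₁ c₀
    + (1 + C₂) * (coneConst C₁ CT c₀ + 2 * C₁ * (√CT * predConst C₁ c₀))

theorem IsNoiseFit.sqrt_mul_meanL1norm_le (hd : IsNoiseFit c₀ c₁ x e B d)
    (hs : Scaling CT η p s nT nS h) (hC₁ : 0 ≤ C₁) (hC₂ : 0 ≤ C₂) (hc₀ : 0 < c₀) (hη : η ≤ 1)
    (hηC : (100 * C₂) ^ 2 * η ≤ 1) (hx : ∀ k, DesignRegular C₁ C₂ C₄ (Real.log p) (x k))
    (hβ : β ∈ parameterSpace s h)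
    (h_min : IsMinOn (coTrainingObjective x (response β x e) (lambdaZero c₀ p s nT nS h)
      (weight p s nT nS h)) Set.univ (β + d + v)) :
    √(Real.log p / nT) * meanL1norm nT nS v
      ≤ (coneConst C₁ CT c₀ + 2 * C₁ * (√CT * predConst C₁ c₀)) * √(rate p s nT nS h) := by
  obtain ⟨h_pred, h_cone⟩ := hd.cone_bounds hs hC₁ hc₀ hη hηC hx hβ h_min
  have h_mean := meanL1norm_le (v := v) hs.size_target_pos (by positivity : 0 ≤ 2 * C₁)
    hs.le_weight hd.card_le fun k hk w => hd.sqrt_mul_l1norm_le hs hC₂ hηC hx hk w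
  have h_rho : √(Real.log p / nT) * √(meanPredSq x v)
      ≤ √CT * (predConst C₁ c₀ * √(rate p s nT nS h)) :=
    mul_le_mul (Real.sqrt_le_sqrt hs.log_div_le) h_pred (Real.sqrt_nonneg _) (Real.sqrt_nonneg _)
  linarith [mul_le_mul_of_nonneg_left h_mean (Real.sqrt_nonneg (Real.log p / nT)),
    mul_le_mul_of_nonneg_left h_rho (by positivity : 0 ≤ 2 * C₁)]

theorem IsNoiseFit.l1norm_average_le (hd : IsNoiseFit c₀ c₁ x e B d)
    (hs : Scaling CT η p s nT nS h) :
    l1norm (weightedAverage nT nS d) ≤ √(rate p s nT nS h) :=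
  Real.le_sqrt_of_sq_le (hd.sq_l1norm_average_le.trans hs.log_div_total_le_rate)

theorem IsNoiseFit.average_error_le (hd : IsNoiseFit c₀ c₁ x e B d)
    (hs : Scaling CT η p s nT nS h) (hC₁ : 0 ≤ C₁) (hC₂ : 0 ≤ C₂) (hc₀ : 0 < c₀) (hη : η ≤ 1)
    (hηC : (100 * C₂) ^ 2 * η ≤ 1) (hx : ∀ k, DesignRegular C₁ C₂ C₄ (Real.log p) (x k))
    (hβ : β ∈ parameterSpace s h)
    (h_min : IsMinOn (coTrainingObjective x (response β x e) (lambdaZero c₀ p s nT nS h)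
      (weight p s nT nS h)) Set.univ (β + d + v)) :
    ‖weightedAverage nT nS (d + v)‖ ≤ averageConst C₁ C₂ CT c₀ * √(rate p s nT nS h) ∧
      √(Real.log p / nT) * l1norm (weightedAverage nT nS (d + v))
        ≤ averageConst C₁ C₂ CT c₀ * √(rate p s nT nS h) := by
  have h_pred := (hd.cone_bounds hs hC₁ hc₀ hη hηC hx hβ h_min).1
  have h_mean := hd.sqrt_mul_meanL1norm_le hs hC₁ hC₂ hc₀ hη hηC hx hβ h_min
  have h_fit := hd.l1norm_average_le hs
  have h_predConst : 0 ≤ predConst C₁ c₀ := Real.sqrt_nonneg _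
  have h_coneConst : 0 ≤ coneConst C₁ CT c₀ := Real.sqrt_nonneg _
  rw [weightedAverage_add, averageConst]
  constructor
  · have h_norm := norm_weightedAverage_le (v := v) hs.size_target_pos hs.size_le hs.log_pos.le
      hC₁ hC₂ hx
    have h_add := norm_add_le (weightedAverage nT nS d) (weightedAverage nT nS v)
    have h_fit_norm := (norm_le_l1norm (weightedAverage nT nS d)).trans h_fit
    have : 0 ≤ (√CT + (coneConst C₁ CT c₀ + 2 * C₁ * (√CT * predConst C₁ c₀)))
      * √(rate p s nT nS h) := by positivity
    linarith [mul_le_mul_of_nonneg_left h_mean hC₂, mul_le_mul_of_nonneg_left h_pred hC₁]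
  · have h_rho := mul_le_mul (Real.sqrt_le_sqrt hs.log_div_le) h_fit (l1norm_nonneg _)
      (Real.sqrt_nonneg _)
    have h_add := mul_le_mul_of_nonneg_left
      ((l1norm_add_le _ _).trans (add_le_add_right (l1norm_weightedAverage_le (nT := nT)
        (nS := nS) v) (l1norm (weightedAverage nT nS d)))) (Real.sqrt_nonneg (Real.log p / nT))
    have : 0 ≤ (1 + C₁ * predConst C₁ c₀ + C₂ * (coneConst C₁ CT c₀
      + 2 * C₁ * (√CT * predConst C₁ c₀))) * √(rate p s nT nS h) := by positivity
    linarith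

theorem sub_weightedAverage_eq (hN : 0 < totalSize K nT nS) (b : EuclideanSpace ℝ (Fin p)) :
    b - weightedAverage nT nS β = weightedAverage nT nS fun k => b - β k := by
  have h_weights : ∑ k : Fin (K + 1), (sampleSize nT nS k : ℝ) / totalSize K nT nS = 1 := by
    rw [← Finset.sum_div, sum_sampleSize, div_self hN.ne']
  simp only [weightedAverage_eq_sum, smul_sub, Finset.sum_sub_distrib, ← Finset.sum_smul,
    h_weights, one_smul]

theorem l1norm_sub_weightedAverage_le (hN : 0 < totalSize K nT nS)
    (hβ : ∀ k, l1norm (β k.succ - β 0) ≤ h k) :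
    l1norm (β 0 - weightedAverage nT nS β) ≤ hbar nT nS h := by
  rw [sub_weightedAverage_eq hN]
  refine (l1norm_weightedAverage_le _).trans ?_
  rw [meanL1norm, Fin.sum_univ_succ, sub_self, l1norm_zero, mul_zero, zero_add, hbar,
    Finset.mul_sum]
  simp only [cast_sampleSize_succ]
  gcongr with k
  rw [← l1norm_neg, neg_sub]
  exact hβ k

/-- The constant in the error bound of the debias step started from a point whose error is
controlled by `M`. -/
noncomputable def debiasConst (C₁ C₂ C₄ c₁ M : ℝ) : ℝ :=
  C₁ * √(2 * C₄ * M ^ 2 + 4 * c₁) + C₂ * (M + (2 * C₄ * M ^ 2 + 4 * c₁) / c₁)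

theorem debias_pred_le {l r M : ℝ} {u v δ : EuclideanSpace ℝ (Fin p)} (hnT : 0 < nT)
    (hl : 0 ≤ l) (hC₄ : 0 ≤ C₄) (hc₁ : 0 ≤ c₁) (hr : 0 ≤ r)
    (hx : DesignRegular (n := nT) C₁ C₂ C₄ l (x 0))
    (h_score : ∀ j, |score (x 0) (e 0) j| ≤ c₁ * √(nT * l) / 2)
    (hu : ‖u‖ ≤ M * √r) (hu_l1 : √(l / nT) * l1norm u ≤ M * √r) (hδ : √(l / nT) * l1norm δ ≤ r)
    (h_min : debiasObjective x (response β x e) (c₁ * √(l / nT)) (β 0 + u - δ) (δ + v)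
      ≤ debiasObjective x (response β x e) (c₁ * √(l / nT)) (β 0 + u - δ) δ) :
    predSq (x 0) (u + v) / nT + c₁ * √(l / nT) * l1norm v ≤ (2 * C₄ * M ^ 2 + 4 * c₁) * r := by
  have hnT' : (0 : ℝ) < nT := by exact_mod_cast hnT
  have h_sqrt : √(nT * l) = nT * √(l / nT) := by
    rw [Real.sqrt_mul hnT'.le, Real.sqrt_div' _ hnT'.le]
    field_simp
    rw [Real.sq_sqrt hnT'.le, mul_comm]
  have h_basic := debias_basic_inequality hnT (by positivity)
    (fun j => (h_score j).trans_eq (by rw [h_sqrt]; ring)) h_min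
  have h_sq : ‖u‖ ^ 2 ≤ M ^ 2 * r := by
    simpa [mul_pow, Real.sq_sqrt hr] using pow_le_pow_left₀ (norm_nonneg u) hu 2
  have h_sq_l1 : l / nT * l1norm u ^ 2 ≤ M ^ 2 * r := by
    have := pow_le_pow_left₀ (mul_nonneg (Real.sqrt_nonneg _) (l1norm_nonneg u)) hu_l1 2
    rwa [mul_pow, mul_pow, Real.sq_sqrt (by positivity), Real.sq_sqrt hr] at this
  have h_pred : predSq (x 0) u / nT ≤ C₄ * (M ^ 2 * r + M ^ 2 * r) := by
    rw [div_le_iff₀ hnT', mul_comm]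
    refine (hx.upper u).trans ?_
    gcongr
  linarith [mul_le_mul_of_nonneg_left hδ hc₁]

theorem debias_error_le {l r M : ℝ} {u v δ : EuclideanSpace ℝ (Fin p)} (hnT : 0 < nT)
    (hl : 0 ≤ l) (hC₁ : 0 ≤ C₁) (hC₂ : 0 ≤ C₂) (hC₄ : 0 ≤ C₄) (hc₁ : 0 < c₁) (hr : 0 ≤ r)
    (hr_one : r ≤ 1) (hx : DesignRegular (n := nT) C₁ C₂ C₄ l (x 0))
    (h_score : ∀ j, |score (x 0) (e 0) j| ≤ c₁ * √(nT * l) / 2)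
    (hu : ‖u‖ ≤ M * √r) (hu_l1 : √(l / nT) * l1norm u ≤ M * √r) (hδ : √(l / nT) * l1norm δ ≤ r)
    (h_min : debiasObjective x (response β x e) (c₁ * √(l / nT)) (β 0 + u - δ) (δ + v)
      ≤ debiasObjective x (response β x e) (c₁ * √(l / nT)) (β 0 + u - δ) δ) :
    ‖u + v‖ ≤ debiasConst C₁ C₂ C₄ c₁ M * √r := by
  have h_basic := debias_pred_le hnT hl hC₄ hc₁.le hr hx h_score hu hu_l1 hδ h_min
  have hA : 0 ≤ 2 * C₄ * M ^ 2 + 4 * c₁ := by positivity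
  have h_pred : √(predSq (x 0) (u + v) / nT) ≤ √(2 * C₄ * M ^ 2 + 4 * c₁) * √r := by
    rw [← Real.sqrt_mul hA]
    refine Real.sqrt_le_sqrt (le_trans (le_add_of_nonneg_right ?_) h_basic)
    have := l1norm_nonneg v
    positivity
  have h_v : √(l / nT) * l1norm v ≤ (2 * C₄ * M ^ 2 + 4 * c₁) / c₁ * √r := by
    have h_root : r ≤ √r := Real.le_sqrt_of_sq_le (pow_le_of_le_one hr hr_one two_ne_zero)
    have := div_nonneg (predSq_nonneg (x 0) (u + v)) (Nat.cast_nonneg (α := ℝ) nT)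
    rw [div_mul_eq_mul_div, le_div_iff₀ hc₁]
    linarith [mul_le_mul_of_nonneg_left h_root hA]
  have h_add : √(l / nT) * l1norm (u + v) ≤ √(l / nT) * l1norm u + √(l / nT) * l1norm v := by
    rw [← mul_add]
    exact mul_le_mul_of_nonneg_left (l1norm_add_le u v) (Real.sqrt_nonneg _)
  have h_norm : ‖u + v‖ ≤ C₁ * √(predSq (x 0) (u + v) / nT)
      + C₂ * √(l / nT) * l1norm (u + v) := hx.norm_le hnT (u + v)
  rw [debiasConst]
  linarith [mul_le_mul_of_nonneg_left h_pred hC₁,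
    mul_le_mul_of_nonneg_left (h_add.trans (add_le_add hu_l1 h_v)) hC₂]

/-- The constant in the error bound of the two-step estimator. -/
noncomputable def errorConst (C₁ C₂ C₄ CT c₀ c₁ : ℝ) : ℝ :=
  debiasConst C₁ C₂ C₄ c₁ (averageConst C₁ C₂ CT c₀) ^ 2

theorem IsNoiseFit.twoStep_error_le (hd : IsNoiseFit c₀ c₁ x e B d)
    (hs : Scaling CT η p s nT nS h) (hC₁ : 0 ≤ C₁) (hC₂ : 0 ≤ C₂) (hC₄ : 0 ≤ C₄) (hc₀ : 0 < c₀)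
    (hc₁ : 0 < c₁) (hη : η ≤ 1) (hηC : (100 * C₂) ^ 2 * η ≤ 1)
    (hx : ∀ k, DesignRegular C₁ C₂ C₄ (Real.log p) (x k)) (hβ : β ∈ parameterSpace s h)
    {βhat : EuclideanSpace ℝ (Fin p)}
    (h_est : IsTwoStepEstimate x (response β x e) (lambdaZero c₀ p s nT nS h)
      (weight p s nT nS h) (lambdaTilde c₁ p nT) βhat) :
    ‖βhat - β 0‖ ^ 2 ≤ errorConst C₁ C₂ C₄ CT c₀ c₁ * rate p s nT nS h := by
  obtain ⟨b, δhat, hb, h_debias, rfl⟩ := h_est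
  obtain ⟨v, rfl⟩ : ∃ v, b = β + d + v := ⟨b - (β + d), (add_sub_cancel _ _).symm⟩
  obtain ⟨hu, hu_l1⟩ := hd.average_error_le hs hC₁ hC₂ hc₀ hη hηC hx hβ hb
  set u := weightedAverage nT nS (d + v)
  set δ := β 0 - weightedAverage nT nS β with hδ_def
  have h_shift : √(Real.log p / nT) * l1norm δ ≤ rate p s nT nS h := by
    refine le_trans ?_ hs.hbar_mul_le_rate
    rw [mul_comm]
    gcongr
    exact l1norm_sub_weightedAverage_le hs.total_pos hβ.2
  have h_start : weightedAverage nT nS (β + d + v) = β 0 + u - δ := by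
    rw [add_assoc, weightedAverage_add, hδ_def]
    abel
  rw [h_start] at h_debias ⊢
  have h_error := debias_error_le (v := δhat - δ) hs.size_target_pos hs.log_pos.le hC₁ hC₂ hC₄ hc₁
    hs.rate_nonneg (hs.rate_le.trans hη) (hx 0) hd.abs_target_score_le hu hu_l1 h_shift
    (by rw [add_sub_cancel]; exact h_debias (Set.mem_univ δ))
  calc ‖β 0 + u - δ + δhat - β 0‖ ^ 2 = ‖u + (δhat - δ)‖ ^ 2 := by congr 2; abel
    _ ≤ _ := pow_le_pow_left₀ (norm_nonneg _) h_error 2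
    _ = _ := by rw [mul_pow, Real.sq_sqrt hs.rate_nonneg, errorConst]

end ErrorBound

section Maurey

variable {ι E : Type*} [Fintype ι]

/- The right-hand side of the conclusion is the mean of `Q (z + ∑ i, V (f i)) (z + ∑ i, V (f i))`
over `m` independent indices `f i` with distribution `w`. -/
theorem nonneg_mean_of_nonneg_sums [AddCommGroup E] [Module ℝ E] {Q : LinearMap.BilinForm ℝ E}
    (hQ : ∀ v w, Q v w = Q w v) {w : ι → ℝ} (hw : ∀ i, 0 ≤ w i) (hw1 : ∑ i, w i = 1) (V : ι → E)
    (m : ℕ) (z : E) (h : ∀ f : Fin m → ι, 0 ≤ Q (z + ∑ i, V (f i)) (z + ∑ i, V (f i))) :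
    0 ≤ Q z z + 2 * m * Q z (∑ i, w i • V i)
      + m * (m - 1) * Q (∑ i, w i • V i) (∑ i, w i • V i) + m * ∑ i, w i * Q (V i) (V i) := by
  induction m generalizing z with
  | zero => simpa using h Fin.elim0
  | succ m ih =>
    set v := ∑ i, w i • V i with hv
    set S := ∑ i, w i * Q (V i) (V i) with hS
    have h_shift : ∀ i, 0 ≤ Q (z + V i) (z + V i) + 2 * m * Q (z + V i) v
        + m * (m - 1) * Q v v + m * S := fun i => ih (z + V i) fun f => by
      simpa only [Fin.sum_univ_succ, Fin.cons_zero, Fin.cons_succ, ← add_assoc]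
        using h (Fin.cons i f)
    have h_lin : ∀ y, ∑ i, w i * Q y (V i) = Q y v := fun y => by simp [hv, map_sum]
    have h_expand : ∀ i, w i * (Q (z + V i) (z + V i) + 2 * m * Q (z + V i) v
        + m * (m - 1) * Q v v + m * S)
        = w i * (Q z z + 2 * m * Q z v + m * (m - 1) * Q v v + m * S)
          + 2 * (w i * Q z (V i)) + w i * Q (V i) (V i) + 2 * m * (w i * Q v (V i)) := fun i => by
      simp only [map_add, LinearMap.add_apply]
      rw [hQ (V i) z, hQ (V i) v]
      ring
    have h_mean := Finset.sum_nonneg fun i (_ : i ∈ Finset.univ) => mul_nonneg (hw i) (h_shift i)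
    rw [Finset.sum_congr rfl fun i _ => h_expand i] at h_mean
    simp only [Finset.sum_add_distrib, ← Finset.mul_sum, ← Finset.sum_mul, hw1, h_lin,
      ← hS] at h_mean
    push_cast
    linarith

theorem nonneg_of_nonneg_sums [AddCommGroup E] [Module ℝ E] {Q : LinearMap.BilinForm ℝ E}
    (hQ : ∀ v w, Q v w = Q w v) {w : ι → ℝ} (hw : ∀ i, 0 ≤ w i) (hw1 : ∑ i, w i = 1) {V : ι → E}
    {m : ℕ} (hm : m ≠ 0) (h : ∀ f : Fin m → ι, 0 ≤ Q (∑ i, V (f i)) (∑ i, V (f i))) {U : ℝ}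
    (hU : ∀ i, Q (V i) (V i) ≤ U) :
    0 ≤ (m - 1) * Q (∑ i, w i • V i) (∑ i, w i • V i) + U := by
  have hm_pos : (0 : ℝ) < m := by positivity
  have h_mean := nonneg_mean_of_nonneg_sums hQ hw hw1 V m 0 fun f => by simpa using h f
  have h_atoms : ∑ i, w i * Q (V i) (V i) ≤ U := by
    calc _ ≤ ∑ i, w i * U := Finset.sum_le_sum fun i _ => mul_le_mul_of_nonneg_left (hU i) (hw i)
      _ = U := by rw [← Finset.sum_mul, hw1, one_mul]
  simp only [map_zero, LinearMap.zero_apply, mul_zero, zero_add] at h_mean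
  refine nonneg_of_mul_nonneg_right (a := (m : ℝ)) ?_ hm_pos
  linarith [mul_le_mul_of_nonneg_left h_atoms hm_pos.le]

/-- The symmetric bilinear form `s ⟨x v, x w⟩ + t ⟨v, w⟩`, where `x i` are the rows of a design. -/
noncomputable def gramForm [NormedAddCommGroup E] [InnerProductSpace ℝ E] (x : ι → E) (s t : ℝ) :
    LinearMap.BilinForm ℝ E :=
  s • ∑ i, (innerₗ E (x i)).smulRight (innerₗ E (x i)) + t • innerₗ E

theorem gramForm_symm [NormedAddCommGroup E] [InnerProductSpace ℝ E] (x : ι → E) (s t : ℝ)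
    (v w : E) : gramForm x s t v w = gramForm x s t w v := by
  simp [gramForm, real_inner_comm v w, mul_comm]

theorem gramForm_self [NormedAddCommGroup E] [InnerProductSpace ℝ E] (x : ι → E) (s t : ℝ)
    (v : E) : gramForm x s t v v = s * predSq x v + t * ‖v‖ ^ 2 := by
  simp [gramForm, predSq, sq]

variable {p : ℕ}

/-- The vertices `± e j` of the `ℓ₁` ball: the atoms of Maurey's argument. -/
noncomputable def signedBasis (a : Fin p × Bool) : EuclideanSpace ℝ (Fin p) :=
  EuclideanSpace.single a.1 (if a.2 then 1 else -1)

/-- The sums of `m` vertices of the `ℓ₁` ball. -/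
noncomputable def netPoint {m : ℕ} (f : Fin m → Fin p × Bool) : EuclideanSpace ℝ (Fin p) :=
  ∑ i, signedBasis (f i)

theorem norm_signedBasis (a : Fin p × Bool) : ‖signedBasis a‖ = 1 := by
  unfold signedBasis
  split_ifs <;> simp

theorem predSq_signedBasis (x : ι → EuclideanSpace ℝ (Fin p)) (a : Fin p × Bool) :
    predSq x (signedBasis a) = ∑ i, x i a.1 ^ 2 := by
  unfold signedBasis
  split_ifs <;> simp [predSq, EuclideanSpace.inner_single_right]

theorem sum_abs_smul_signedBasis (v : EuclideanSpace ℝ (Fin p)) :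
    ∑ j, |v j| • signedBasis (j, decide (0 ≤ v j)) = v := by
  have h_single : ∀ j, |v j| • signedBasis (j, decide (0 ≤ v j)) = EuclideanSpace.single j (v j) :=
    fun j => by
      ext i
      rcases le_or_gt 0 (v j) with h | h
      · by_cases hij : i = j <;> simp [signedBasis, h, abs_of_nonneg, hij]
      · by_cases hij : i = j <;> simp [signedBasis, not_le.2 h, abs_of_neg h, hij]
  rw [Finset.sum_congr rfl fun j _ => h_single j]
  ext i
  simp [Pi.single_apply]

theorem nonneg_of_nonneg_netPoint {m : ℕ} (hm : m ≠ 0) {x : ι → EuclideanSpace ℝ (Fin p)}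
    {s t U : ℝ} (h : ∀ f : Fin m → Fin p × Bool,
      0 ≤ s * predSq x (netPoint f) + t * ‖netPoint f‖ ^ 2)
    (hU : ∀ a, s * predSq x (signedBasis a) + t ≤ U) (v : EuclideanSpace ℝ (Fin p)) :
    0 ≤ (m - 1) * (s * predSq x v + t * ‖v‖ ^ 2) + U * l1norm v ^ 2 := by
  rcases (l1norm_nonneg v).eq_or_lt with hv | hv
  · have hv0 : v = 0 := norm_le_zero_iff.1 ((norm_le_l1norm v).trans hv.ge)
    simp [hv0, predSq]
  have h_bary : ∑ j, (|v j| / l1norm v) • signedBasis (j, decide (0 ≤ v j)) = (l1norm v)⁻¹ • v := by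
    simp only [div_eq_inv_mul, ← smul_smul, ← Finset.smul_sum, sum_abs_smul_signedBasis]
  have h_nonneg := nonneg_of_nonneg_sums (gramForm_symm x s t) (w := fun j => |v j| / l1norm v)
    (fun j => by positivity) (by rw [← Finset.sum_div]; exact div_self hv.ne')
    (V := fun j => signedBasis (j, decide (0 ≤ v j))) hm
    (fun f => by
      rw [gramForm_self]
      exact h fun i => (f i, decide (0 ≤ v (f i))))
    (fun j => by simpa [gramForm_self, norm_signedBasis] using hU (j, decide (0 ≤ v j)))
  rw [h_bary, gramForm_self, predSq_smul, norm_smul, Real.norm_of_nonneg (by positivity)]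
    at h_nonneg
  calc 0 ≤ l1norm v ^ 2 * _ := mul_nonneg (sq_nonneg _) h_nonneg
    _ = _ := by field_simp

theorem predSq_ge_of_netPoint {m : ℕ} (hm : m ≠ 0) {x : ι → EuclideanSpace ℝ (Fin p)} {θ U : ℝ}
    (hθ : 0 ≤ θ) (h : ∀ f : Fin m → Fin p × Bool, θ * ‖netPoint f‖ ^ 2 ≤ predSq x (netPoint f))
    (hU : ∀ j, ∑ i, x i j ^ 2 ≤ U) (v : EuclideanSpace ℝ (Fin p)) :
    (m - 1) * (θ * ‖v‖ ^ 2) ≤ (m - 1) * predSq x v + U * l1norm v ^ 2 := by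
  linarith [nonneg_of_nonneg_netPoint hm (x := x) (s := 1) (t := -θ) (U := U)
    (fun f => by linarith [h f]) (fun a => by rw [predSq_signedBasis]; linarith [hU a.1]) v]

theorem predSq_le_of_netPoint {m : ℕ} (hm : m ≠ 0) {x : ι → EuclideanSpace ℝ (Fin p)} {τ : ℝ}
    (h : ∀ f : Fin m → Fin p × Bool, predSq x (netPoint f) ≤ τ * ‖netPoint f‖ ^ 2)
    (v : EuclideanSpace ℝ (Fin p)) :
    (m - 1) * predSq x v ≤ τ * ((m - 1) * ‖v‖ ^ 2 + l1norm v ^ 2) := by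
  linarith [nonneg_of_nonneg_netPoint hm (x := x) (s := -1) (t := τ) (U := τ)
    (fun f => by linarith [h f]) (fun a => by linarith [predSq_nonneg x (signedBasis a)]) v]

end Maurey

section SubGaussian

variable {Ω : Type*} [MeasurableSpace Ω] {μ : Measure Ω}

theorem lintegral_exp_sq_div_four_gaussianReal :
    ∫⁻ g, ENNReal.ofReal (Real.exp (g ^ 2 / 4)) ∂(gaussianReal 0 1) = ENNReal.ofReal √2 := by
  rw [gaussianReal_of_var_ne_zero 0 one_ne_zero,
    lintegral_withDensity_eq_lintegral_mul _ (measurable_gaussianPDF 0 1) (by fun_prop)]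
  have h_density : ∀ g : ℝ,
      (gaussianPDF 0 1 * fun g : ℝ => ENNReal.ofReal (Real.exp (g ^ 2 / 4))) g
        = ENNReal.ofReal ((√(2 * Real.pi))⁻¹ * Real.exp (-(1 / 4) * g ^ 2)) := by
    intro g
    rw [Pi.mul_apply, gaussianPDF, ← ENNReal.ofReal_mul (gaussianPDFReal_nonneg _ _ _),
      gaussianPDFReal, mul_assoc, ← Real.exp_add]
    congr 3
    · simp
    · simp; ring
  simp_rw [h_density]
  rw [← ofReal_integral_eq_lintegral_ofReal
    ((integrable_exp_neg_mul_sq (by norm_num)).const_mul _)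
    (Filter.Eventually.of_forall fun g => by positivity), integral_const_mul, integral_gaussian,
    ← Real.sqrt_inv, ← Real.sqrt_mul (by positivity)]
  congr 2
  field_simp
  norm_num

theorem ofReal_exp_mul_sq_eq_lintegral_gaussianReal {t : ℝ} (ht : 0 ≤ t) (y : ℝ) :
    ENNReal.ofReal (Real.exp (t * y ^ 2))
      = ∫⁻ g, ENNReal.ofReal (Real.exp (√(2 * t) * g * y)) ∂(gaussianReal 0 1) := by
  have h_mgf := congrFun (mgf_fun_id_gaussianReal (μ := 0) (v := 1)) (√(2 * t) * y)
  simp_rw [mgf, mul_right_comm _ y] at h_mgf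
  rw [← ofReal_integral_eq_lintegral_ofReal
    (by simpa only [mul_right_comm] using integrable_exp_mul_gaussianReal (√(2 * t) * y))
    (Filter.Eventually.of_forall fun g => by positivity), h_mgf, mul_pow,
    Real.sq_sqrt (by positivity)]
  congr 2
  simp
  ring

/- Writing `exp (t y²)` as a Gaussian mixture of the functions `exp (u y)` reduces the claim to the
moment generating function of `Y`. -/
theorem lintegral_exp_mul_sq_le [SFinite μ] {Y : Ω → ℝ} {v : ℝ≥0} (hY : Measurable Y)
    (h : HasSubgaussianMGF Y v μ) {t : ℝ} (ht : 0 ≤ t) (htv : 4 * (t * v) ≤ 1) :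
    ∫⁻ ω, ENNReal.ofReal (Real.exp (t * Y ω ^ 2)) ∂μ ≤ ENNReal.ofReal √2 := by
  simp_rw [ofReal_exp_mul_sq_eq_lintegral_gaussianReal ht]
  rw [lintegral_lintegral_swap (by fun_prop), ← lintegral_exp_sq_div_four_gaussianReal]
  refine lintegral_mono fun g => ?_
  rw [← ofReal_integral_eq_lintegral_ofReal (h.integrable_exp_mul _)
    (Filter.Eventually.of_forall fun ω => by positivity)]
  refine ENNReal.ofReal_le_ofReal ((h.mgf_le _).trans (Real.exp_le_exp.2 ?_))
  rw [mul_pow, Real.sq_sqrt (by positivity)]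
  nlinarith [mul_le_mul_of_nonneg_right htv (sq_nonneg g)]

theorem integrable_exp_mul_sq [SFinite μ] {Y : Ω → ℝ} {v : ℝ≥0} (hY : Measurable Y)
    (h : HasSubgaussianMGF Y v μ) {t : ℝ} (ht : 0 ≤ t) (htv : 4 * (t * v) ≤ 1) :
    Integrable (fun ω => Real.exp (t * Y ω ^ 2)) μ :=
  (lintegral_ofReal_ne_top_iff_integrable (by fun_prop)
    (Filter.Eventually.of_forall fun ω => by positivity)).1
    ((lintegral_exp_mul_sq_le hY h ht htv).trans_lt ENNReal.ofReal_lt_top).ne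

theorem mgf_sq_le_two [SFinite μ] {Y : Ω → ℝ} {v : ℝ≥0} (hY : Measurable Y)
    (h : HasSubgaussianMGF Y v μ) {t : ℝ} (ht : 0 ≤ t) (htv : 4 * (t * v) ≤ 1) :
    mgf (fun ω => Y ω ^ 2) μ t ≤ 2 := by
  rw [mgf, integral_eq_lintegral_of_nonneg_ae
    (Filter.Eventually.of_forall fun ω => by positivity) (by fun_prop)]
  refine (ENNReal.toReal_mono ENNReal.ofReal_ne_top (lintegral_exp_mul_sq_le hY h ht htv)).trans ?_
  rw [ENNReal.toReal_ofReal (by positivity), Real.sqrt_le_left (by norm_num)]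
  norm_num

theorem integral_pow_four_le [SFinite μ] {Y : Ω → ℝ} {v : ℝ≥0} (hY : Measurable Y)
    (h : HasSubgaussianMGF Y v μ) {V : ℝ} (hV : 0 < V) (hvV : v ≤ V) :
    Integrable (fun ω => Y ω ^ 4) μ ∧ ∫ ω, Y ω ^ 4 ∂μ ≤ 64 * V ^ 2 := by
  have htv : 4 * (1 / (4 * V) * v) ≤ 1 := by
    rw [show 4 * (1 / (4 * V) * (v : ℝ)) = v / V by field_simp, div_le_one hV]
    exact hvV
  have h_exp_int := (integrable_exp_mul_sq hY h (by positivity) htv).const_mul (32 * V ^ 2)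
  have h_le_exp : ∀ ω, Y ω ^ 4 ≤ 32 * V ^ 2 * Real.exp (1 / (4 * V) * Y ω ^ 2) := fun ω => by
    have hx : 0 ≤ 1 / (4 * V) * Y ω ^ 2 := by positivity
    have h_quad := Real.quadratic_le_exp_of_nonneg hx
    calc Y ω ^ 4 = 32 * V ^ 2 * ((1 / (4 * V) * Y ω ^ 2) ^ 2 / 2) := by field_simp; ring
      _ ≤ _ := by gcongr; linarith
  have h_int : Integrable (fun ω => Y ω ^ 4) μ :=
    h_exp_int.mono' (by fun_prop) (Filter.Eventually.of_forall fun ω => by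
      rw [Real.norm_of_nonneg (by positivity)]
      exact h_le_exp ω)
  refine ⟨h_int, (integral_mono h_int h_exp_int h_le_exp).trans ?_⟩
  rw [integral_const_mul]
  have h_mgf := mgf_sq_le_two hY h (by positivity) htv
  rw [mgf] at h_mgf
  nlinarith [sq_nonneg V]

end SubGaussian

section IndependentSums

variable {Ω ι : Type*} [MeasurableSpace Ω] {μ : Measure Ω} [Fintype ι] {Y : ι → Ω → ℝ}

theorem exp_neg_le_one_sub_add_sq {x : ℝ} (hx : 0 ≤ x) : Real.exp (-x) ≤ 1 - x + x ^ 2 / 2 := by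
  have h_pos : 0 < 1 + x + x ^ 2 / 2 := by positivity
  rw [Real.exp_neg]
  refine (inv_anti₀ h_pos (Real.quadratic_le_exp_of_nonneg hx)).trans ?_
  rw [inv_eq_one_div, div_le_iff₀ h_pos]
  nlinarith [pow_nonneg hx 4]

theorem integrable_exp_neg_mul_of_nonneg [IsFiniteMeasure μ] {Z : Ω → ℝ} (hZ : Measurable Z)
    (h0 : ∀ ω, 0 ≤ Z ω) {t : ℝ} (ht : 0 ≤ t) : Integrable (fun ω => Real.exp (-t * Z ω)) μ :=
  Integrable.of_bound (C := 1) (by fun_prop) (Filter.Eventually.of_forall fun ω => by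
    rw [Real.norm_of_nonneg (by positivity), Real.exp_le_one_iff, neg_mul, neg_nonpos]
    exact mul_nonneg ht (h0 ω))

theorem mgf_neg_le_exp [IsProbabilityMeasure μ] {Z : Ω → ℝ} (hZ : Measurable Z)
    (h0 : ∀ ω, 0 ≤ Z ω) (h_sq_int : Integrable (fun ω => Z ω ^ 2) μ) {a M t : ℝ} (ht : 0 ≤ t)
    (h1 : a ≤ ∫ ω, Z ω ∂μ) (h2 : ∫ ω, Z ω ^ 2 ∂μ ≤ M) :
    mgf Z μ (-t) ≤ Real.exp (-(t * a) + t ^ 2 * M / 2) := by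
  have h_int : Integrable Z μ :=
    ((memLp_two_iff_integrable_sq hZ.aestronglyMeasurable).2 h_sq_int).integrable (by norm_num)
  have h_lin_int : Integrable (fun ω => 1 - t * Z ω) μ :=
    (integrable_const _).sub (h_int.const_mul _)
  have h_quad_int : Integrable (fun ω => t ^ 2 / 2 * Z ω ^ 2) μ := h_sq_int.const_mul _
  calc mgf Z μ (-t) ≤ ∫ ω, (1 - t * Z ω + t ^ 2 / 2 * Z ω ^ 2) ∂μ :=
        integral_mono (integrable_exp_neg_mul_of_nonneg hZ h0 ht) (h_lin_int.add h_quad_int)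
          fun ω => by
            have := exp_neg_le_one_sub_add_sq (mul_nonneg ht (h0 ω))
            rw [mul_pow] at this
            simp only [neg_mul]
            linarith
    _ = 1 - t * ∫ ω, Z ω ∂μ + t ^ 2 / 2 * ∫ ω, Z ω ^ 2 ∂μ := by
        rw [integral_add h_lin_int h_quad_int, integral_sub (integrable_const _)
          (h_int.const_mul _), integral_const_mul, integral_const_mul]
        simp
    _ ≤ -(t * a) + t ^ 2 * M / 2 + 1 := by
        linarith [mul_le_mul_of_nonneg_left h1 ht,
          mul_le_mul_of_nonneg_left h2 (by positivity : 0 ≤ t ^ 2 / 2)]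
    _ ≤ _ := Real.add_one_le_exp _

theorem prod_mgf_le_exp {t b : ℝ} (h : ∀ i, mgf (Y i) μ t ≤ Real.exp b) :
    ∏ i, mgf (Y i) μ t ≤ Real.exp (Fintype.card ι * b) := by
  rw [Real.exp_nat_mul]
  exact (Finset.prod_le_prod (fun i _ => mgf_nonneg) fun i _ => h i).trans (by simp)

theorem measureReal_sum_le_le_exp [IsProbabilityMeasure μ] (hY : ∀ i, Measurable (Y i))
    (h_indep : iIndepFun Y μ) (h0 : ∀ i ω, 0 ≤ Y i ω) {a M : ℝ} (ha : 0 ≤ a) (hM : 0 < M)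
    (h1 : ∀ i, a ≤ ∫ ω, Y i ω ∂μ) (h_int : ∀ i, Integrable (fun ω => Y i ω ^ 2) μ)
    (h2 : ∀ i, ∫ ω, Y i ω ^ 2 ∂μ ≤ M) :
    μ.real {ω | ∑ i, Y i ω ≤ Fintype.card ι * (a / 2)}
      ≤ Real.exp (-(a ^ 2 / (8 * M)) * Fintype.card ι) := by
  set t := a / (2 * M) with ht
  have ht0 : 0 ≤ t := by positivity
  have h_chernoff := measure_le_le_exp_mul_mgf (μ := μ) (X := ∑ i, Y i) (t := -t)
    (Fintype.card ι * (a / 2)) (by linarith) (h_indep.integrable_exp_mul_sum hY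
      fun i _ => integrable_exp_neg_mul_of_nonneg (hY i) (h0 i) ht0)
  rw [h_indep.mgf_sum hY] at h_chernoff
  simp only [Finset.sum_apply] at h_chernoff
  calc _ ≤ _ := h_chernoff
    _ ≤ Real.exp (-(-t) * (Fintype.card ι * (a / 2)))
          * Real.exp (Fintype.card ι * (-(t * a) + t ^ 2 * M / 2)) :=
        mul_le_mul_of_nonneg_left (prod_mgf_le_exp fun i =>
          mgf_neg_le_exp (hY i) (h0 i) (h_int i) ht0 (h1 i) (h2 i)) (Real.exp_nonneg _)
    _ = _ := by
        rw [← Real.exp_add, ht]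
        congr 1
        field_simp
        ring

theorem measureReal_sum_ge_le_exp [IsProbabilityMeasure μ] (hY : ∀ i, Measurable (Y i))
    (h_indep : iIndepFun Y μ) {t : ℝ} (ht : 0 ≤ t)
    (h_int : ∀ i, Integrable (fun ω => Real.exp (t * Y i ω)) μ)
    (h2 : ∀ i, mgf (Y i) μ t ≤ 2) (b : ℝ) :
    μ.real {ω | Fintype.card ι * b ≤ ∑ i, Y i ω}
      ≤ Real.exp (-(t * b - 1) * Fintype.card ι) := by
  have h_chernoff := measure_ge_le_exp_mul_mgf (μ := μ) (X := ∑ i, Y i) (t := t)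
    (Fintype.card ι * b) ht (h_indep.integrable_exp_mul_sum hY fun i _ => h_int i)
  rw [h_indep.mgf_sum hY] at h_chernoff
  simp only [Finset.sum_apply] at h_chernoff
  have h_two_le : (2 : ℝ) ≤ Real.exp 1 := by linarith [Real.add_one_le_exp (1 : ℝ)]
  calc _ ≤ _ := h_chernoff
    _ ≤ Real.exp (-t * (Fintype.card ι * b)) * Real.exp (Fintype.card ι * 1) :=
        mul_le_mul_of_nonneg_left (prod_mgf_le_exp fun i => (h2 i).trans h_two_le)
          (Real.exp_nonneg _)
    _ = _ := by
        rw [← Real.exp_add]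
        congr 1
        ring

end IndependentSums

section NetToRegular

variable {p n : ℕ} {c cl τ l CT : ℝ} {x : Fin n → EuclideanSpace ℝ (Fin p)}

theorem isClosed_setOf_designRegular (C₁ C₂ C₄ l : ℝ) :
    IsClosed {x : Fin n → EuclideanSpace ℝ (Fin p) | DesignRegular C₁ C₂ C₄ l x} := by
  have h_cont : ∀ v : EuclideanSpace ℝ (Fin p), Continuous
      fun x : Fin n → EuclideanSpace ℝ (Fin p) => predSq x v := fun v => by
    unfold predSq; fun_prop
  have h_eq : {x : Fin n → EuclideanSpace ℝ (Fin p) | DesignRegular C₁ C₂ C₄ l x}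
      = (⋂ v, {x | √n * ‖v‖ ≤ C₁ * √(predSq x v) + C₂ * √l * l1norm v})
        ∩ ⋂ v, {x | predSq x v ≤ n * (C₄ * (‖v‖ ^ 2 + l / n * l1norm v ^ 2))} := by
    ext x
    simp only [Set.mem_inter_iff, Set.mem_iInter, Set.mem_ofPred_eq]
    exact ⟨fun h => ⟨h.lower, h.upper⟩, fun h => ⟨h.1, h.2⟩⟩
  rw [h_eq]
  exact (isClosed_iInter fun v => isClosed_le continuous_const
      ((continuous_const.mul (h_cont v).sqrt).add continuous_const)).inter
    (isClosed_iInter fun v => isClosed_le (h_cont v) continuous_const)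

theorem sqrt_mul_norm_le_of_mul_norm_sq_le {C D : ℝ} (hC : 0 ≤ C) (hD : 0 ≤ D) (hl : 0 ≤ l)
    {v : EuclideanSpace ℝ (Fin p)}
    (h : n * ‖v‖ ^ 2 ≤ C * predSq x v + D * (l * l1norm v ^ 2)) :
    √n * ‖v‖ ≤ √C * √(predSq x v) + √D * √l * l1norm v := by
  have h_pred := predSq_nonneg x v
  have h_l1 := l1norm_nonneg v
  refine le_of_sq_le_sq ?_ (by positivity)
  have h_cross : 0 ≤ √C * √(predSq x v) * (√D * √l * l1norm v) := by positivity
  calc (√n * ‖v‖) ^ 2 = n * ‖v‖ ^ 2 := by rw [mul_pow, Real.sq_sqrt (Nat.cast_nonneg n)]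
    _ ≤ C * predSq x v + D * (l * l1norm v ^ 2) := h
    _ = (√C * √(predSq x v)) ^ 2 + (√D * √l * l1norm v) ^ 2 := by
      simp only [mul_pow, Real.sq_sqrt hC, Real.sq_sqrt h_pred, Real.sq_sqrt hD, Real.sq_sqrt hl]
      ring
    _ ≤ _ := by linarith [add_sq (√C * √(predSq x v)) (√D * √l * l1norm v)]

theorem predSq_le_of_netPoint_of_div_le (hn : 0 < n) (hl : 0 < l) (hτ : 0 ≤ τ) {m : ℕ}
    (hm : n / l ≤ m - 1)
    (h : ∀ f : Fin m → Fin p × Bool, predSq x (netPoint f) ≤ n * τ * ‖netPoint f‖ ^ 2)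
    (v : EuclideanSpace ℝ (Fin p)) :
    predSq x v ≤ n * (τ * (‖v‖ ^ 2 + l / n * l1norm v ^ 2)) := by
  have hn' : (0 : ℝ) < n := by exact_mod_cast hn
  have hm_pos : 0 < (m : ℝ) - 1 := lt_of_lt_of_le (by positivity) hm
  have hm_ne : m ≠ 0 := by rintro rfl; norm_num at hm_pos
  have h_one : 1 ≤ ((m : ℝ) - 1) * (l / n) := by
    rw [← mul_div_assoc, le_div_iff₀ hn', one_mul]
    rwa [div_le_iff₀ hl] at hm
  refine le_of_mul_le_mul_left ((predSq_le_of_netPoint hm_ne h v).trans ?_) hm_pos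
  calc n * τ * ((m - 1) * ‖v‖ ^ 2 + l1norm v ^ 2)
      ≤ n * τ * ((m - 1) * ‖v‖ ^ 2 + (m - 1) * (l / n) * l1norm v ^ 2) := by
        gcongr
        exact le_mul_of_one_le_left (sq_nonneg _) h_one
    _ = (m - 1) * (n * (τ * (‖v‖ ^ 2 + l / n * l1norm v ^ 2))) := by ring

theorem sum_sq_le_of_predSq_le (hτ : 0 ≤ τ) (hn : 0 < n) (hl : l ≤ CT * n)
    (h : ∀ v, predSq x v ≤ n * (τ * (‖v‖ ^ 2 + l / n * l1norm v ^ 2))) (j : Fin p) :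
    ∑ i, x i j ^ 2 ≤ n * (τ * (1 + CT)) := by
  have hn' : (0 : ℝ) < n := by exact_mod_cast hn
  have h_l1 : l1norm (signedBasis (j, true)) = 1 := by
    simp [signedBasis, l1norm, apply_ite abs]
  have h_col := h (signedBasis (j, true))
  rw [predSq_signedBasis, norm_signedBasis, h_l1, one_pow, mul_one] at h_col
  refine h_col.trans ?_
  have : l / n ≤ CT := by rwa [div_le_iff₀ hn']
  gcongr

theorem mul_norm_sq_le_of_netPoint (hc : 0 < c) (hcl : 0 < cl) (hl : 0 < l) {U : ℝ} (hU : 0 ≤ U)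
    {m : ℕ} (hm : cl * n / (4 * l) < m + 1)
    (h : ∀ f : Fin m → Fin p × Bool,
      n * (1 / (2 * c)) * ‖netPoint f‖ ^ 2 ≤ predSq x (netPoint f))
    (h_col : ∀ j, ∑ i, x i j ^ 2 ≤ n * U) (v : EuclideanSpace ℝ (Fin p)) :
    n * ‖v‖ ^ 2 ≤ 2 * c * predSq x v + (24 * c * U + 8) / cl * (l * l1norm v ^ 2) := by
  have h_pred := predSq_nonneg x v
  rw [div_lt_iff₀ (by positivity)] at hm
  rcases lt_or_ge m 2 with hm_lt | hm_ge
  · have hm_le : (m : ℝ) + 1 ≤ 2 := by exact_mod_cast hm_lt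
    have h_n : cl * n ≤ 8 * l := by nlinarith
    calc n * ‖v‖ ^ 2 ≤ n * l1norm v ^ 2 := by gcongr; exact norm_le_l1norm v
      _ = cl * n / cl * l1norm v ^ 2 := by field_simp
      _ ≤ 2 * c * predSq x v + (24 * c * U + 8) * l / cl * l1norm v ^ 2 := by
        refine le_add_of_nonneg_of_le (by positivity) ?_
        have h_const : cl * n ≤ (24 * c * U + 8) * l := by
          nlinarith [mul_nonneg (mul_nonneg hc.le hU) hl.le]
        gcongr
      _ = _ := by ring
  · have hm_two : (2 : ℝ) ≤ m := by exact_mod_cast hm_ge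
    have h_m : cl * n / 12 ≤ (m - 1) * l := by nlinarith
    have h_net := predSq_ge_of_netPoint (by omega) (by positivity) h h_col v
    have h_tail : 2 * c * (n * U) ≤ (m - 1) * ((24 * c * U + 8) / cl * l) := by
      calc 2 * c * (n * U) = 24 * c * U / cl * (cl * n / 12) := by field_simp; ring
        _ ≤ (24 * c * U + 8) / cl * ((m - 1) * l) := by gcongr; linarith
        _ = _ := by ring
    refine le_of_mul_le_mul_left (a := (m : ℝ) - 1) ?_ (by linarith)
    calc (m - 1) * (n * ‖v‖ ^ 2)
        = 2 * c * ((m - 1) * (n * (1 / (2 * c)) * ‖v‖ ^ 2)) := by field_simp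
      _ ≤ 2 * c * ((m - 1) * predSq x v + n * U * l1norm v ^ 2) := by gcongr
      _ ≤ _ := by linarith [mul_le_mul_of_nonneg_right h_tail (sq_nonneg (l1norm v))]

end NetToRegular

section SubGaussianRows

variable {Ω ι E : Type*} [MeasurableSpace Ω] [NormedAddCommGroup E] [InnerProductSpace ℝ E]
  [MeasurableSpace E]

/-- Independent sub-Gaussian random vectors `X i` with variance proxy `V` whose second moments in
all directions are at least `1 / c`. -/
structure SubGaussianRows (μ : Measure Ω) (c : ℝ) (V : ℝ≥0) (X : ι → Ω → E) : Prop where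
  measurable : ∀ i, Measurable (X i)
  indep : iIndepFun X μ
  subGaussian : ∀ i u, HasSubgaussianMGF (fun ω => inner ℝ u (X i ω)) (V * ‖u‖₊ ^ 2) μ
  second_moment_ge : ∀ i u, 1 / c * ‖u‖ ^ 2 ≤ ∫ ω, inner ℝ u (X i ω) ^ 2 ∂μ

variable [OpensMeasurableSpace E] [SecondCountableTopology E] {μ : Measure Ω} {c : ℝ} {V : ℝ≥0}
  {X : ι → Ω → E}

theorem SubGaussianRows.measurable_inner (hX : SubGaussianRows μ c V X) (i : ι) (v : E) :
    Measurable fun ω => inner ℝ v (X i ω) :=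
  (hX.measurable i).const_inner

theorem SubGaussianRows.indep_inner_sq (hX : SubGaussianRows μ c V X) (v : E) :
    iIndepFun (fun i ω => inner ℝ v (X i ω) ^ 2) μ :=
  hX.indep.comp (fun _ y => inner ℝ v y ^ 2) fun _ => by fun_prop

variable [Fintype ι] [IsProbabilityMeasure μ]

theorem SubGaussianRows.measureReal_predSq_lt_le (hX : SubGaussianRows μ c V X) (hc : 0 < c)
    (hV : 0 < V) (v : E) :
    μ.real {ω | predSq (fun i => X i ω) v < Fintype.card ι * (1 / (2 * c)) * ‖v‖ ^ 2}
      ≤ Real.exp (-(1 / (512 * c ^ 2 * V ^ 2)) * Fintype.card ι) := by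
  rcases eq_or_ne v 0 with rfl | hv
  · simp [predSq, Real.exp_nonneg]
  have : 0 < ‖v‖ := norm_pos_iff.2 hv
  have h_fourth : ∀ i, Integrable (fun ω => (inner ℝ v (X i ω) ^ 2) ^ 2) μ
      ∧ ∫ ω, (inner ℝ v (X i ω) ^ 2) ^ 2 ∂μ ≤ 64 * (V * ‖v‖ ^ 2) ^ 2 := fun i => by
    simp only [← pow_mul]
    exact integral_pow_four_le (hX.measurable_inner i v) (hX.subGaussian i v) (by positivity)
      (by push_cast; rfl)
  have h_tail := measureReal_sum_le_le_exp (fun i => (hX.measurable_inner i v).pow_const 2)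
    (hX.indep_inner_sq v) (fun i ω => sq_nonneg _) (a := 1 / c * ‖v‖ ^ 2)
    (M := 64 * (V * ‖v‖ ^ 2) ^ 2) (by positivity) (by positivity)
    (fun i => hX.second_moment_ge i v) (fun i => (h_fourth i).1) fun i => (h_fourth i).2
  refine (measureReal_mono fun ω hω => ?_).trans (h_tail.trans (le_of_eq ?_))
  · simp only [Set.mem_ofPred_eq, predSq, real_inner_comm v] at hω ⊢
    exact hω.le.trans (le_of_eq (by field_simp))
  · congr 2
    field_simp
    norm_num

theorem SubGaussianRows.measureReal_predSq_gt_le (hX : SubGaussianRows μ c V X) (hV : 0 < V)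
    (τ : ℝ) (v : E) :
    μ.real {ω | Fintype.card ι * τ * ‖v‖ ^ 2 < predSq (fun i => X i ω) v}
      ≤ Real.exp (-(τ / (4 * V) - 1) * Fintype.card ι) := by
  rcases eq_or_ne v 0 with rfl | hv
  · simp [predSq, Real.exp_nonneg]
  have : 0 < ‖v‖ := norm_pos_iff.2 hv
  have ht : 4 * (1 / (4 * (V * ‖v‖ ^ 2)) * ((V * ‖v‖₊ ^ 2 : ℝ≥0) : ℝ)) ≤ 1 := by
    push_cast
    exact le_of_eq (by field_simp)
  have h_tail := measureReal_sum_ge_le_exp (fun i => (hX.measurable_inner i v).pow_const 2)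
    (hX.indep_inner_sq v) (t := 1 / (4 * (V * ‖v‖ ^ 2))) (by positivity)
    (fun i => integrable_exp_mul_sq (hX.measurable_inner i v) (hX.subGaussian i v)
      (by positivity) ht)
    (fun i => mgf_sq_le_two (hX.measurable_inner i v) (hX.subGaussian i v) (by positivity) ht)
    (τ * ‖v‖ ^ 2)
  refine (measureReal_mono fun ω hω => ?_).trans (h_tail.trans (le_of_eq ?_))
  · simp only [Set.mem_ofPred_eq, predSq, real_inner_comm v] at hω ⊢
    rw [← mul_assoc]
    exact hω.le
  · congr 3
    field_simp

end SubGaussianRows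

section RegularDesigns

variable {Ω : Type*} [MeasurableSpace Ω] {μ : Measure Ω} {p n : ℕ}

theorem card_netPoint_le (hp : 2 ≤ p) (m : ℕ) :
    (Fintype.card (Fin m → Fin p × Bool) : ℝ) ≤ Real.exp (2 * m * Real.log p) := by
  have hp' : (2 : ℝ) ≤ p := by exact_mod_cast hp
  have h_exp : Real.exp (2 * m * Real.log p) = ((p : ℝ) * p) ^ m := by
    rw [mul_assoc, mul_left_comm, Real.exp_nat_mul, two_mul, Real.exp_add,
      Real.exp_log (by linarith)]
  rw [h_exp]
  simp only [Fintype.card_pi, Fintype.card_prod, Fintype.card_fin, Fintype.card_bool,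
    Finset.prod_const, Finset.card_univ]
  push_cast
  gcongr

theorem measureReal_exists_netPoint_le [IsFiniteMeasure μ] (hp : 2 ≤ p) {m : ℕ} {r : ℝ}
    {P : Ω → EuclideanSpace ℝ (Fin p) → Prop} (h : ∀ v, μ.real {ω | P ω v} ≤ Real.exp r) :
    μ.real {ω | ∃ f : Fin m → Fin p × Bool, P ω (netPoint f)}
      ≤ Real.exp (2 * m * Real.log p + r) := by
  rw [Set.ofPred_exists]
  calc _ ≤ ∑ f : Fin m → Fin p × Bool, μ.real {ω | P ω (netPoint f)} :=
        measureReal_iUnion_fintype_le _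
    _ ≤ ∑ _f : Fin m → Fin p × Bool, Real.exp r := Finset.sum_le_sum fun f _ => h _
    _ ≤ Real.exp (2 * m * Real.log p) * Real.exp r := by
      rw [Finset.sum_const, nsmul_eq_mul, Finset.card_univ]
      gcongr
      exact card_netPoint_le hp m
    _ = Real.exp (2 * m * Real.log p + r) := (Real.exp_add _ _).symm

/-- The constant in the upper restricted eigenvalue bound. -/
noncomputable def designUpperConst (V CT : ℝ) : ℝ := 4 * V * (4 * CT + 4)

/-- The exponential rate at which a fixed quadratic form `‖x v‖²` drops below half its mean. -/
noncomputable def lowerTailRate (c V : ℝ) : ℝ := 1 / (512 * c ^ 2 * V ^ 2)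

/-- The square of the `ℓ₁` constant in the lower restricted eigenvalue bound. -/
noncomputable def designLowerConst (c V CT : ℝ) : ℝ :=
  (24 * c * (designUpperConst V CT * (1 + CT)) + 8) / lowerTailRate c V

/-- The exponential rate at which designs are regular. -/
noncomputable def designRate (c V : ℝ) : ℝ := min (lowerTailRate c V / 2) 1

theorem lowerTailRate_pos {c V : ℝ} (hc : 0 < c) (hV : 0 < V) : 0 < lowerTailRate c V := by
  unfold lowerTailRate; positivity

theorem designUpperConst_pos {V CT : ℝ} (hV : 0 < V) (hCT : 0 ≤ CT) :
    0 < designUpperConst V CT := by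
  unfold designUpperConst; positivity

theorem designRate_pos {c V : ℝ} (hc : 0 < c) (hV : 0 < V) : 0 < designRate c V :=
  lt_min (half_pos (lowerTailRate_pos hc hV)) one_pos

variable [IsProbabilityMeasure μ] {X : Fin n → Ω → EuclideanSpace ℝ (Fin p)} {c CT : ℝ} {V : ℝ≥0}

theorem SubGaussianRows.measureReal_exists_netPoint_gt_le (hX : SubGaussianRows μ c V X)
    (hV : 0 < V) (hp : 2 ≤ p) (hlog : Real.log p ≤ CT * n) {m : ℕ}
    (hm : m * Real.log p ≤ 2 * Real.log p + n) :
    μ.real {ω | ∃ f : Fin m → Fin p × Bool,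
        n * designUpperConst V CT * ‖netPoint f‖ ^ 2 < predSq (fun i => X i ω) (netPoint f)}
      ≤ Real.exp (-designRate c V * n) := by
  have h_tail := hX.measureReal_predSq_gt_le hV (designUpperConst V CT)
  rw [Fintype.card_fin] at h_tail
  refine (measureReal_exists_netPoint_le hp h_tail).trans (Real.exp_le_exp.2 ?_)
  have h_const : designUpperConst V CT / (4 * V) = 4 * CT + 4 := by
    unfold designUpperConst
    field_simp
  have h_rate : designRate c V * n ≤ 1 * n := by gcongr; exact min_le_right _ _
  rw [h_const]
  linarith

theorem SubGaussianRows.measureReal_exists_netPoint_lt_le (hX : SubGaussianRows μ c V X)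
    (hc : 0 < c) (hV : 0 < V) (hp : 2 ≤ p) {m : ℕ}
    (hm : m * Real.log p ≤ lowerTailRate c V * n / 4) :
    μ.real {ω | ∃ f : Fin m → Fin p × Bool,
        predSq (fun i => X i ω) (netPoint f) < n * (1 / (2 * c)) * ‖netPoint f‖ ^ 2}
      ≤ Real.exp (-designRate c V * n) := by
  have h_tail := hX.measureReal_predSq_lt_le hc hV
  rw [Fintype.card_fin, ← lowerTailRate] at h_tail
  refine (measureReal_exists_netPoint_le hp h_tail).trans (Real.exp_le_exp.2 ?_)
  have h_rate : designRate c V * n ≤ lowerTailRate c V / 2 * n := by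
    gcongr
    exact min_le_left _ _
  linarith

theorem SubGaussianRows.measureReal_not_designRegular_le (hX : SubGaussianRows μ c V X)
    (hc : 0 < c) (hV : 0 < V) (hCT : 0 ≤ CT) (hp : 2 ≤ p) (hn : 0 < n)
    (hlog : Real.log p ≤ CT * n) :
    μ.real {ω | ¬ DesignRegular √(2 * c) √(designLowerConst c V CT) (designUpperConst V CT)
      (Real.log p) fun i => X i ω} ≤ 2 * Real.exp (-designRate c V * n) := by
  have hl : 0 < Real.log p := Real.log_pos (by exact_mod_cast hp)
  have hcl := lowerTailRate_pos hc (V := V) (by exact_mod_cast hV)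
  have hτ := (designUpperConst_pos (V := V) (by exact_mod_cast hV) hCT).le
  have hU : 0 ≤ designUpperConst V CT * (1 + CT) := by positivity
  have h_ceil := Nat.ceil_lt_add_one (a := n / Real.log p) (by positivity)
  have h_floor := Nat.floor_le (a := lowerTailRate c V * n / (4 * Real.log p)) (by positivity)
  have h_gt := hX.measureReal_exists_netPoint_gt_le (m := ⌈n / Real.log p⌉₊ + 1) hV hp hlog (by
    rw [← sub_lt_iff_lt_add, lt_div_iff₀ hl] at h_ceil
    push_cast
    linarith)
  have h_lt := hX.measureReal_exists_netPoint_lt_le hc hV hp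
    (m := ⌊lowerTailRate c V * n / (4 * Real.log p)⌋₊) (by
      rw [le_div_iff₀ (by positivity)] at h_floor
      linarith)
  rw [two_mul (Real.exp _)]
  refine (measureReal_mono fun ω hω => ?_).trans
    ((measureReal_union_le _ _).trans (add_le_add h_gt h_lt))
  by_contra h_good
  simp only [Set.mem_union, Set.mem_ofPred_eq, not_or, not_exists, not_lt] at h_good
  have h_upper := predSq_le_of_netPoint_of_div_le hn hl hτ
    (by push_cast; linarith [Nat.le_ceil (n / Real.log p)]) h_good.1
  refine hω ⟨fun v => sqrt_mul_norm_le_of_mul_norm_sq_le (by positivity)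
    (by unfold designLowerConst; positivity) hl.le ?_, h_upper⟩
  exact mul_norm_sq_le_of_netPoint hc hcl hl hU (Nat.lt_floor_add_one _) h_good.2
    (sum_sq_le_of_predSq_le hτ hn hlog h_upper) v

end RegularDesigns

section SecondMoment

variable {Ω : Type*} [MeasurableSpace Ω] {μ : Measure Ω} {p : ℕ}

theorem le_sum_mul_of_spectrum_ge {A : Matrix (Fin p) (Fin p) ℝ} (hA : A.IsHermitian) {r : ℝ}
    (hr : ∀ t ∈ spectrum ℝ A, r ≤ t) (u : EuclideanSpace ℝ (Fin p)) :
    r * ‖u‖ ^ 2 ≤ ∑ j, ∑ l, u j * u l * A j l := by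
  have h_psd : (A - algebraMap ℝ _ r).PosSemidef := by
    refine Matrix.posSemidef_iff_isHermitian_and_spectrum_nonneg.2 ⟨hA.sub ?_, fun t ht => ?_⟩
    · rw [Algebra.algebraMap_eq_smul_one]
      exact Matrix.isHermitian_one.smul (IsSelfAdjoint.all r)
    · rw [← spectrum.sub_singleton_eq] at ht
      obtain ⟨t, ht, _, rfl, rfl⟩ := ht
      exact sub_nonneg.2 (hr t ht)
  have h_form : star u.ofLp ⬝ᵥ (A - algebraMap ℝ _ r).mulVec u.ofLp
      = (∑ j, ∑ l, u j * u l * A j l) - r * ‖u‖ ^ 2 := by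
    rw [Matrix.sub_mulVec, dotProduct_sub, Algebra.algebraMap_eq_smul_one, Matrix.smul_mulVec,
      Matrix.one_mulVec, EuclideanSpace.real_norm_sq_eq]
    simp only [dotProduct, Matrix.mulVec, Finset.mul_sum, Pi.star_apply, star_trivial,
      Pi.smul_apply, smul_eq_mul]
    congr 1
    · exact Finset.sum_congr rfl fun j _ => Finset.sum_congr rfl fun l _ => by ring
    · exact Finset.sum_congr rfl fun j _ => by ring
  linarith [h_psd.dotProduct_mulVec_nonneg u.ofLp]

theorem le_integral_inner_sq [IsProbabilityMeasure μ] {Y : Ω → EuclideanSpace ℝ (Fin p)}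
    {A : Matrix (Fin p) (Fin p) ℝ} {r : ℝ} (h_mem : ∀ j, MemLp (fun ω => Y ω j) 2 μ)
    (h_mean : ∀ j, ∫ ω, Y ω j ∂μ = 0)
    (h_cov : ∀ j l, cov[fun ω => Y ω j, fun ω => Y ω l; μ] = A j l)
    (hr : ∀ t ∈ spectrum ℝ A, r ≤ t) (u : EuclideanSpace ℝ (Fin p)) :
    r * ‖u‖ ^ 2 ≤ ∫ ω, inner ℝ u (Y ω) ^ 2 ∂μ := by
  have hA : A.IsHermitian := by
    ext j l
    rw [Matrix.conjTranspose_apply, star_trivial, ← h_cov, ← h_cov, covariance_comm]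
  have h_int (j l) : Integrable (fun ω => Y ω j * Y ω l) μ := (h_mem j).integrable_mul (h_mem l)
  refine (le_sum_mul_of_spectrum_ge hA hr u).trans_eq ?_
  have h_sq (ω) : inner ℝ u (Y ω) ^ 2 = ∑ j, ∑ l, u j * u l * (Y ω j * Y ω l) := by
    rw [PiLp.inner_apply, sq, Finset.sum_mul_sum]
    refine Finset.sum_congr rfl fun j _ => Finset.sum_congr rfl fun l _ => ?_
    simp only [RCLike.inner_apply, conj_trivial]
    ring
  simp_rw [h_sq]
  rw [integral_finsetSum _ fun j _ => integrable_finsetSum _ fun l _ => (h_int j l).const_mul _]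
  refine Finset.sum_congr rfl fun j _ => ?_
  rw [integral_finsetSum _ fun l _ => (h_int j l).const_mul _]
  refine Finset.sum_congr rfl fun l _ => ?_
  rw [integral_const_mul, ← h_cov, covariance_eq_sub (h_mem j) (h_mem l), h_mean, h_mean]
  simp

theorem hasSubgaussianMGF_mono {Y : Ω → ℝ} {v w : ℝ≥0} (h : HasSubgaussianMGF Y v μ)
    (hvw : v ≤ w) : HasSubgaussianMGF Y w μ where
  integrable_exp_mul := h.integrable_exp_mul
  mgf_le t := (h.mgf_le t).trans (by gcongr)

theorem SubGaussianDesign.subGaussianRows [IsProbabilityMeasure μ] {K nT nS : ℕ} {c : ℝ}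
    {κ V : ℝ≥0}
    {X : (k : Fin (K + 1)) → Fin (sampleSize nT nS k) → Ω → EuclideanSpace ℝ (Fin p)}
    {Cov : Fin (K + 1) → Matrix (Fin p) (Fin p) ℝ} (hX : SubGaussianDesign μ c κ X Cov)
    (hκ : κ ≤ V) (k : Fin (K + 1)) : SubGaussianRows μ c V (X k) where
  measurable := hX.measurable k
  indep := hX.indep k
  subGaussian i u := hasSubgaussianMGF_mono (hX.subGaussian k i u) (by gcongr)
  second_moment_ge i := by
    refine le_integral_inner_sq (fun j => ?_) (hX.mean_zero k i) (hX.covariance_eq k i)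
      fun t ht => (hX.spectrum_subset k ht).1
    simpa [EuclideanSpace.inner_single_left]
      using (hX.subGaussian k i (EuclideanSpace.single j 1)).memLp 2

end SecondMoment

section Conditioning

variable {Ω A B : Type*} [MeasurableSpace Ω] [MeasurableSpace A] [MeasurableSpace B]
  {μ : Measure Ω} [IsProbabilityMeasure μ]

theorem measureReal_le_of_indepFun {Y : Ω → A} {Z : Ω → B} (hY : Measurable Y) (hZ : Measurable Z)
    (h_indep : IndepFun Y Z μ) {G : Set A} {S : Set (A × B)} (hG : MeasurableSet G)
    (hS : MeasurableSet S) {δ : ℝ} (hδ : 0 ≤ δ) (h : ∀ y ∈ G, μ.real {ω | (y, Z ω) ∈ S} ≤ δ) :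
    μ.real {ω | Y ω ∈ G ∧ (Y ω, Z ω) ∈ S} ≤ δ := by
  have hT : MeasurableSet (G ×ˢ Set.univ ∩ S) := (hG.prod MeasurableSet.univ).inter hS
  have := Measure.isProbabilityMeasure_map (μ := μ) hY.aemeasurable
  have := Measure.isProbabilityMeasure_map (μ := μ) hZ.aemeasurable
  have h_eq : {ω | Y ω ∈ G ∧ (Y ω, Z ω) ∈ S}
      = (fun ω => (Y ω, Z ω)) ⁻¹' (G ×ˢ Set.univ ∩ S) := by
    ext; simp
  rw [measureReal_def, h_eq, ← Measure.map_apply (hY.prodMk hZ) hT,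
    (indepFun_iff_map_prod_eq_prod_map_map hY.aemeasurable hZ.aemeasurable).1 h_indep,
    Measure.prod_apply hT]
  refine ENNReal.toReal_le_of_le_ofReal hδ ?_
  calc ∫⁻ y, (μ.map Z) (Prod.mk y ⁻¹' (G ×ˢ Set.univ ∩ S)) ∂(μ.map Y)
      ≤ ∫⁻ _, ENNReal.ofReal δ ∂(μ.map Y) := by
        refine lintegral_mono fun y => ?_
        by_cases hy : y ∈ G
        · have h_section : Prod.mk y ⁻¹' (G ×ˢ Set.univ ∩ S) = {z | (y, z) ∈ S} := by
            ext; simp [hy]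
          have h_meas : MeasurableSet {z | (y, z) ∈ S} := measurable_prodMk_left hS
          rw [h_section, Measure.map_apply hZ h_meas]
          exact (ENNReal.le_ofReal_iff_toReal_le (measure_ne_top _ _) hδ).2 (h y hy)
        · have h_section : Prod.mk y ⁻¹' (G ×ˢ Set.univ ∩ S) = ∅ := by ext; simp [hy]
          simp [h_section]
    _ = ENNReal.ofReal δ := by simp

end Conditioning

theorem measurableSet_setOf_exists_mem_of_isClosed {A B : Type*} [TopologicalSpace A] [T2Space A]
    [MeasurableSpace A] [OpensMeasurableSpace A] [TopologicalSpace B] [SigmaCompactSpace (A × B)]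
    {S : Set (A × B)} (hS : IsClosed S) : MeasurableSet {a | ∃ b, (a, b) ∈ S} := by
  obtain ⟨f, hf, hfS⟩ := (isSigmaCompact_univ.of_isClosed_subset hS (Set.subset_univ _)).image
    continuous_fst
  have h_eq : {a | ∃ b, (a, b) ∈ S} = ⋃ i, f i := by
    rw [hfS]; ext a; simp
  rw [h_eq]
  exact MeasurableSet.iUnion fun i => (hf i).isClosed.measurableSet

section GramMatrix

variable {ι E : Type*} [Fintype ι] [NormedAddCommGroup E] [InnerProductSpace ℝ E]

theorem gramMul_neg (x : ι → E) (d : E) : gramMul x (-d) = -gramMul x d := by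
  simp only [gramMul, ← score_neg, Pi.neg_def, inner_neg_right]

theorem gramMul_zero (x : ι → E) : gramMul x 0 = 0 := by
  simp [gramMul, score]

theorem gramMul_sub (x : ι → E) (d v : E) : gramMul x (d - v) = gramMul x d - gramMul x v := by
  rw [sub_eq_add_neg, gramMul_add, gramMul_neg, sub_eq_add_neg]

theorem inner_gramMul_self (x : ι → E) (d : E) : inner ℝ (gramMul x d) d = predSq x d := by
  simp only [inner_gramMul, predSq, sq]

theorem predSq_add (x : ι → E) (d v : E) :
    predSq x (d + v) = predSq x d + 2 * inner ℝ (gramMul x d) v + predSq x v := by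
  rw [inner_gramMul, predSq, predSq, predSq, Finset.mul_sum, ← Finset.sum_add_distrib,
    ← Finset.sum_add_distrib]
  exact Finset.sum_congr rfl fun i _ => by rw [inner_add_right]; ring

end GramMatrix

section LassoFit

variable {ι : Type*} [Fintype ι] {p : ℕ} {x : ι → EuclideanSpace ℝ (Fin p)} {m L : ℝ}
  {z z' d d' : EuclideanSpace ℝ (Fin p)}

/-- The lasso objective `½‖x d‖² - ⟪z, d⟫ + L ‖d‖₁`, in terms of the score `z`. -/
noncomputable def lassoObjective (x : ι → EuclideanSpace ℝ (Fin p)) (L : ℝ)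
    (z d : EuclideanSpace ℝ (Fin p)) : ℝ :=
  predSq x d / 2 - inner ℝ z d + L * l1norm d

theorem exists_forall_lassoObjective_le (hm : 0 < m) (hL : 0 ≤ L)
    (hx : ∀ v, m * ‖v‖ ^ 2 ≤ predSq x v) (z : EuclideanSpace ℝ (Fin p)) :
    ∃ d, ∀ d', lassoObjective x L z d ≤ lassoObjective x L z d' := by
  have h_cont : Continuous (lassoObjective x L z) := by
    have := continuous_l1norm (p := p)
    unfold lassoObjective predSq
    fun_prop
  have h_zero : lassoObjective x L z 0 = 0 := by simp [lassoObjective, predSq]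
  refine h_cont.exists_forall_le' 0 ((tendsto_norm_cocompact_atTop.eventually_ge_atTop
    (2 * ‖z‖ / m)).mono fun d hd => ?_)
  rw [h_zero, lassoObjective]
  have h_inner := real_inner_le_norm z d
  have h_norm := mul_le_mul_of_nonneg_right ((div_le_iff₀ hm).1 hd) (norm_nonneg d)
  have h_pen := mul_nonneg hL (l1norm_nonneg d)
  linarith [hx d, sq ‖d‖]

theorem lassoOptimal_of_forall_lassoObjective_le (hL : 0 ≤ L)
    (hd : ∀ d', lassoObjective x L z d ≤ lassoObjective x L z d') : LassoOptimal x L z d := by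
  intro v
  have h_step : ∀ t ∈ Set.Ioc (0 : ℝ) 1, inner ℝ (z - gramMul x d) v
      ≤ L * (l1norm (d + v) - l1norm d) + t * (predSq x v / 2) := by
    rintro t ⟨ht, ht_one⟩
    have h_convex : l1norm (d + t • v) ≤ (1 - t) * l1norm d + t * l1norm (d + v) := by
      rw [show d + t • v = (1 - t) • d + t • (d + v) by module]
      refine (l1norm_add_le _ _).trans_eq ?_
      rw [l1norm_smul, l1norm_smul, abs_of_nonneg (by linarith), abs_of_pos ht]
    have h_pen := mul_le_mul_of_nonneg_left h_convex hL
    have h_min := hd (d + t • v)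
    rw [lassoObjective, lassoObjective, predSq_add, predSq_smul, inner_smul_right,
      inner_add_right, inner_smul_right] at h_min
    refine le_of_mul_le_mul_left ?_ ht
    rw [inner_sub_left]
    linarith
  have h_lim : Filter.Tendsto
      (fun t : ℝ => L * (l1norm (d + v) - l1norm d) + t * (predSq x v / 2))
      (nhdsWithin 0 (Set.Ioi 0)) (nhds (L * (l1norm (d + v) - l1norm d))) := by
    refine (Continuous.tendsto' (by fun_prop) _ _ ?_).mono_left nhdsWithin_le_nhds
    ring
  exact ge_of_tendsto h_lim (Filter.eventually_of_mem (Ioc_mem_nhdsGT one_pos) h_step)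

theorem LassoOptimal.neg (h : LassoOptimal x L z d) : LassoOptimal x L (-z) (-d) := by
  intro v
  have h_neg := h (-v)
  rw [gramMul_neg, ← neg_sub', inner_neg_left, l1norm_neg,
    show -d + v = -(d + -v) by abel, l1norm_neg]
  rwa [inner_neg_right] at h_neg

theorem lassoOptimal_zero (x : ι → EuclideanSpace ℝ (Fin p)) (hL : 0 ≤ L) :
    LassoOptimal x L 0 0 := by
  intro v
  simpa [gramMul_zero] using mul_nonneg hL (l1norm_nonneg v)

theorem LassoOptimal.predSq_sub_le (h : LassoOptimal x L z d) (h' : LassoOptimal x L z' d') :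
    predSq x (d - d') ≤ inner ℝ (z - z') (d - d') := by
  have h_left := h (d' - d)
  have h_right := h' (d - d')
  rw [add_sub_cancel] at h_left h_right
  rw [← neg_sub d d', inner_neg_right] at h_left
  rw [← inner_gramMul_self, gramMul_sub]
  simp only [inner_sub_left] at *
  linarith

theorem LassoOptimal.norm_sub_le (hx : ∀ v, m * ‖v‖ ^ 2 ≤ predSq x v)
    (h : LassoOptimal x L z d) (h' : LassoOptimal x L z' d') : m * ‖d - d'‖ ≤ ‖z - z'‖ := by
  rcases (norm_nonneg (d - d')).eq_or_lt with h_zero | h_pos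
  · simp [← h_zero]
  refine le_of_mul_le_mul_right ?_ h_pos
  calc m * ‖d - d'‖ * ‖d - d'‖ = m * ‖d - d'‖ ^ 2 := by ring
    _ ≤ predSq x (d - d') := hx _
    _ ≤ inner ℝ (z - z') (d - d') := h.predSq_sub_le h'
    _ ≤ ‖z - z'‖ * ‖d - d'‖ := real_inner_le_norm _ _

theorem LassoOptimal.eq (hm : 0 < m) (hx : ∀ v, m * ‖v‖ ^ 2 ≤ predSq x v)
    (h : LassoOptimal x L z d) (h' : LassoOptimal x L z d') : d = d' := by
  have h_norm := h.norm_sub_le hx h'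
  rw [sub_self, norm_zero] at h_norm
  exact sub_eq_zero.1 (norm_le_zero_iff.1 (nonpos_of_mul_nonpos_right h_norm hm))

theorem LassoOptimal.norm_le (hL : 0 ≤ L) (hx : ∀ v, m * ‖v‖ ^ 2 ≤ predSq x v)
    (h : LassoOptimal x L z d) : m * ‖d‖ ≤ ‖z‖ := by
  simpa using h.norm_sub_le hx (lassoOptimal_zero x hL)

theorem LassoOptimal.predSq_le (hm : 0 ≤ m) (hL : 0 ≤ L) (hx : ∀ v, m * ‖v‖ ^ 2 ≤ predSq x v)
    (h : LassoOptimal x L z d) : m * predSq x d ≤ ‖z‖ ^ 2 := by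
  have h_pred := h.predSq_sub_le (lassoOptimal_zero x hL)
  rw [sub_zero, sub_zero] at h_pred
  calc m * predSq x d ≤ m * (‖z‖ * ‖d‖) := by
        gcongr
        exact h_pred.trans (real_inner_le_norm z d)
    _ = ‖z‖ * (m * ‖d‖) := by ring
    _ ≤ ‖z‖ * ‖z‖ := by gcongr; exact h.norm_le hL hx
    _ = ‖z‖ ^ 2 := (sq _).symm

theorem exists_continuous_lassoOptimal (hm : 0 < m) (hL : 0 ≤ L)
    (hx : ∀ v, m * ‖v‖ ^ 2 ≤ predSq x v) :
    ∃ D : EuclideanSpace ℝ (Fin p) → EuclideanSpace ℝ (Fin p),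
      Continuous D ∧ ∀ z, LassoOptimal x L z (D z) := by
  choose D hD using exists_forall_lassoObjective_le hm hL hx
  have h_opt (z) : LassoOptimal x L z (D z) := lassoOptimal_of_forall_lassoObjective_le hL (hD z)
  refine ⟨D, LipschitzWith.continuous (K := Real.toNNReal (1 / m))
    (LipschitzWith.of_dist_le_mul fun z z' => ?_), h_opt⟩
  rw [Real.coe_toNNReal _ (by positivity), dist_eq_norm, dist_eq_norm, one_div_mul_eq_div,
    le_div_iff₀ hm, mul_comm]
  exact (h_opt z).norm_sub_le hx (h_opt z')

end LassoFit

section GaussianNoise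

variable {Ω : Type*} [MeasurableSpace Ω] {μ : Measure Ω} {σ : ℝ}

/-- Gaussian noise of level `σ`: a family of independent centred Gaussian variables with variances
at most `σ²`. -/
structure IsGaussianNoise {ι : Type*} (μ : Measure Ω) (σ : ℝ) (ξ : ι → Ω → ℝ) : Prop where
  measurable : ∀ i, Measurable (ξ i)
  gaussian : ∀ i, ∃ v : ℝ≥0, (v : ℝ) ≤ σ ^ 2 ∧ μ.map (ξ i) = gaussianReal 0 v
  indep : iIndepFun ξ μ

theorem GaussianErrors.isGaussianNoise {p K nT nS : ℕ} {X : (k : Fin (K + 1)) →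
      Fin (sampleSize nT nS k) → Ω → EuclideanSpace ℝ (Fin p)}
    {ε : (k : Fin (K + 1)) → Fin (sampleSize nT nS k) → Ω → ℝ} (h : GaussianErrors μ σ X ε) :
    IsGaussianNoise μ σ fun ki : (k : Fin (K + 1)) × Fin (sampleSize nT nS k) => ε ki.1 ki.2 :=
  ⟨fun ki => h.measurable ki.1 ki.2, fun ki => h.gaussian ki.1 ki.2, h.indep⟩

theorem IsGaussianNoise.precomp {ι ι' : Type*} {ξ : ι → Ω → ℝ} (h : IsGaussianNoise μ σ ξ)
    {g : ι' → ι} (hg : Function.Injective g) : IsGaussianNoise μ σ fun i => ξ (g i) :=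
  ⟨fun i => h.measurable (g i), fun i => h.gaussian (g i), h.indep.precomp hg⟩

theorem IsGaussianNoise.block {κ : Type*} {ι : κ → Type*} {ξ : (k : κ) → ι k → Ω → ℝ}
    (h : IsGaussianNoise μ σ fun ki : (k : κ) × ι k => ξ ki.1 ki.2) (k : κ) :
    IsGaussianNoise μ σ (ξ k) :=
  h.precomp (g := fun i => (⟨k, i⟩ : (k : κ) × ι k)) sigma_mk_injective

theorem hasSubgaussianMGF_of_map_eq_gaussianReal {Z : Ω → ℝ} {v : ℝ≥0} (hZ : Measurable Z)
    (h : μ.map Z = gaussianReal 0 v) : HasSubgaussianMGF Z v μ where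
  integrable_exp_mul t := by
    have h_int := integrable_exp_mul_gaussianReal (μ := 0) (v := v) t
    rw [← h] at h_int
    exact (integrable_map_measure (by fun_prop) hZ.aemeasurable).1 h_int
  mgf_le t := by simp [mgf_gaussianReal h]

theorem IsGaussianNoise.hasSubgaussianMGF_sum_mul [IsProbabilityMeasure μ] {ι : Type*} [Fintype ι]
    {ξ : ι → Ω → ℝ} (h : IsGaussianNoise μ σ ξ) (a : ι → ℝ) {V : ℝ≥0}
    (hV : σ ^ 2 * ∑ i, a i ^ 2 ≤ V) : HasSubgaussianMGF (fun ω => ∑ i, ξ i ω * a i) V μ := by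
  choose v hv h_map using h.gaussian
  have h_term (i) (_ : i ∈ Finset.univ) :
      HasSubgaussianMGF (fun ω => ξ i ω * a i) (⟨a i ^ 2, sq_nonneg _⟩ * v i) μ := by
    simpa only [mul_comm] using
      (hasSubgaussianMGF_of_map_eq_gaussianReal (h.measurable i) (h_map i)).const_mul (a i)
  refine hasSubgaussianMGF_mono (HasSubgaussianMGF.sum_of_iIndepFun
    (h.indep.comp (fun i y => y * a i) fun i => by fun_prop) h_term) ?_
  rw [← NNReal.coe_le_coe, NNReal.coe_sum]
  refine le_trans ?_ hV
  rw [Finset.mul_sum]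
  refine Finset.sum_le_sum fun i _ => ?_
  change a i ^ 2 * v i ≤ σ ^ 2 * a i ^ 2
  rw [mul_comm]
  exact mul_le_mul_of_nonneg_right (hv i) (sq_nonneg _)

theorem IsGaussianNoise.integral_odd_eq_zero [IsProbabilityMeasure μ] {ι : Type*} [Finite ι]
    {ξ : ι → Ω → ℝ} (h : IsGaussianNoise μ σ ξ) {f : (ι → ℝ) → ℝ} (hf : Measurable f)
    (h_odd : ∀ e, f (-e) = -f e) : ∫ ω, f (fun i => ξ i ω) ∂μ = 0 := by
  have := Fintype.ofFinite ι
  choose v _ h_map using h.gaussian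
  have h_law : μ.map (fun ω i => ξ i ω) = Measure.pi fun i => gaussianReal 0 (v i) := by
    rw [(iIndepFun_iff_map_fun_eq_pi_map fun i => (h.measurable i).aemeasurable).1 h.indep]
    simp_rw [h_map]
  have h_symm (i) : (gaussianReal 0 (v i)).IsNegInvariant :=
    ⟨by rw [Measure.neg]; exact gaussianReal_map_neg.trans (by rw [neg_zero])⟩
  have h_neg := integral_neg_eq_self f (Measure.pi fun i => gaussianReal 0 (v i))
  simp_rw [h_odd, integral_neg, ← h_law] at h_neg
  rw [integral_map (measurable_pi_lambda _ h.measurable).aemeasurable hf.aestronglyMeasurable]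
    at h_neg
  linarith

theorem indepFun_blocks {κ : Type*} [Finite κ] {ι : κ → Type*} [∀ k, Finite (ι k)]
    {ξ : (k : κ) → ι k → Ω → ℝ} (hm : ∀ k i, Measurable (ξ k i))
    (h_indep : iIndepFun (fun ki : (k : κ) × ι k => ξ ki.1 ki.2) μ) {k k' : κ} (hk : k ≠ k') :
    IndepFun (fun ω i => ξ k i ω) (fun ω i => ξ k' i ω) μ := by
  classical
  have := Fintype.ofFinite κ
  have h_fin (k : κ) : Fintype (ι k) := Fintype.ofFinite _
  have h := h_indep.indepFun_finset (Finset.univ.filter fun ki : (k : κ) × ι k => ki.1 = k)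
    (Finset.univ.filter fun ki : (k : κ) × ι k => ki.1 = k')
    (Finset.disjoint_filter.2 fun ki _ h1 h2 => hk (h1.symm.trans h2)) (fun ki => hm ki.1 ki.2)
  exact h.comp (φ := fun f i => f ⟨⟨k, i⟩, by simp⟩) (ψ := fun f i => f ⟨⟨k', i⟩, by simp⟩)
    (measurable_pi_lambda _ fun i => measurable_pi_apply _)
    (measurable_pi_lambda _ fun i => measurable_pi_apply _)

end GaussianNoise

section Deviations

variable {Ω : Type*} [MeasurableSpace Ω] {μ : Measure Ω}

theorem measureReal_lt_abs_le [IsFiniteMeasure μ] {Z : Ω → ℝ} {V : ℝ≥0}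
    (h : HasSubgaussianMGF Z V μ) {θ : ℝ} (hθ : 0 ≤ θ) (τ : ℝ) :
    μ.real {ω | τ < |Z ω|} ≤ 2 * Real.exp (-(θ * τ) + θ ^ 2 * V / 2) := by
  have h_one_sided {Y : Ω → ℝ} (hY : HasSubgaussianMGF Y V μ) :
      μ.real {ω | τ ≤ Y ω} ≤ Real.exp (-(θ * τ) + θ ^ 2 * V / 2) := by
    refine (measure_ge_le_exp_mul_mgf τ hθ (hY.integrable_exp_mul θ)).trans ?_
    rw [Real.exp_add, neg_mul, mul_comm (θ ^ 2)]
    gcongr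
    exact hY.mgf_le θ
  rw [two_mul (Real.exp _)]
  refine (measureReal_mono fun ω hω => ?_).trans
    ((measureReal_union_le _ _).trans (add_le_add (h_one_sided h) (h_one_sided h.neg)))
  exact (lt_abs.1 hω).imp le_of_lt fun h => show τ ≤ -Z ω from h.le

theorem measureReal_exists_le {κ : Type*} [Fintype κ] {P : κ → Ω → Prop} {δ : ℝ}
    (h : ∀ k, μ.real {ω | P k ω} ≤ δ) : μ.real {ω | ∃ k, P k ω} ≤ Fintype.card κ * δ := by
  rw [Set.ofPred_exists]
  refine (measureReal_iUnion_fintype_le _).trans ?_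
  simpa using Finset.sum_le_sum fun k (_ : k ∈ Finset.univ) => h k

theorem measureReal_le_sum_le {κ : Type*} [Fintype κ] {W : κ → Ω → ℝ} {q T : ℝ}
    (hW : ∀ k ω, 0 ≤ W k ω) (h_int : ∀ k, Integrable (W k) μ) (hq : ∀ k, ∫ ω, W k ω ∂μ ≤ q)
    (hT : 0 < T) : μ.real {ω | T ≤ ∑ k, W k ω} ≤ Fintype.card κ * q / T := by
  rw [le_div_iff₀ hT, mul_comm]
  refine (mul_meas_ge_le_integral_of_nonneg
    (Filter.Eventually.of_forall fun ω => Finset.sum_nonneg fun k _ => hW k ω)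
    (integrable_finsetSum _ fun k _ => h_int k) T).trans ?_
  rw [integral_finsetSum _ fun k _ => h_int k]
  simpa using Finset.sum_le_sum fun k (_ : k ∈ Finset.univ) => hq k

theorem measureReal_lt_abs_sum_le [IsProbabilityMeasure μ] {κ : Type*} [Fintype κ]
    {W : κ → Ω → ℝ} {q T : ℝ}
    (hW : ∀ k, MemLp (W k) 2 μ) (h_mean : ∀ k, ∫ ω, W k ω ∂μ = 0)
    (h_indep : Pairwise fun k k' => IndepFun (W k) (W k') μ) (hq : ∀ k, ∫ ω, W k ω ^ 2 ∂μ ≤ q)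
    (hT : 0 < T) : μ.real {ω | T < |∑ k, W k ω|} ≤ Fintype.card κ * q / T ^ 2 := by
  have hS : MemLp (∑ k, W k) 2 μ := memLp_finsetSum' _ fun k _ => hW k
  have hS_mean : ∫ ω, (∑ k, W k) ω ∂μ = 0 := by
    simp only [Finset.sum_apply]
    rw [integral_finsetSum _ fun k _ => (hW k).integrable one_le_two]
    simp [h_mean]
  have h_var : variance (∑ k, W k) μ ≤ Fintype.card κ * q := by
    rw [IndepFun.variance_sum (fun k _ => hW k) fun k _ k' _ h => h_indep h]
    have h_le (k) (_ : k ∈ Finset.univ) : variance (W k) μ ≤ q :=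
      (variance_of_integral_eq_zero (hW k).aestronglyMeasurable.aemeasurable (h_mean k)).trans_le
        (hq k)
    simpa using Finset.sum_le_sum h_le
  have h_cheb := meas_ge_le_variance_div_sq hS hT
  rw [hS_mean] at h_cheb
  refine (measureReal_mono (s₂ := {ω | T ≤ |(∑ k, W k) ω - 0|}) fun ω hω => ?_).trans
    ((ENNReal.toReal_le_of_le_ofReal (div_nonneg (variance_nonneg _ _) (sq_nonneg T)) h_cheb).trans
      (by gcongr))
  simpa using le_of_lt hω

theorem IsGaussianNoise.measureReal_lt_abs_sum_odd_le [IsProbabilityMeasure μ] {κ : Type*}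
    [Fintype κ] {ι : κ → Type*} [∀ k, Finite (ι k)] {σ : ℝ} {ξ : (k : κ) → ι k → Ω → ℝ}
    (hξ : IsGaussianNoise μ σ fun ki : (k : κ) × ι k => ξ ki.1 ki.2) {f : (k : κ) → (ι k → ℝ) → ℝ}
    (hf : ∀ k, Measurable (f k)) (h_odd : ∀ k e, f k (-e) = -f k e) {W : κ → Ω → ℝ}
    (hW : ∀ k, Integrable (W k) μ) (hfW : ∀ k ω, f k (fun i => ξ k i ω) ^ 2 ≤ W k ω) {q T : ℝ}
    (hq : ∀ k, ∫ ω, W k ω ∂μ ≤ q) (hT : 0 < T) :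
    μ.real {ω | T < |∑ k, f k fun i => ξ k i ω|} ≤ Fintype.card κ * q / T ^ 2 := by
  have hfm (k) : Measurable fun ω => f k fun i => ξ k i ω :=
    (hf k).comp (measurable_pi_lambda _ (hξ.block k).measurable)
  have h_sq (k) : Integrable (fun ω => f k (fun i => ξ k i ω) ^ 2) μ :=
    (hW k).mono' ((hfm k).pow_const 2).aestronglyMeasurable
      (Filter.Eventually.of_forall fun ω => by
        rw [Real.norm_of_nonneg (sq_nonneg _)]; exact hfW k ω)
  exact measureReal_lt_abs_sum_le
    (fun k => (memLp_two_iff_integrable_sq (hfm k).aestronglyMeasurable).2 (h_sq k))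
    (fun k => (hξ.block k).integral_odd_eq_zero (hf k) (h_odd k))
    (fun k k' hk => (indepFun_blocks (fun k => (hξ.block k).measurable) hξ.indep hk).comp
      (hf k) (hf k'))
    (fun k => (integral_mono (h_sq k) (hW k) (hfW k)).trans (hq k)) hT

end Deviations

section TailSecondMoment

variable {Ω : Type*} [MeasurableSpace Ω] {μ : Measure Ω} {Z : Ω → ℝ} {V : ℝ≥0} {θ : ℝ}

theorem ite_lt_abs_sq_le (hθ : 0 < θ) (τ z : ℝ) :
    (if τ < |z| then z ^ 2 else 0)
      ≤ 2 / θ ^ 2 * Real.exp (-(θ * τ)) * (Real.exp (2 * θ * z) + Real.exp (-(2 * θ) * z)) := by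
  split_ifs with h
  · have h_sq : (θ * |z|) ^ 2 / 2 ≤ Real.exp (θ * |z|) := by
      have h_nonneg : 0 ≤ θ * |z| := by positivity
      linarith [Real.quadratic_le_exp_of_nonneg h_nonneg]
    have h_tail : Real.exp (θ * |z|) ≤ Real.exp (-(θ * τ)) * Real.exp (2 * θ * |z|) := by
      rw [← Real.exp_add, Real.exp_le_exp]
      nlinarith
    have h_abs : Real.exp (2 * θ * |z|) ≤ Real.exp (2 * θ * z) + Real.exp (-(2 * θ) * z) := by
      rcases abs_choice z with h | h <;> rw [h]
      · exact le_add_of_nonneg_right (Real.exp_nonneg _)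
      · rw [mul_neg, ← neg_mul]
        exact le_add_of_nonneg_left (Real.exp_nonneg _)
    calc z ^ 2 = 2 / θ ^ 2 * ((θ * |z|) ^ 2 / 2) := by rw [mul_pow, sq_abs]; field_simp
      _ ≤ 2 / θ ^ 2 * (Real.exp (-(θ * τ)) *
          (Real.exp (2 * θ * z) + Real.exp (-(2 * θ) * z))) := by
        gcongr
        exact h_sq.trans (h_tail.trans (by gcongr))
      _ = _ := by ring
  · positivity

theorem integrable_exp_add_exp_neg (h : HasSubgaussianMGF Z V μ) (a t : ℝ) :
    Integrable (fun ω => a * (Real.exp (t * Z ω) + Real.exp (-t * Z ω))) μ :=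
  ((h.integrable_exp_mul t).add (h.integrable_exp_mul (-t))).const_mul a

theorem integrable_ite_lt_abs_sq (hZ : Measurable Z) (h : HasSubgaussianMGF Z V μ) (τ : ℝ) :
    Integrable (fun ω => if τ < |Z ω| then Z ω ^ 2 else 0) μ := by
  have hm : Measurable fun ω => if τ < |Z ω| then Z ω ^ 2 else 0 :=
    Measurable.ite (measurableSet_lt measurable_const (by fun_prop)) (by fun_prop) measurable_const
  refine (integrable_exp_add_exp_neg h (2 / 1 ^ 2 * Real.exp (-(1 * τ))) (2 * 1)).mono'
    hm.aestronglyMeasurable (Filter.Eventually.of_forall fun ω => ?_)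
  rw [Real.norm_of_nonneg (by positivity)]
  exact ite_lt_abs_sq_le one_pos τ (Z ω)

theorem integral_ite_lt_abs_sq_le (hZ : Measurable Z) (h : HasSubgaussianMGF Z V μ) (hθ : 0 < θ)
    (τ : ℝ) : ∫ ω, (if τ < |Z ω| then Z ω ^ 2 else 0) ∂μ
      ≤ 4 / θ ^ 2 * Real.exp (-(θ * τ) + 2 * θ ^ 2 * V) := by
  have h_mgf {t : ℝ} (ht : t ^ 2 = (2 * θ) ^ 2) :
      ∫ ω, Real.exp (t * Z ω) ∂μ ≤ Real.exp (2 * θ ^ 2 * V) := by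
    refine (h.mgf_le t).trans_eq ?_
    rw [ht]
    ring_nf
  refine (integral_mono (integrable_ite_lt_abs_sq hZ h τ) (integrable_exp_add_exp_neg h _ _)
    fun ω => ite_lt_abs_sq_le hθ τ (Z ω)).trans ?_
  rw [integral_const_mul, integral_add (h.integrable_exp_mul _) (h.integrable_exp_mul _)]
  calc _ ≤ 2 / θ ^ 2 * Real.exp (-(θ * τ)) *
        (Real.exp (2 * θ ^ 2 * V) + Real.exp (2 * θ ^ 2 * V)) := by
        gcongr
        exacts [h_mgf rfl, h_mgf (neg_sq _)]
    _ = _ := by rw [Real.exp_add]; ring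

end TailSecondMoment

section Excess

variable {p : ℕ} {τ : ℝ} {z : EuclideanSpace ℝ (Fin p)}

/-- Some entry of `z` exceeds the threshold `τ` in absolute value. -/
def Exceeds (τ : ℝ) (z : EuclideanSpace ℝ (Fin p)) : Prop := ∃ j, τ < |z j|

/-- An upper bound for `‖z‖²` on the event that `z` exceeds the threshold `τ`, whose expectation
decouples into the entries of `z`. -/
noncomputable def excess (τ : ℝ) (z : EuclideanSpace ℝ (Fin p)) : ℝ :=
  p * ∑ j, if τ < |z j| then z j ^ 2 else 0

theorem excess_nonneg (τ : ℝ) (z : EuclideanSpace ℝ (Fin p)) : 0 ≤ excess τ z :=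
  mul_nonneg (Nat.cast_nonneg _) (Finset.sum_nonneg fun j _ => by positivity)

theorem Exceeds.norm_sq_le (h : Exceeds τ z) : ‖z‖ ^ 2 ≤ excess τ z := by
  obtain ⟨j₀, h₀⟩ := h
  obtain ⟨j, -, hj⟩ := Finset.exists_max_image Finset.univ (fun j => |z j|) ⟨j₀, Finset.mem_univ _⟩
  have hτ : τ < |z j| := h₀.trans_le (hj j₀ (Finset.mem_univ _))
  rw [EuclideanSpace.real_norm_sq_eq]
  calc ∑ i, z i ^ 2 ≤ ∑ _i : Fin p, z j ^ 2 :=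
        Finset.sum_le_sum fun i hi => sq_le_sq.2 (hj i hi)
    _ = p * (if τ < |z j| then z j ^ 2 else 0) := by rw [if_pos hτ]; simp
    _ ≤ excess τ z := by
      unfold excess
      gcongr
      exact Finset.single_le_sum (f := fun i => if τ < |z i| then z i ^ 2 else 0)
        (fun i _ => by positivity) (Finset.mem_univ j)

theorem Exceeds.sq_le (h : Exceeds τ z) (hτ : 0 ≤ τ) : τ ^ 2 ≤ excess τ z := by
  refine le_trans ?_ h.norm_sq_le
  obtain ⟨j, hj⟩ := h
  exact pow_le_pow_left₀ hτ (hj.le.trans (PiLp.norm_apply_le z j)) 2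

theorem measurableSet_exceeds (τ : ℝ) :
    MeasurableSet {z : EuclideanSpace ℝ (Fin p) | Exceeds τ z} := by
  simp only [Exceeds, Set.ofPred_exists]
  exact MeasurableSet.iUnion fun j => measurableSet_lt measurable_const (by fun_prop)

theorem exceeds_neg : Exceeds τ (-z) ↔ Exceeds τ z := by simp [Exceeds]

variable {Ω : Type*} [MeasurableSpace Ω] {μ : Measure Ω} {Z : Ω → EuclideanSpace ℝ (Fin p)}

theorem integrable_excess {V : Fin p → ℝ≥0} (hZ : Measurable Z)
    (h : ∀ j, HasSubgaussianMGF (fun ω => Z ω j) (V j) μ) (τ : ℝ) :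
    Integrable (fun ω => excess τ (Z ω)) μ :=
  (integrable_finsetSum _ fun j _ => integrable_ite_lt_abs_sq (by fun_prop) (h j) τ).const_mul _

theorem integral_excess_le {V : ℝ≥0} (hZ : Measurable Z)
    (h : ∀ j, HasSubgaussianMGF (fun ω => Z ω j) V μ) {θ : ℝ} (hθ : 0 < θ) (τ : ℝ) :
    ∫ ω, excess τ (Z ω) ∂μ ≤ p ^ 2 * (4 / θ ^ 2) * Real.exp (-(θ * τ) + 2 * θ ^ 2 * V) := by
  unfold excess
  rw [integral_const_mul,
    integral_finsetSum _ fun j _ => integrable_ite_lt_abs_sq (by fun_prop) (h j) τ]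
  calc _ ≤ (p : ℝ) * ∑ _j : Fin p, 4 / θ ^ 2 * Real.exp (-(θ * τ) + 2 * θ ^ 2 * V) := by
        gcongr with j
        exact integral_ite_lt_abs_sq_le (by fun_prop) (h j) hθ τ
    _ = _ := by
      rw [Finset.sum_const, Finset.card_univ, Fintype.card_fin, nsmul_eq_mul]
      ring

end Excess

section TruncatedLassoFit

variable {p : ℕ} {ι : Type*} [Fintype ι] {x : ι → EuclideanSpace ℝ (Fin p)} {m L τ : ℝ}
  {D : EuclideanSpace ℝ (Fin p) → EuclideanSpace ℝ (Fin p)}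

/-- `D` maps a score `z` to a lasso fit with this score if `z` exceeds the threshold `τ`, and to `0`
otherwise. -/
structure IsTruncatedLassoFit (x : ι → EuclideanSpace ℝ (Fin p)) (L τ : ℝ)
    (D : EuclideanSpace ℝ (Fin p) → EuclideanSpace ℝ (Fin p)) : Prop where
  measurable : Measurable D
  lassoOptimal : ∀ z, Exceeds τ z → LassoOptimal x L z (D z)
  eq_zero : ∀ z, ¬ Exceeds τ z → D z = 0

theorem exists_isTruncatedLassoFit (hm : 0 < m) (hL : 0 ≤ L)
    (hx : ∀ v, m * ‖v‖ ^ 2 ≤ predSq x v) (τ : ℝ) : ∃ D, IsTruncatedLassoFit x L τ D := by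
  classical
  obtain ⟨D, hD, h_opt⟩ := exists_continuous_lassoOptimal hm hL hx
  refine ⟨fun z => if Exceeds τ z then D z else 0,
    Measurable.ite (measurableSet_exceeds τ) hD.measurable measurable_const,
    fun z hz => ?_, fun z hz => if_neg hz⟩
  rw [if_pos hz]
  exact h_opt z

theorem IsTruncatedLassoFit.map_neg (hD : IsTruncatedLassoFit x L τ D) (hm : 0 < m)
    (hx : ∀ v, m * ‖v‖ ^ 2 ≤ predSq x v) (z : EuclideanSpace ℝ (Fin p)) : D (-z) = -D z := by
  by_cases hz : Exceeds τ z
  · exact (hD.lassoOptimal _ (exceeds_neg.2 hz)).eq hm hx (hD.lassoOptimal z hz).neg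
  · rw [hD.eq_zero z hz, hD.eq_zero _ (mt exceeds_neg.1 hz), neg_zero]

theorem IsTruncatedLassoFit.sq_mul_norm_sq_le (hD : IsTruncatedLassoFit x L τ D) (hm : 0 ≤ m)
    (hL : 0 ≤ L) (hx : ∀ v, m * ‖v‖ ^ 2 ≤ predSq x v) (z : EuclideanSpace ℝ (Fin p)) :
    m ^ 2 * ‖D z‖ ^ 2 ≤ excess τ z := by
  by_cases hz : Exceeds τ z
  · rw [← mul_pow]
    exact (pow_le_pow_left₀ (by positivity) ((hD.lassoOptimal z hz).norm_le hL hx) 2).trans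
      hz.norm_sq_le
  · simpa [hD.eq_zero z hz] using excess_nonneg τ z

theorem IsTruncatedLassoFit.mul_predSq_le (hD : IsTruncatedLassoFit x L τ D) (hm : 0 ≤ m)
    (hL : 0 ≤ L) (hx : ∀ v, m * ‖v‖ ^ 2 ≤ predSq x v) (z : EuclideanSpace ℝ (Fin p)) :
    m * predSq x (D z) ≤ excess τ z := by
  by_cases hz : Exceeds τ z
  · exact ((hD.lassoOptimal z hz).predSq_le hm hL hx).trans hz.norm_sq_le
  · simpa [hD.eq_zero z hz, predSq] using excess_nonneg τ z

end TruncatedLassoFit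

section NoiseRegular

variable {p K nT nS : ℕ}

@[fun_prop]
theorem continuous_score_comp {A ι E : Type*} [TopologicalSpace A] [Fintype ι]
    [NormedAddCommGroup E] [InnerProductSpace ℝ E] {f : A → ι → E} {g : A → ι → ℝ}
    (hf : Continuous f) (hg : Continuous g) : Continuous fun a => score (f a) (g a) := by
  unfold score
  fun_prop

@[fun_prop]
theorem continuous_gramMul_comp {A ι E : Type*} [TopologicalSpace A] [Fintype ι]
    [NormedAddCommGroup E] [InnerProductSpace ℝ E] {f : A → ι → E} {g : A → E}
    (hf : Continuous f) (hg : Continuous g) : Continuous fun a => gramMul (f a) (g a) := by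
  unfold gramMul
  fun_prop

theorem isClosed_setOf_isNoiseFit (c₀ c₁ : ℝ) (B : Finset (Fin K)) :
    IsClosed {r : (Designs p K nT nS × Responses K nT nS) ×
      (Fin (K + 1) → EuclideanSpace ℝ (Fin p)) | IsNoiseFit c₀ c₁ r.1.1 r.1.2 B r.2} := by
  refine isClosed_of_closure_subset fun r hr => ?_
  have h_mem {T : Set ((Designs p K nT nS × Responses K nT nS) ×
      (Fin (K + 1) → EuclideanSpace ℝ (Fin p)))} (hT : IsClosed T)
      (h : ∀ q, IsNoiseFit c₀ c₁ q.1.1 q.1.2 B q.2 → q ∈ T) : r ∈ T := by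
    refine closure_minimal ?_ hT hr
    exact h
  have h_le {f : (Designs p K nT nS × Responses K nT nS) ×
      (Fin (K + 1) → EuclideanSpace ℝ (Fin p)) → ℝ} {a : ℝ} (hf : Continuous f)
      (h : ∀ q, IsNoiseFit c₀ c₁ q.1.1 q.1.2 B q.2 → f q ≤ a) : f r ≤ a :=
    h_mem (isClosed_le hf continuous_const) h
  have h_zero (k) (h : ∀ q : (Designs p K nT nS × Responses K nT nS) ×
      (Fin (K + 1) → EuclideanSpace ℝ (Fin p)), IsNoiseFit c₀ c₁ q.1.1 q.1.2 B q.2 → q.2 k = 0) :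
      r.2 k = 0 :=
    h_mem (T := {q | q.2 k = 0}) (isClosed_eq (by fun_prop) continuous_const) h
  have h_l1 := continuous_l1norm (p := p)
  obtain ⟨q, hq⟩ := closure_nonempty_iff.1 ⟨r, hr⟩
  refine ⟨hq.card_le, h_zero 0 fun q hq => hq.target_eq_zero,
    fun k hk => h_zero k.succ fun q hq => hq.eq_zero k hk,
    fun k hk j => h_le (by fun_prop) fun q hq => hq.abs_score_le k hk j,
    fun k hk v => sub_nonpos.1 (h_le (by fun_prop) fun q hq =>
      sub_nonpos.2 (hq.lassoOptimal k hk v)),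
    fun j => h_le ?_ fun q hq => hq.abs_sum_score_le j,
    h_le (f := fun q => l1norm (weightedAverage nT nS q.2) ^ 2) ?_
      fun q hq => hq.sq_l1norm_average_le,
    fun j => h_le (by fun_prop) fun q hq => hq.abs_target_score_le j⟩
  · fun_prop
  · unfold weightedAverage
    fun_prop

/-- The errors are regular if they have a noise fit. In contrast to the noise fit, the regularity
of the errors is an event. -/
def NoiseRegular (c₀ c₁ : ℝ) (x : Designs p K nT nS) (e : Responses K nT nS) : Prop :=
  ∃ B d, IsNoiseFit c₀ c₁ x e B d

theorem measurableSet_setOf_noiseRegular (c₀ c₁ : ℝ) :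
    MeasurableSet {q : Designs p K nT nS × Responses K nT nS | NoiseRegular c₀ c₁ q.1 q.2} := by
  simp only [NoiseRegular, Set.ofPred_exists]
  refine MeasurableSet.iUnion fun B => ?_
  rw [← Set.ofPred_exists]
  exact measurableSet_setOf_exists_mem_of_isClosed (isClosed_setOf_isNoiseFit c₀ c₁ B)

end NoiseRegular

section LogDimension

variable {p : ℕ}

theorem exp_neg_mul_log (hp : 0 < p) (r : ℕ) : Real.exp (-(r * Real.log p)) = 1 / (p : ℝ) ^ r := by
  rw [Real.exp_neg, Real.exp_nat_mul, Real.exp_log (by exact_mod_cast hp), one_div]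

theorem half_le_log (hp : 2 ≤ p) : 1 / 2 ≤ Real.log p := by
  have h_mono : Real.log 2 ≤ Real.log p := Real.log_le_log two_pos (by exact_mod_cast hp)
  linarith [Real.log_two_gt_d9]

theorem sqrt_div_mul_sqrt_mul {l n : ℝ} (hl : 0 ≤ l) (hn : 0 < n) : √(l / n) * √(n * l) = l := by
  rw [← Real.sqrt_mul (by positivity), show l / n * (n * l) = l ^ 2 by field_simp, Real.sqrt_sq hl]

end LogDimension

section ScoreDeviations

variable {p : ℕ} {Ω ι : Type*} [MeasurableSpace Ω] {μ : Measure Ω} [Fintype ι]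
  {x : ι → EuclideanSpace ℝ (Fin p)} {ξ : ι → Ω → ℝ} {σ n U : ℝ} {v : ℝ≥0}

theorem score_apply (e : ι → ℝ) (j : Fin p) : score x e j = ∑ i, e i * x i j := by
  simp [score]

theorem IsGaussianNoise.measurable_score (hξ : IsGaussianNoise μ σ ξ) :
    Measurable fun ω => score x fun i => ξ i ω := by
  unfold score
  exact Finset.measurable_fun_sum _ fun i _ => (hξ.measurable i).smul_const _

variable [IsProbabilityMeasure μ]

theorem IsGaussianNoise.hasSubgaussianMGF_score (hξ : IsGaussianNoise μ σ ξ) (hn : 0 ≤ n)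
    {j : Fin p} (h_col : ∑ i, x i j ^ 2 ≤ n * U) (hv : σ ^ 2 * U ≤ v) :
    HasSubgaussianMGF (fun ω => score x (fun i => ξ i ω) j) (v * n.toNNReal) μ := by
  simp only [score_apply]
  refine hξ.hasSubgaussianMGF_sum_mul _ ?_
  rw [NNReal.coe_mul, Real.coe_toNNReal n hn]
  calc σ ^ 2 * ∑ i, x i j ^ 2 ≤ σ ^ 2 * (n * U) := by gcongr
    _ = σ ^ 2 * U * n := by ring
    _ ≤ v * n := by gcongr

theorem IsGaussianNoise.measureReal_exists_lt_abs_score_le (hξ : IsGaussianNoise μ σ ξ)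
    (hp : 2 ≤ p) (hn : 0 < n) (h_col : ∀ j, ∑ i, x i j ^ 2 ≤ n * U) (hv : σ ^ 2 * U ≤ v) {r : ℕ}
    {a : ℝ} (ha : r + 1 + v / 2 ≤ a) :
    μ.real {ω | ∃ j, a * √(n * Real.log p) < |score x (fun i => ξ i ω) j|} ≤ 2 / (p : ℝ) ^ r := by
  have hl : 0 ≤ Real.log p := by linarith [half_le_log hp]
  have h_entry (j : Fin p) : μ.real {ω | a * √(n * Real.log p) < |score x (fun i => ξ i ω) j|}
      ≤ 2 * (1 / (p : ℝ) ^ (r + 1)) := by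
    refine (measureReal_lt_abs_le (hξ.hasSubgaussianMGF_score hn.le (h_col j) hv)
      (Real.sqrt_nonneg (Real.log p / n)) _).trans ?_
    rw [← exp_neg_mul_log (by omega), mul_left_comm, sqrt_div_mul_sqrt_mul hl hn,
      Real.sq_sqrt (by positivity), NNReal.coe_mul, Real.coe_toNNReal n hn.le]
    gcongr
    have h_drift : Real.log p / n * (v * n) / 2 = v / 2 * Real.log p := by field_simp
    rw [h_drift]
    push_cast
    nlinarith
  refine (measureReal_exists_le h_entry).trans_eq ?_
  rw [Fintype.card_fin]
  field_simp
  ring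

theorem IsGaussianNoise.integrable_excess_score (hξ : IsGaussianNoise μ σ ξ) (τ : ℝ) :
    Integrable (fun ω => excess τ (score x fun i => ξ i ω)) μ := by
  refine integrable_excess hξ.measurable_score (V := fun j => (σ ^ 2 * ∑ i, x i j ^ 2).toNNReal)
    (fun j => ?_) τ
  simp only [score_apply]
  exact hξ.hasSubgaussianMGF_sum_mul _ (Real.le_coe_toNNReal _)

theorem IsGaussianNoise.integral_excess_score_le (hξ : IsGaussianNoise μ σ ξ) (hp : 2 ≤ p)
    (hn : 0 < n) (h_col : ∀ j, ∑ i, x i j ^ 2 ≤ n * U) (hv : σ ^ 2 * U ≤ v) {a : ℝ}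
    (ha : 6 + 2 * v ≤ a) :
    ∫ ω, excess (a * √(n * Real.log p)) (score x fun i => ξ i ω) ∂μ
      ≤ 4 * n / (Real.log p * p ^ 4) := by
  have hl : 0 < Real.log p := by linarith [half_le_log hp]
  refine (integral_excess_le hξ.measurable_score
    (fun j => hξ.hasSubgaussianMGF_score hn.le (h_col j) hv)
    (Real.sqrt_pos.2 (div_pos hl hn)) (a * √(n * Real.log p))).trans ?_
  rw [mul_left_comm, sqrt_div_mul_sqrt_mul hl.le hn, Real.sq_sqrt (by positivity), NNReal.coe_mul,
    Real.coe_toNNReal n hn.le]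
  calc (p : ℝ) ^ 2 * (4 / (Real.log p / n)) *
        Real.exp (-(a * Real.log p) + 2 * (Real.log p / n) * (v * n))
      ≤ (p : ℝ) ^ 2 * (4 / (Real.log p / n)) * Real.exp (-((6 : ℕ) * Real.log p)) := by
        gcongr
        have h_drift : 2 * (Real.log p / n) * (v * n) = 2 * v * Real.log p := by field_simp
        rw [h_drift]
        push_cast
        nlinarith
    _ = 4 * n / (Real.log p * p ^ 4) := by
      rw [exp_neg_mul_log (by omega)]
      field_simp

end ScoreDeviations

section FitDeviations

variable {p : ℕ} {Ω κ : Type*} [MeasurableSpace Ω] {μ : Measure Ω} [IsProbabilityMeasure μ]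
  [Fintype κ] {ι : κ → Type*} [∀ k, Fintype (ι k)] {x : (k : κ) → ι k → EuclideanSpace ℝ (Fin p)}
  {ξ : (k : κ) → ι k → Ω → ℝ} {σ n N U γ L a c₀ : ℝ} {v : ℝ≥0}
  {D : κ → EuclideanSpace ℝ (Fin p) → EuclideanSpace ℝ (Fin p)}

theorem IsGaussianNoise.measureReal_le_sum_excess_le [Nonempty κ]
    (hξ : IsGaussianNoise μ σ fun ki : (k : κ) × ι k => ξ ki.1 ki.2) (hp : 2 ≤ p) (hn : 0 < n)
    (h_col : ∀ k j, ∑ i, x k i j ^ 2 ≤ n * U) (hv : σ ^ 2 * U ≤ v) (ha : 6 + 2 * v ≤ a) :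
    μ.real {ω | (a * √(n * Real.log p)) ^ 2 * Fintype.card κ / (10 * p) ≤
      ∑ k, excess (a * √(n * Real.log p)) (score (x k) fun i => ξ k i ω)} ≤ 10 / p := by
  have hl := half_le_log hp
  have ha₀ : 6 ≤ a := by linarith [v.coe_nonneg]
  refine (measureReal_le_sum_le (fun k ω => excess_nonneg _ _)
    (fun k => (hξ.block k).integrable_excess_score _)
    (fun k => (hξ.block k).integral_excess_score_le hp hn (h_col k) hv ha) (by positivity)).trans ?_
  rw [mul_pow, Real.sq_sqrt (by positivity)]
  have hp₁ : (1 : ℝ) ≤ p := by exact_mod_cast (by omega : 1 ≤ p)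
  have h_one_le : 1 ≤ a ^ 2 * Real.log p ^ 2 * (p : ℝ) ^ 2 / 4 := by
    have h_prod : 2 ≤ a * Real.log p * p := by
      nlinarith [mul_le_mul ha₀ hl (by norm_num) (by linarith)]
    nlinarith
  calc _ = 10 / p * (1 / (a ^ 2 * Real.log p ^ 2 * (p : ℝ) ^ 2 / 4)) := by field_simp
    _ ≤ 10 / p * 1 := by
      gcongr
      exact div_le_one_of_le₀ h_one_le (by positivity)
    _ = 10 / p := mul_one _

theorem IsGaussianNoise.measureReal_exists_lt_abs_sum_le
    (hξ : IsGaussianNoise μ σ fun ki : (k : κ) × ι k => ξ ki.1 ki.2) (hp : 2 ≤ p) (hn : 0 < n)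
    (h_col : ∀ k j, ∑ i, x k i j ^ 2 ≤ n * U) (hv : σ ^ 2 * U ≤ v) (ha : 6 + 2 * v ≤ a)
    {f : κ → EuclideanSpace ℝ (Fin p) → EuclideanSpace ℝ (Fin p)} (hf : ∀ k, Measurable (f k))
    (h_odd : ∀ k z, f k (-z) = -f k z) {A T : ℝ} (hA : 0 ≤ A)
    (hfA : ∀ k z j, f k z j ^ 2 ≤ A * excess (a * √(n * Real.log p)) z) (hT : 0 < T) :
    μ.real {ω | ∃ j, T < |(∑ k, f k (score (x k) fun i => ξ k i ω)) j|}
      ≤ 8 * (Fintype.card κ * n * A) / (p ^ 3 * T ^ 2) := by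
  have hl := half_le_log hp
  have h_entry (j : Fin p) : μ.real {ω | T < |(∑ k, f k (score (x k) fun i => ξ k i ω)) j|}
      ≤ Fintype.card κ * (A * (4 * n / (Real.log p * p ^ 4))) / T ^ 2 := by
    simp only [WithLp.ofLp_sum, Finset.sum_apply]
    refine hξ.measureReal_lt_abs_sum_odd_le (f := fun k e => f k (score (x k) e) j) (fun k => ?_)
      (fun k e => by rw [score_neg, h_odd]; rfl)
      (fun k => ((hξ.block k).integrable_excess_score _).const_mul A) (fun k ω => hfA k _ j)
      (fun k => ?_) hT
    · have h_score : Measurable (score (x k)) := (by fun_prop : Continuous (score (x k))).measurable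
      fun_prop
    · rw [integral_const_mul]
      gcongr
      exact (hξ.block k).integral_excess_score_le hp hn (h_col k) hv ha
  refine (measureReal_exists_le h_entry).trans ?_
  rw [Fintype.card_fin]
  calc _ = 8 * (Fintype.card κ * n * A) / (p ^ 3 * T ^ 2) * (1 / 2 / Real.log p) := by
        field_simp; ring
    _ ≤ 8 * (Fintype.card κ * n * A) / (p ^ 3 * T ^ 2) * 1 := by
      gcongr
      exact div_le_one_of_le₀ hl (by linarith)
    _ = _ := mul_one _

theorem IsGaussianNoise.measureReal_exists_lt_abs_sum_lassoFit_le
    (hξ : IsGaussianNoise μ σ fun ki : (k : κ) × ι k => ξ ki.1 ki.2) (hp : 2 ≤ p) (hn : 0 < n)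
    (hnN : Fintype.card κ * n ≤ N) (hN : 0 < N)
    (h_col : ∀ k j, ∑ i, x k i j ^ 2 ≤ n * U) (hv : σ ^ 2 * U ≤ v) (ha : 6 + 2 * v ≤ a)
    (hγ : 0 < γ) (hL : 0 ≤ L) (hx : ∀ k v, γ * n * ‖v‖ ^ 2 ≤ predSq (x k) v)
    (hD : ∀ k, IsTruncatedLassoFit (x k) L (a * √(n * Real.log p)) (D k)) :
    μ.real {ω | ∃ j, √(Real.log p * N) / (n * p) < |(∑ k, D k (score (x k) fun i => ξ k i ω)) j|}
      ≤ 16 / γ ^ 2 / p := by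
  have hl := half_le_log hp
  refine (hξ.measureReal_exists_lt_abs_sum_le hp hn h_col hv ha (A := 1 / (γ * n) ^ 2)
    (fun k => (hD k).measurable) (fun k => (hD k).map_neg (by positivity) (hx k)) (by positivity)
    (fun k z j => ?_) (by positivity)).trans ?_
  · rw [one_div, inv_mul_eq_div, le_div_iff₀ (by positivity), mul_comm]
    refine le_trans ?_ ((hD k).sq_mul_norm_sq_le (by positivity) hL (hx k) z)
    refine mul_le_mul_of_nonneg_left ?_ (sq_nonneg _)
    exact sq_le_sq.2 ((PiLp.norm_apply_le (D k z) j).trans (le_abs_self _))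
  · rw [div_pow (√(Real.log p * N)), Real.sq_sqrt (by positivity)]
    calc _ = 16 / γ ^ 2 / p * (Fintype.card κ * n / N) * (1 / 2 / Real.log p) := by
          field_simp; ring
      _ ≤ 16 / γ ^ 2 / p * 1 * 1 := by
        gcongr
        · exact div_le_one_of_le₀ hnN hN.le
        · exact div_le_one_of_le₀ hl (by linarith)
      _ = _ := by ring

theorem gramMul_apply_sq_le {ι : Type*} [Fintype ι] (x : ι → EuclideanSpace ℝ (Fin p))
    (d : EuclideanSpace ℝ (Fin p)) (j : Fin p) :
    gramMul x d j ^ 2 ≤ predSq x d * ∑ i, x i j ^ 2 := by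
  rw [gramMul, score_apply]
  exact Finset.sum_mul_sq_le_sq_mul_sq _ _ _

theorem IsGaussianNoise.measureReal_exists_lt_abs_sum_gramMul_le
    (hξ : IsGaussianNoise μ σ fun ki : (k : κ) × ι k => ξ ki.1 ki.2) (hp : 2 ≤ p) (hn : 0 < n)
    (hnN : Fintype.card κ * n ≤ N) (hN : 0 < N) (hU : 0 ≤ U)
    (h_col : ∀ k j, ∑ i, x k i j ^ 2 ≤ n * U) (hv : σ ^ 2 * U ≤ v) (ha : 6 + 2 * v ≤ a)
    (hγ : 0 < γ) (hL : 0 ≤ L) (hx : ∀ k v, γ * n * ‖v‖ ^ 2 ≤ predSq (x k) v)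
    (hD : ∀ k, IsTruncatedLassoFit (x k) L (a * √(n * Real.log p)) (D k)) (hc₀ : 1 ≤ c₀) :
    μ.real {ω | ∃ j, c₀ / 4 * √(N * Real.log p) <
        |(∑ k, gramMul (x k) (D k (score (x k) fun i => ξ k i ω))) j|} ≤ 256 * U / γ / p := by
  have hl := half_le_log hp
  have hp₁ : (1 : ℝ) ≤ p := by exact_mod_cast (by omega : 1 ≤ p)
  refine (hξ.measureReal_exists_lt_abs_sum_le hp hn h_col hv ha (A := U / γ)
    (f := fun k z => gramMul (x k) (D k z)) (fun k => ?_)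
    (fun k z => by rw [(hD k).map_neg (by positivity) (hx k), gramMul_neg]) (by positivity)
    (fun k z j => ?_) (by positivity)).trans ?_
  · exact (by fun_prop : Continuous (gramMul (x k))).measurable.comp (hD k).measurable
  · calc gramMul (x k) (D k z) j ^ 2 ≤ predSq (x k) (D k z) * (n * U) :=
          (gramMul_apply_sq_le _ _ _).trans
            (mul_le_mul_of_nonneg_left (h_col k j) (predSq_nonneg _ _))
      _ = U / γ * (γ * n * predSq (x k) (D k z)) := by field_simp
      _ ≤ _ := by
        gcongr
        exact (hD k).mul_predSq_le (by positivity) hL (hx k) z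
  · rw [mul_pow, Real.sq_sqrt (by positivity)]
    calc _ = 256 * U / γ / p * (Fintype.card κ * n / N) * (1 / 2 / Real.log p)
          * (1 / (c₀ ^ 2 * p ^ 2)) := by
          field_simp; ring
      _ ≤ 256 * U / γ / p * 1 * 1 * 1 := by
        gcongr
        · exact div_le_one_of_le₀ hnN hN.le
        · exact div_le_one_of_le₀ hl (by linarith)
        · exact div_le_one_of_le₀ (one_le_mul_of_one_le_of_one_le (one_le_pow₀ hc₀)
            (one_le_pow₀ hp₁)) (by positivity)
      _ = _ := by ring

end FitDeviations

section ConstructNoiseFit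

variable {p K nT nS : ℕ} {c₀ c₁ : ℝ} {x : Designs p K nT nS} {e : Responses K nT nS}
  {D : Fin K → EuclideanSpace ℝ (Fin p) → EuclideanSpace ℝ (Fin p)}

theorem isNoiseFit_empty
    (h_target : ∀ j, |score (x 0) (e 0) j| ≤ c₁ / 2 * √(nT * Real.log p))
    (h_total : ∀ j, |(∑ k, score (x k) (e k)) j| ≤ c₀ / 2 * √(totalSize K nT nS * Real.log p))
    (h_source : ∀ (k : Fin K) (j),
      |score (x k.succ) (e k.succ) j| ≤ 4 * c₀ * √(nS * Real.log p)) :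
    IsNoiseFit c₀ c₁ x e ∅ 0 where
  card_le := by simp
  target_eq_zero := rfl
  eq_zero _ _ := rfl
  abs_score_le k _ := h_source k
  lassoOptimal := by simp
  abs_sum_score_le j := by
    simp only [Pi.zero_apply, gramMul_zero, sub_zero]
    linarith [h_total j]
  sq_l1norm_average_le := by
    have hN : 0 ≤ totalSize K nT nS := by unfold totalSize; positivity
    simp only [weightedAverage, Pi.zero_apply, Finset.sum_const_zero, smul_zero, add_zero,
      l1norm_zero]
    rw [zero_pow two_ne_zero]
    exact div_nonneg (Real.log_natCast_nonneg p) hN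
  abs_target_score_le j := by linarith [h_target j]

open Classical in
theorem card_filter_exceeds_mul_sq_le {κ : Type*} [Fintype κ] {τ : ℝ} (hτ : 0 ≤ τ)
    (z : κ → EuclideanSpace ℝ (Fin p)) :
    (Finset.univ.filter fun k => Exceeds τ (z k)).card * τ ^ 2 ≤ ∑ k, excess τ (z k) := by
  rw [← nsmul_eq_mul]
  refine (Finset.card_nsmul_le_sum _ (fun k => excess τ (z k)) _ fun k hk =>
    (Finset.mem_filter.1 hk).2.sq_le hτ).trans ?_
  exact Finset.sum_le_sum_of_subset_of_nonneg (Finset.subset_univ _) fun k _ _ => excess_nonneg _ _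

theorem l1norm_le_mul_of_abs_le {v : EuclideanSpace ℝ (Fin p)} {t : ℝ} (h : ∀ j, |v j| ≤ t) :
    l1norm v ≤ p * t := by
  simpa [l1norm] using Finset.sum_le_sum fun j (_ : j ∈ Finset.univ) => h j

theorem sq_l1norm_average_cons_zero_le (hp : 0 < p) (hnS : 0 < nS) {N : ℝ} (hN : 0 < N)
    {l : ℝ} (hl : 0 ≤ l) {d : Fin K → EuclideanSpace ℝ (Fin p)} (hN_eq : totalSize K nT nS = N)
    (h : ∀ j, |(∑ k, d k) j| ≤ √(l * N) / (nS * p)) :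
    l1norm (weightedAverage nT nS (Fin.cons 0 d : Fin (K + 1) → EuclideanSpace ℝ (Fin p))) ^ 2
      ≤ l / N := by
  have h_nonneg : 0 ≤ (nS / N : ℝ) := by positivity
  simp only [weightedAverage, Fin.cons_succ, Fin.cons_zero, smul_zero, add_zero, hN_eq, l1norm_smul,
    abs_of_nonneg h_nonneg]
  calc (nS / N * l1norm (∑ k, d k)) ^ 2 ≤ (nS / N * (p * (√(l * N) / (nS * p)))) ^ 2 := by
        gcongr
        · exact mul_nonneg h_nonneg (l1norm_nonneg _)
        · exact l1norm_le_mul_of_abs_le h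
    _ = √(l * N) ^ 2 / N ^ 2 := by field_simp
    _ = l / N := by
      rw [Real.sq_sqrt (by positivity)]
      field_simp

theorem exists_isNoiseFit_of_truncatedLassoFit (hp : 2 ≤ p) (hnT : 0 < nT) (hnS : 0 < nS)
    (hc₀ : 0 < c₀)
    (hD : ∀ k, IsTruncatedLassoFit (x k.succ) (8 * c₀ * √(nS * Real.log p))
      (4 * c₀ * √(nS * Real.log p)) (D k))
    (h_target : ∀ j, |score (x 0) (e 0) j| ≤ c₁ / 2 * √(nT * Real.log p))
    (h_total : ∀ j, |(∑ k, score (x k) (e k)) j| ≤ c₀ / 4 * √(totalSize K nT nS * Real.log p))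
    (h_excess : ∑ k : Fin K, excess (4 * c₀ * √(nS * Real.log p)) (score (x k.succ) (e k.succ))
      ≤ (4 * c₀ * √(nS * Real.log p)) ^ 2 * K / (10 * p))
    (h_fit : ∀ j, |(∑ k, D k (score (x k.succ) (e k.succ))) j|
      ≤ √(Real.log p * totalSize K nT nS) / (nS * p))
    (h_gram : ∀ j, |(∑ k, gramMul (x k.succ) (D k (score (x k.succ) (e k.succ)))) j|
      ≤ c₀ / 4 * √(totalSize K nT nS * Real.log p)) :
    ∃ B d, IsNoiseFit c₀ c₁ x e B d := by
  classical
  set τ := 4 * c₀ * √(nS * Real.log p)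
  have hl : 0 < Real.log p := Real.log_pos (by exact_mod_cast hp)
  have hτ : 0 < τ := by positivity
  refine ⟨Finset.univ.filter fun k => Exceeds τ (score (x k.succ) (e k.succ)),
    Fin.cons 0 fun k => D k (score (x k.succ) (e k.succ)), ?_, rfl, fun k hk => ?_,
    fun k hk j => ?_, fun k hk => ?_, fun j => ?_,
    sq_l1norm_average_cons_zero_le (by omega) hnS (totalSize_pos hnT) hl.le rfl h_fit,
    fun j => by linarith [h_target j]⟩
  · have h_card := (card_filter_exceeds_mul_sq_le hτ.le fun k : Fin K =>
      score (x k.succ) (e k.succ)).trans h_excess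
    rw [le_div_iff₀ (by positivity)] at h_card
    have h_mul_le : (10 * (p * (Finset.univ.filter fun k : Fin K =>
        Exceeds τ (score (x k.succ) (e k.succ))).card : ℕ) : ℝ) ≤ K := by
      refine le_of_mul_le_mul_left ?_ (pow_pos hτ 2)
      push_cast
      linarith
    exact_mod_cast h_mul_le
  · exact (hD k).eq_zero _ (by simpa using hk)
  · exact not_lt.1 fun h_lt => hk (Finset.mem_filter.2 ⟨Finset.mem_univ k, j, h_lt⟩)
  · exact (hD k).lassoOptimal _ (Finset.mem_filter.1 hk).2
  · have h_split : ∑ k, gramMul (x k) ((Fin.cons 0 fun k => D k (score (x k.succ) (e k.succ)) :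
          Fin (K + 1) → EuclideanSpace ℝ (Fin p)) k)
        = ∑ k : Fin K, gramMul (x k.succ) (D k (score (x k.succ) (e k.succ))) := by
      rw [Fin.sum_univ_succ, Fin.cons_zero, gramMul_zero, zero_add]
      rfl
    rw [Finset.sum_sub_distrib, h_split, PiLp.sub_apply]
    exact (abs_sub _ _).trans (by linarith [h_total j, h_gram j])

end ConstructNoiseFit

section NoiseRegularProbability

variable {p K nT nS s : ℕ} {Ω : Type*} [MeasurableSpace Ω] {μ : Measure Ω}

theorem measureReal_or_le {P Q : Ω → Prop} {a b : ℝ} (hP : μ.real {ω | P ω} ≤ a)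
    (hQ : μ.real {ω | Q ω} ≤ b) : μ.real {ω | P ω ∨ Q ω} ≤ a + b :=
  (measureReal_union_le _ _).trans (add_le_add hP hQ)

variable {x : Designs p K nT nS} {ε : (k : Fin (K + 1)) → Fin (sampleSize nT nS k) → Ω → ℝ}
  {σ U C₁ C₂ C₄ CT η γ a c₀ c₁ : ℝ} {v : ℝ≥0} {h : Fin K → ℝ}

theorem IsGaussianNoise.sources
    (hε : IsGaussianNoise μ σ
      fun ki : (k : Fin (K + 1)) × Fin (sampleSize nT nS k) => ε ki.1 ki.2) :
    IsGaussianNoise μ σ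
      fun ki : (k : Fin K) × Fin (sampleSize nT nS k.succ) => ε ki.1.succ ki.2 :=
  hε.precomp (Function.Injective.sigma_map (β₂ := fun k => Fin (sampleSize nT nS k))
    (f₂ := fun _ => id) (Fin.succ_injective K) fun _ => Function.injective_id)

variable [IsProbabilityMeasure μ]

theorem IsGaussianNoise.measureReal_exists_lt_abs_sum_score_le
    (hε : IsGaussianNoise μ σ
      fun ki : (k : Fin (K + 1)) × Fin (sampleSize nT nS k) => ε ki.1 ki.2)
    (hp : 2 ≤ p) (hnT : 0 < nT) (h_col : ∀ k j, ∑ i, x k i j ^ 2 ≤ sampleSize nT nS k * U)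
    (hv : σ ^ 2 * U ≤ v) (ha : 2 + v / 2 ≤ a) :
    μ.real {ω | ∃ j, a * √(totalSize K nT nS * Real.log p)
      < |(∑ k, score (x k) fun i => ε k i ω) j|} ≤ 2 / p := by
  have h_sum (ω : Ω) : ∑ k, score (x k) (fun i => ε k i ω)
      = score (fun ki : (k : Fin (K + 1)) × Fin (sampleSize nT nS k) => x ki.1 ki.2)
        fun ki => ε ki.1 ki.2 ω := by
    simp only [score, Fintype.sum_sigma]
  simp only [h_sum]
  refine (hε.measureReal_exists_lt_abs_score_le hp (totalSize_pos hnT) (fun j => ?_) hv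
    (r := 1) (by push_cast; linarith)).trans_eq (by rw [pow_one])
  rw [Fintype.sum_sigma, ← sum_sampleSize, Finset.sum_mul]
  exact Finset.sum_le_sum fun k _ => h_col k j

theorem IsGaussianNoise.measureReal_not_noiseRegular_le_of_le
    (hε : IsGaussianNoise μ σ
      fun ki : (k : Fin (K + 1)) × Fin (sampleSize nT nS k) => ε ki.1 ki.2)
    (hp : 2 ≤ p) (hnT : 0 < nT) (hnS : 0 < nS) (hK : K ≤ p)
    (h_col : ∀ k j, ∑ i, x k i j ^ 2 ≤ sampleSize nT nS k * U)
    (hv : σ ^ 2 * U ≤ v) (hc₀ : 4 + v ≤ c₀) (hc₁ : 4 + v ≤ c₁) :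
    μ.real {ω | ¬ NoiseRegular c₀ c₁ x fun k i => ε k i ω} ≤ 6 / p := by
  have := v.coe_nonneg
  have h_target := (hε.block 0).measureReal_exists_lt_abs_score_le (r := 1) (a := c₁ / 2) hp
    (by exact_mod_cast hnT) (h_col 0) hv (by push_cast; linarith)
  have h_total := hε.measureReal_exists_lt_abs_sum_score_le (a := c₀ / 2) hp hnT h_col hv
    (by linarith)
  have h_source := measureReal_exists_le fun k : Fin K =>
    (hε.block k.succ).measureReal_exists_lt_abs_score_le (r := 2) (a := 4 * c₀) hp
      (by exact_mod_cast hnS) (h_col k.succ) hv (by push_cast; linarith)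
  refine (measureReal_mono fun ω hω => ?_).trans
    ((measureReal_or_le h_target (measureReal_or_le h_total h_source)).trans ?_)
  · by_contra h_not
    simp only [Set.mem_ofPred_eq, not_or, not_exists, not_lt] at h_not
    exact hω ⟨∅, 0, isNoiseFit_empty h_not.1 h_not.2.1 h_not.2.2⟩
  · have : (0 : ℝ) < p := by positivity
    rw [Fintype.card_fin, pow_one]
    have h_sources : K * (2 / (p : ℝ) ^ 2) ≤ 2 / p := by
      calc K * (2 / (p : ℝ) ^ 2) ≤ p * (2 / (p : ℝ) ^ 2) := by gcongr
        _ = 2 / (p : ℝ) := by field_simp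
    have h_sum : 2 / (p : ℝ) + (2 / p + 2 / p) = 6 / p := by ring
    linarith

/-- The constant in the failure probability of the regularity of the errors, for designs of the
sources with smallest eigenvalue at least `γ` and columns of mean square at most `U`. -/
noncomputable def noiseConst (γ U : ℝ) : ℝ := 14 + 16 / γ ^ 2 + 256 * U / γ

theorem le_noiseConst (hγ : 0 ≤ γ) (hU : 0 ≤ U) : 14 ≤ noiseConst γ U := by
  have : 0 ≤ 16 / γ ^ 2 + 256 * U / γ := by positivity
  unfold noiseConst
  linarith

theorem IsGaussianNoise.measureReal_not_noiseRegular_le_of_mul_norm_sq_le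
    (hε : IsGaussianNoise μ σ
      fun ki : (k : Fin (K + 1)) × Fin (sampleSize nT nS k) => ε ki.1 ki.2)
    (hp : 2 ≤ p) (hK : 1 ≤ K) (hnT : 0 < nT) (hnS : 0 < nS) (hU : 0 ≤ U)
    (h_col : ∀ k j, ∑ i, x k i j ^ 2 ≤ sampleSize nT nS k * U) (hγ : 0 < γ)
    (hx : ∀ (k : Fin K) w, γ * nS * ‖w‖ ^ 2 ≤ predSq (x k.succ) w)
    (hv : σ ^ 2 * U ≤ v) (hc₀ : 8 + 2 * v ≤ c₀) (hc₁ : 4 + v ≤ c₁) :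
    μ.real {ω | ¬ NoiseRegular c₀ c₁ x fun k i => ε k i ω} ≤ noiseConst γ U / p := by
  have := v.coe_nonneg
  have hn : (0 : ℝ) < nS := by exact_mod_cast hnS
  have hN := totalSize_pos (K := K) (nS := nS) hnT
  have hnN : Fintype.card (Fin K) * (nS : ℝ) ≤ totalSize K nT nS := by
    rw [Fintype.card_fin]
    exact le_add_of_nonneg_right (Nat.cast_nonneg nT)
  have : Nonempty (Fin K) := ⟨⟨0, hK⟩⟩
  have hL : 0 ≤ 8 * c₀ * √(nS * Real.log p) := by
    have : 0 ≤ c₀ := by linarith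
    positivity
  choose D hD using fun k : Fin K => exists_isTruncatedLassoFit (mul_pos hγ hn) hL (hx k)
    (4 * c₀ * √(nS * Real.log p))
  have h_col' (k : Fin K) := h_col k.succ
  have ha : 6 + 2 * v ≤ 4 * c₀ := by linarith
  have h_target := (hε.block 0).measureReal_exists_lt_abs_score_le (r := 1) (a := c₁ / 2) hp
    (by exact_mod_cast hnT) (h_col 0) hv (by push_cast; linarith)
  have h_total := hε.measureReal_exists_lt_abs_sum_score_le (a := c₀ / 4) hp hnT h_col hv
    (by linarith)
  have h_excess := IsGaussianNoise.measureReal_le_sum_excess_le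
    (x := fun k : Fin K => x k.succ) (ξ := fun k : Fin K => ε k.succ) hε.sources hp hn h_col' hv ha
  have h_fit := IsGaussianNoise.measureReal_exists_lt_abs_sum_lassoFit_le
    (x := fun k : Fin K => x k.succ) (ξ := fun k : Fin K => ε k.succ) hε.sources hp hn hnN hN
    h_col' hv ha hγ hL hx hD
  have h_gram := IsGaussianNoise.measureReal_exists_lt_abs_sum_gramMul_le
    (x := fun k : Fin K => x k.succ) (ξ := fun k : Fin K => ε k.succ) hε.sources hp hn hnN hN hU
    h_col' hv ha hγ hL hx hD (by linarith : 1 ≤ c₀)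
  rw [Fintype.card_fin] at h_excess
  refine (measureReal_mono fun ω hω => ?_).trans ((measureReal_or_le h_target (measureReal_or_le
    h_total (measureReal_or_le h_excess (measureReal_or_le h_fit h_gram)))).trans_eq ?_)
  · by_contra h_not
    simp only [Set.mem_ofPred_eq, not_or, not_exists, not_lt, not_le] at h_not
    obtain ⟨h₁, h₂, h₃, h₄, h₅⟩ := h_not
    exact hω (exists_isNoiseFit_of_truncatedLassoFit hp hnT hnS (by linarith) hD h₁ h₂ h₃.le h₄ h₅)
  · rw [noiseConst, pow_one]
    ring

theorem DesignRegular.mul_norm_sq_le {n : ℕ} {l : ℝ} {x : Fin n → EuclideanSpace ℝ (Fin p)}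
    (hx : DesignRegular C₁ C₂ C₄ l x) (hl : 0 ≤ l) (hC₁ : 0 < C₁) (hC₂ : 0 ≤ C₂)
    (hn : 4 * C₂ ^ 2 * (l * p) ≤ n) (w : EuclideanSpace ℝ (Fin p)) :
    1 / (4 * C₁ ^ 2) * n * ‖w‖ ^ 2 ≤ predSq x w := by
  have h_sq := pow_le_pow_left₀ (by positivity) (hx.sqrt_mul_norm_le hl hC₂ hn w) 2
  rw [mul_pow, mul_pow, Real.sq_sqrt (Nat.cast_nonneg n), Real.sq_sqrt (predSq_nonneg x w)] at h_sq
  rw [mul_assoc, one_div_mul_eq_div, div_le_iff₀ (by positivity)]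
  linarith

theorem Scaling.measureReal_not_noiseRegular_le (hs : Scaling CT η p s nT nS h)
    (hε : IsGaussianNoise μ σ
      fun ki : (k : Fin (K + 1)) × Fin (sampleSize nT nS k) => ε ki.1 ki.2)
    (hC₁ : 0 < C₁) (hC₂ : 0 ≤ C₂) (hC₄ : 0 ≤ C₄) (hη : (100 * C₂) ^ 2 * η ≤ 1)
    (hx : ∀ k, DesignRegular C₁ C₂ C₄ (Real.log p) (x k))
    (hv : σ ^ 2 * (C₄ * (1 + CT)) ≤ v) (hc₀ : 8 + 2 * v ≤ c₀) (hc₁ : 4 + v ≤ c₁) :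
    μ.real {ω | ¬ NoiseRegular c₀ c₁ x fun k i => ε k i ω}
      ≤ noiseConst (1 / (4 * C₁ ^ 2)) (C₄ * (1 + CT)) / p := by
  have hp := hs.two_le_dim
  have hnT := hs.size_target_pos
  have hCT : 0 ≤ CT := (div_nonneg hs.log_pos.le (Nat.cast_nonneg nT)).trans hs.log_div_le
  have hU : 0 ≤ C₄ * (1 + CT) := by positivity
  have h_col (k) (j) : ∑ i, x k i j ^ 2 ≤ sampleSize nT nS k * (C₄ * (1 + CT)) :=
    sum_sq_le_of_predSq_le hC₄ (hnT.trans_le (le_sampleSize hs.size_le k))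
      (hs.log_le_mul_sampleSize k) (hx k).upper j
  rcases le_or_gt K p with hKp | hpK
  · refine (hε.measureReal_not_noiseRegular_le_of_le hp hnT hs.size_source_pos hKp h_col hv
      (by linarith [v.coe_nonneg]) hc₁).trans ?_
    gcongr
    linarith [le_noiseConst (γ := 1 / (4 * C₁ ^ 2)) (by positivity) hU]
  · exact hε.measureReal_not_noiseRegular_le_of_mul_norm_sq_le hp hs.one_le_sources hnT
      hs.size_source_pos hU h_col (by positivity) (fun k w => (hx k.succ).mul_norm_sq_le
        hs.log_pos.le hC₁ hC₂ (hs.four_mul_sq_mul_le hη hpK.le) w) hv hc₀ hc₁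

end NoiseRegularProbability

section Assembly

variable {p K nT nS s : ℕ} {Ω : Type*} [MeasurableSpace Ω] {μ : Measure Ω}

theorem natCast_mul_exp_neg_le (hp : 2 ≤ p) (hK : 1 ≤ K) {t : ℝ} (ht : 2 * K * Real.log p ≤ t) :
    K * Real.exp (-t) ≤ Real.exp (-Real.log p) := by
  have hl : 0 < Real.log p := Real.log_pos (by exact_mod_cast hp)
  have hK' : (1 : ℝ) ≤ K := by exact_mod_cast hK
  have h_le_exp : (K : ℝ) ≤ Real.exp (K * Real.log p) := by
    rw [Real.exp_nat_mul, Real.exp_log (by exact_mod_cast (by omega : 0 < p))]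
    exact_mod_cast (Nat.lt_pow_self hp).le
  calc K * Real.exp (-t) ≤ Real.exp (K * Real.log p) * Real.exp (-(2 * K * Real.log p)) := by gcongr
    _ = Real.exp (-(K * Real.log p)) := by rw [← Real.exp_add]; ring_nf
    _ ≤ Real.exp (-Real.log p) := by gcongr; exact le_mul_of_one_le_left hl.le hK'

theorem exists_measurableSet_of_measureReal_not_le [IsProbabilityMeasure μ] {P : Ω → Prop} {δ : ℝ}
    (h : μ.real {ω | ¬ P ω} ≤ δ) : ∃ E, MeasurableSet E ∧ 1 - δ ≤ μ.real E ∧ ∀ ω ∈ E, P ω := by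
  have h_meas := measurableSet_toMeasurable μ {ω | ¬ P ω}
  refine ⟨_, h_meas.compl, ?_, fun ω hω => ?_⟩
  · rw [probReal_compl_eq_one_sub h_meas, measureReal_def, measure_toMeasurable, ← measureReal_def]
    linarith
  · exact not_not.1 fun h_not => hω (subset_toMeasurable μ _ h_not)

theorem isClosed_setOf_forall_designRegular (C₁ C₂ C₄ l : ℝ) :
    IsClosed {x : Designs p K nT nS | ∀ k, DesignRegular C₁ C₂ C₄ l (x k)} := by
  rw [Set.ofPred_forall]
  exact isClosed_iInter fun k =>
    (isClosed_setOf_designRegular C₁ C₂ C₄ l).preimage (continuous_apply k)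

namespace Scaling

variable {c σ CT η C₁ C₂ C₄ c₀ c₁ a δ : ℝ} {v κ V : ℝ≥0} {h : Fin K → ℝ}
  {X : (k : Fin (K + 1)) → Fin (sampleSize nT nS k) → Ω → EuclideanSpace ℝ (Fin p)}
  {ε : (k : Fin (K + 1)) → Fin (sampleSize nT nS k) → Ω → ℝ}
  {Cov : Fin (K + 1) → Matrix (Fin p) (Fin p) ℝ} {β : Fin (K + 1) → EuclideanSpace ℝ (Fin p)}

theorem constant_pos (hs : Scaling CT η p s nT nS h) : 0 < CT :=
  (div_pos hs.log_pos (by exact_mod_cast hs.size_target_pos)).trans_le hs.log_div_le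

theorem sum_exp_neg_sampleSize_le (hs : Scaling CT η p s nT nS h) (ha : 0 ≤ a) (hη : η ≤ a / 2) :
    ∑ k : Fin (K + 1), Real.exp (-a * sampleSize nT nS k)
      ≤ Real.exp (-(a / CT * Real.log p)) + Real.exp (-Real.log p) := by
  rw [Fin.sum_univ_succ]
  simp only [sampleSize, Fin.cons_zero, Fin.cons_succ, Finset.sum_const, Finset.card_univ,
    Fintype.card_fin, nsmul_eq_mul, neg_mul]
  refine add_le_add ?_ (natCast_mul_exp_neg_le hs.two_le_dim hs.one_le_sources ?_)
  · refine Real.exp_le_exp.2 (neg_le_neg ?_)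
    rw [div_mul_eq_mul_div, div_le_iff₀ hs.constant_pos, mul_assoc, mul_comm (nT : ℝ)]
    exact mul_le_mul_of_nonneg_left (hs.log_le_mul_sampleSize 0) ha
  · have h_drift : η * nS ≤ a / 2 * nS := by gcongr
    linarith [hs.sources_mul_log_le]

theorem measureReal_not_forall_designRegular_le [IsProbabilityMeasure μ]
    (hs : Scaling CT η p s nT nS h) (hc : 0 < c) (hV : 0 < V) (hκ : κ ≤ V)
    (hη : η ≤ designRate c V / 2) (hX : SubGaussianDesign μ c κ X Cov) :
    μ.real {ω | ¬ ∀ k, DesignRegular √(2 * c) √(designLowerConst c V CT) (designUpperConst V CT)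
      (Real.log p) fun i => X k i ω}
      ≤ 2 * (Real.exp (-(designRate c V / CT * Real.log p)) + Real.exp (-Real.log p)) := by
  simp only [not_forall, Set.ofPred_exists]
  refine (measureReal_iUnion_fintype_le _).trans ((Finset.sum_le_sum fun k _ =>
    (hX.subGaussianRows hκ k).measureReal_not_designRegular_le hc hV hs.constant_pos.le
      hs.two_le_dim (hs.size_target_pos.trans_le (le_sampleSize hs.size_le k))
      (hs.log_le_mul_sampleSize k)).trans ?_)
  rw [← Finset.mul_sum]
  gcongr
  exact hs.sum_exp_neg_sampleSize_le (designRate_pos hc (by exact_mod_cast hV)).le hη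

theorem measureReal_not_regular_le [IsProbabilityMeasure μ] (hs : Scaling CT η p s nT nS h)
    (hX : ∀ k i, Measurable (X k i)) (hε : GaussianErrors μ σ X ε)
    (hC₁ : 0 < C₁) (hC₂ : 0 ≤ C₂) (hC₄ : 0 ≤ C₄) (hη : (100 * C₂) ^ 2 * η ≤ 1)
    (hv : σ ^ 2 * (C₄ * (1 + CT)) ≤ v) (hc₀ : 8 + 2 * v ≤ c₀) (hc₁ : 4 + v ≤ c₁)
    (h_design : μ.real {ω | ¬ ∀ k, DesignRegular C₁ C₂ C₄ (Real.log p) fun i => X k i ω} ≤ δ) :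
    μ.real {ω | ¬ ((∀ k, DesignRegular C₁ C₂ C₄ (Real.log p) fun i => X k i ω) ∧
        NoiseRegular c₀ c₁ (fun k i => X k i ω) fun k i => ε k i ω)}
      ≤ δ + noiseConst (1 / (4 * C₁ ^ 2)) (C₄ * (1 + CT)) / p := by
  have hCT := hs.constant_pos
  have h_const := le_noiseConst (γ := 1 / (4 * C₁ ^ 2)) (U := C₄ * (1 + CT)) (by positivity)
    (by positivity)
  have h_noise := measureReal_le_of_indepFun (Y := fun ω k i => X k i ω) (Z := fun ω k i => ε k i ω)
    (measurable_pi_lambda _ fun k => measurable_pi_lambda _ fun i => hX k i)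
    (measurable_pi_lambda _ fun k => measurable_pi_lambda _ fun i => hε.measurable k i)
    hε.indep_design.symm (isClosed_setOf_forall_designRegular C₁ C₂ C₄ (Real.log p)).measurableSet
    (measurableSet_setOf_noiseRegular c₀ c₁).compl
    (δ := noiseConst (1 / (4 * C₁ ^ 2)) (C₄ * (1 + CT)) / p)
    (div_nonneg (by linarith) (Nat.cast_nonneg p)) fun x hx =>
      hs.measureReal_not_noiseRegular_le hε.isGaussianNoise hC₁ hC₂ hC₄ hη hx hv hc₀ hc₁
  refine (measureReal_mono fun ω hω => ?_).trans (measureReal_or_le h_design h_noise)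
  by_cases h_reg : ∀ k, DesignRegular C₁ C₂ C₄ (Real.log p) fun i => X k i ω
  · exact Or.inr ⟨h_reg, fun h_noise_reg => hω ⟨h_reg, h_noise_reg⟩⟩
  · exact Or.inl h_reg

end Scaling

/-- The constant `c₀ = c₁` of the tuning parameters. -/
noncomputable def tuningConst (σ V CT : ℝ) : ℝ :=
  8 + 2 * (σ ^ 2 * (designUpperConst V CT * (1 + CT)))

/-- The bound `η` on the drift `h̄ √(log p / n_T) + K s log p / n_S`. -/
noncomputable def driftConst (c V CT : ℝ) : ℝ :=
  min 1 (min (designRate c V / 2) (1 / (1 + (100 * √(designLowerConst c V CT)) ^ 2)))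

/-- The factor of the exponential in the failure probability of the two-step estimator. -/
noncomputable def failureConst (c V CT : ℝ) : ℝ :=
  4 + noiseConst (1 / (4 * √(2 * c) ^ 2)) (designUpperConst V CT * (1 + CT))

/-- The exponent in the failure probability of the two-step estimator. -/
noncomputable def failureRate (c V CT : ℝ) : ℝ := min 1 (designRate c V / CT)

/-- The factor of the rate in the error bound of the two-step estimator. -/
noncomputable def riskConst (c σ V CT : ℝ) : ℝ :=
  errorConst √(2 * c) √(designLowerConst c V CT) (designUpperConst V CT) CT
    (tuningConst σ V CT) (tuningConst σ V CT)

section Constants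

variable {c σ V CT : ℝ}

theorem tuningConst_pos (hV : 0 < V) (hCT : 0 ≤ CT) : 0 < tuningConst σ V CT := by
  have := designUpperConst_pos hV hCT
  unfold tuningConst
  positivity

theorem driftConst_pos (hc : 0 < c) (hV : 0 < V) : 0 < driftConst c V CT := by
  have := designRate_pos hc hV
  unfold driftConst
  positivity

theorem sq_mul_driftConst_le (hc : 0 < c) (hV : 0 < V) :
    (100 * √(designLowerConst c V CT)) ^ 2 * driftConst c V CT ≤ 1 := by
  have h_le : driftConst c V CT ≤ 1 / (1 + (100 * √(designLowerConst c V CT)) ^ 2) :=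
    (min_le_right _ _).trans (min_le_right _ _)
  have := sq_nonneg (100 * √(designLowerConst c V CT))
  rw [le_div_iff₀ (by positivity)] at h_le
  linarith [driftConst_pos (CT := CT) hc hV]

theorem one_le_failureConst (hc : 0 < c) (hV : 0 < V) (hCT : 0 ≤ CT) : 1 ≤ failureConst c V CT := by
  have := designUpperConst_pos hV hCT
  have h_noise := le_noiseConst (γ := 1 / (4 * √(2 * c) ^ 2))
    (U := designUpperConst V CT * (1 + CT)) (by positivity) (by positivity)
  unfold failureConst
  linarith

theorem riskConst_nonneg : 0 ≤ riskConst c σ V CT := sq_nonneg _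

theorem two_mul_add_div_le_failureConst_mul_exp (hc : 0 < c) (hV : 0 < V) (hCT : 0 ≤ CT)
    (hp : 2 ≤ p) :
    2 * (Real.exp (-(designRate c V / CT * Real.log p)) + Real.exp (-Real.log p))
        + noiseConst (1 / (4 * √(2 * c) ^ 2)) (designUpperConst V CT * (1 + CT)) / p
      ≤ failureConst c V CT * Real.exp (-failureRate c V CT * Real.log p) := by
  have hl : 0 < Real.log p := Real.log_pos (by exact_mod_cast hp)
  have := designUpperConst_pos hV hCT
  have h_noise := le_noiseConst (γ := 1 / (4 * √(2 * c) ^ 2))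
    (U := designUpperConst V CT * (1 + CT)) (by positivity) (by positivity)
  have h_target : Real.exp (-(designRate c V / CT * Real.log p))
      ≤ Real.exp (-failureRate c V CT * Real.log p) := by
    rw [neg_mul]
    gcongr
    exact min_le_right _ _
  have h_source : Real.exp (-Real.log p) ≤ Real.exp (-failureRate c V CT * Real.log p) := by
    rw [neg_mul]
    gcongr
    exact mul_le_of_le_one_left hl.le (min_le_left _ _)
  have h_inv : (p : ℝ)⁻¹ = Real.exp (-Real.log p) := by
    rw [Real.exp_neg, Real.exp_log (by positivity)]
  rw [div_eq_mul_inv _ (p : ℝ), h_inv, failureConst, add_mul]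
  have h_mul := mul_le_mul_of_nonneg_left h_source ((by norm_num : (0 : ℝ) ≤ 14).trans h_noise)
  linarith

end Constants

theorem Scaling.exists_measurableSet_norm_sub_sq_le [IsProbabilityMeasure μ] {c σ CT : ℝ}
    {κ V : ℝ≥0} {h : Fin K → ℝ}
    {X : (k : Fin (K + 1)) → Fin (sampleSize nT nS k) → Ω → EuclideanSpace ℝ (Fin p)}
    {ε : (k : Fin (K + 1)) → Fin (sampleSize nT nS k) → Ω → ℝ}
    {Cov : Fin (K + 1) → Matrix (Fin p) (Fin p) ℝ} {β : Fin (K + 1) → EuclideanSpace ℝ (Fin p)}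
    (hs : Scaling CT (driftConst c V CT) p s nT nS h) (hc : 0 < c) (hV : 0 < V) (hκ : κ ≤ V)
    (hβ : β ∈ parameterSpace s h) (hX : SubGaussianDesign μ c κ X Cov)
    (hε : GaussianErrors μ σ X ε) :
    ∃ E : Set Ω, MeasurableSet E ∧
      1 - failureConst c V CT * Real.exp (-failureRate c V CT * Real.log p) ≤ μ.real E ∧
      ∀ ω ∈ E, ∀ βhat, IsTwoStepEstimate (fun k i => X k i ω)
          (response β (fun k i => X k i ω) (fun k i => ε k i ω))
          (lambdaZero (tuningConst σ V CT) p s nT nS h) (weight p s nT nS h)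
          (lambdaTilde (tuningConst σ V CT) p nT) βhat →
        ‖βhat - β 0‖ ^ 2 ≤ riskConst c σ V CT * rate p s nT nS h := by
  have hCT := hs.constant_pos
  have hV' : (0 : ℝ) < V := by exact_mod_cast hV
  have hC₄ := designUpperConst_pos hV' hCT.le
  have hv : 0 ≤ σ ^ 2 * (designUpperConst V CT * (1 + CT)) := by positivity
  have h_drift := sq_mul_driftConst_le (CT := CT) hc hV'
  have h_tuning := tuningConst_pos (σ := σ) hV' hCT.le
  have h_prob := hs.measureReal_not_regular_le (v := NNReal.mk _ hv) (c₀ := tuningConst σ V CT)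
    (c₁ := tuningConst σ V CT) hX.measurable hε (Real.sqrt_pos.2 (by positivity : 0 < 2 * c))
    (Real.sqrt_nonneg _) hC₄.le h_drift le_rfl le_rfl
    (by rw [tuningConst, NNReal.coe_mk]; linarith)
    (hs.measureReal_not_forall_designRegular_le hc hV hκ
      ((min_le_right _ _).trans (min_le_left _ _)) hX)
  obtain ⟨E, hE, hE_prob, hE_reg⟩ := exists_measurableSet_of_measureReal_not_le
    (h_prob.trans (two_mul_add_div_le_failureConst_mul_exp hc hV' hCT.le hs.two_le_dim))
  refine ⟨E, hE, hE_prob, fun ω hω βhat h_est => ?_⟩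
  obtain ⟨h_design, B, d, hd⟩ := hE_reg ω hω
  exact hd.twoStep_error_le hs (Real.sqrt_nonneg _) (Real.sqrt_nonneg _) hC₄.le h_tuning h_tuning
    (min_le_left _ _) h_drift h_design hβ h_est

end Assembly

end TransFusion

theorem theorem2_general (c σ CT : ℝ) (κ : ℝ≥0) (hc : 0 < c) (hCT : 0 < CT) :
    ∃ c₀ c₁ c₂ c₃ C η : ℝ, 0 < c₀ ∧ 0 < c₁ ∧ 0 < c₂ ∧ 0 < c₃ ∧ 0 < C ∧ 0 < η ∧
      ∀ (K nT nS p s : ℕ), 1 ≤ K → 1 ≤ s → nT ≤ nS →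
      (s : ℝ) * Real.log p ≤ CT * nT →
      ∀ (h : Fin K → ℝ),
      TransFusion.hbar nT nS h * √(Real.log p / nT) + (K : ℝ) * s * Real.log p / nS ≤ η →
      ∀ (β : Fin (K + 1) → EuclideanSpace ℝ (Fin p)), β ∈ TransFusion.parameterSpace s h →
      ∀ (Ω : Type*) [MeasurableSpace Ω] (μ : Measure Ω) [IsProbabilityMeasure μ]
        (X : (k : Fin (K + 1)) → Fin (TransFusion.sampleSize nT nS k) → Ω →
          EuclideanSpace ℝ (Fin p))
        (ε : (k : Fin (K + 1)) → Fin (TransFusion.sampleSize nT nS k) → Ω → ℝ)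
        (Cov : Fin (K + 1) → Matrix (Fin p) (Fin p) ℝ),
      TransFusion.SubGaussianDesign μ c κ X Cov →
      TransFusion.GaussianErrors μ σ X ε →
      ∃ E : Set Ω, MeasurableSet E ∧ 1 - c₂ * Real.exp (-c₃ * Real.log p) ≤ μ.real E ∧
        ∀ ω ∈ E, ∀ βhat : EuclideanSpace ℝ (Fin p),
          TransFusion.IsTwoStepEstimate (fun k i => X k i ω)
            (TransFusion.response β (fun k i => X k i ω) (fun k i => ε k i ω))
            (TransFusion.lambdaZero c₀ p s nT nS h) (TransFusion.weight p s nT nS h)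
            (TransFusion.lambdaTilde c₁ p nT) βhat →
          ‖βhat - β 0‖ ^ 2 ≤
            C * ((s : ℝ) * Real.log p / TransFusion.totalSize K nT nS +
              TransFusion.hbar nT nS h * √(Real.log p / nT)) := by
  open TransFusion in
  open TransFusion in
  set V : ℝ≥0 := max κ 1
  have hV : 0 < V := lt_max_of_lt_right one_pos
  have hV' : (0 : ℝ) < V := hV
  have h_failure := one_le_failureConst hc hV' hCT.le
  have h_tuning := tuningConst_pos (σ := σ) hV' hCT.le
  refine ⟨tuningConst σ V CT, tuningConst σ V CT, failureConst c V CT, failureRate c V CT,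
    riskConst c σ V CT + 1, driftConst c V CT, h_tuning, h_tuning,
    one_pos.trans_le h_failure, lt_min one_pos (div_pos (designRate_pos hc hV') hCT),
    add_pos_of_nonneg_of_pos riskConst_nonneg one_pos, driftConst_pos hc hV', ?_⟩
  intro K nT nS p s hK hs hnTS hT h hη β hβ Ω _ μ _ X ε Cov hX hε
  rcases lt_or_ge p 2 with hp | hp
  · have h_log : Real.log p = 0 := by interval_cases p <;> simp
    exact ⟨∅, MeasurableSet.empty, by simpa [h_log] using h_failure, fun ω hω => hω.elim⟩
  have h_scaling : Scaling CT (driftConst c V CT) p s nT nS h :=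
    ⟨hp, hK, hs, hnTS, hT, hη, fun k => (l1norm_nonneg _).trans (hβ.2 k)⟩
  obtain ⟨E, hE, hE_prob, hE_le⟩ :=
    h_scaling.exists_measurableSet_norm_sub_sq_le hc hV (le_max_left κ 1) hβ hX hε
  refine ⟨E, hE, hE_prob, fun ω hω βhat h_est => (hE_le ω hω βhat h_est).trans ?_⟩
  exact mul_le_mul_of_nonneg_right (le_add_of_nonneg_right zero_le_one) h_scaling.rate_nonneg

theorem theorem2 (c σ CT CS : ℝ) (κ : ℝ≥0)
    (hc : 0 < c) (hσ : 0 ≤ σ) (hCT : 0 < CT) (hCS : 0 < CS) :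
    ∃ c₀ c₁ c₂ c₃ C η : ℝ, 0 < c₀ ∧ 0 < c₁ ∧ 0 < c₂ ∧ 0 < c₃ ∧ 0 < C ∧ 0 < η ∧
      ∀ (K nT nS p s : ℕ), 1 ≤ K → 1 ≤ s → nT ≤ nS →
      (s : ℝ) * Real.log p ≤ CT * nT →
      (K : ℝ) ^ 2 * s * Real.log p ≤ CS * nS →
      ∀ (h : Fin K → ℝ),
      TransFusion.hbar nT nS h * √(Real.log p / nT) + (K : ℝ) * s * Real.log p / nS ≤ η →
      ∀ (β : Fin (K + 1) → EuclideanSpace ℝ (Fin p)), β ∈ TransFusion.parameterSpace s h →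
      ∀ (Ω : Type*) [MeasurableSpace Ω] (μ : Measure Ω) [IsProbabilityMeasure μ]
        (X : (k : Fin (K + 1)) → Fin (TransFusion.sampleSize nT nS k) → Ω →
          EuclideanSpace ℝ (Fin p))
        (ε : (k : Fin (K + 1)) → Fin (TransFusion.sampleSize nT nS k) → Ω → ℝ)
        (Cov : Fin (K + 1) → Matrix (Fin p) (Fin p) ℝ),
      TransFusion.SubGaussianDesign μ c κ X Cov →
      TransFusion.GaussianErrors μ σ X ε →
      ∃ E : Set Ω, MeasurableSet E ∧ 1 - c₂ * Real.exp (-c₃ * Real.log p) ≤ μ.real E ∧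
        ∀ ω ∈ E, ∀ βhat : EuclideanSpace ℝ (Fin p),
          TransFusion.IsTwoStepEstimate (fun k i => X k i ω)
            (TransFusion.response β (fun k i => X k i ω) (fun k i => ε k i ω))
            (TransFusion.lambdaZero c₀ p s nT nS h) (TransFusion.weight p s nT nS h)
            (TransFusion.lambdaTilde c₁ p nT) βhat →
          ‖βhat - β 0‖ ^ 2 ≤
            C * ((s : ℝ) * Real.log p / TransFusion.totalSize K nT nS +
              TransFusion.hbar nT nS h * √(Real.log p / nT)) := by
  open TransFusion in
  obtain ⟨c₀, c₁, c₂, c₃, C, η, hc₀, hc₁, hc₂, hc₃, hC, hη, h⟩ := theorem2_general c σ CT κ hc hCT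
  exact ⟨c₀, c₁, c₂, c₃, C, η, hc₀, hc₁, hc₂, hc₃, hC, hη,
    fun K nT nS p s hK hs hnTS hT _ => h K nT nS p s hK hs hnTS hT⟩
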